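/- All posets are finite. Let $P$ be a bounded poset of rank $k$ (every maximal chain has length $k$). A root of $x\in P$ is a maximal chain $\mathbf r$ of $[\hat 0,x]$; a chain edge labeling $\lambda$ of $P$ assigns to each rooted cover relation $(\mathbf r,x\lessdot y)$ an element of a totally ordered set. A maximal chain $x=x_0\lessdot x_1\lessdot\dots\lessdot x_n=y$ of a rooted interval $[x,y]_{\mathbf r}$ is labeled by the word of labels of $(\mathbf r\cup\{x_1,\dots,x_i\},\,x_i\lessdot x_{i+1})$, $0\le i<n$; it is *increasing* if this word is strictly increasing and *descending* if the word has no ascent, i.e. is weakly decreasing. $\lambda$ is a *$CL$-labeling* if every rooted interval has a unique increasing maximal chain, and this chain is lexicographically first among the maximal chains of the rooted interval. Let $\{\Sigma_s\}$ be a finite, linearly ordered collection of rank $k$ (induced) subposets of $P$. Write $\mathcal M(\Sigma_s)$ for the set of maximal chains of $\Sigma_s$, let $\mathcal M(\Delta_s)=\mathcal M(\Sigma_s)\setminus\bigcup_{t<s}\mathcal M(\Sigma_t)$, and let $\Delta_s$ be the simplicial complex whose faces are the subsets of members of $\mathcal M(\Delta_s)$. The collection $\{\Sigma_s\}$ is a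 *$CL$-ced* of $P$ with respect to a $CL$-labeling $\lambda$ of $P$ if 1. each $\Sigma_s$ is isomorphic to the face lattice of a convex polytope; 2. for each $s$ and each rooted interval $[x,y]_{\mathbf r}$ of $P$, at most one descending maximal chain of $[x,y]_{\mathbf r}$ is a face of $\Delta_s$; 3. if $t<s$ and $\mathbf c$ is a chain of length $<k$ that extends both to a chain in $\mathcal M(\Delta_s)$ and to a chain in $\mathcal M(\Delta_t)$, then $\mathbf c$ extends to a chain in $\mathcal M(\Sigma_s)\setminus\mathcal M(\Delta_s)$; 4. every chain of $P$ is contained in some $\Sigma_s$. For bounded posets $P_1,P_2$, let $P_1\times P_2$ be the direct product (with the componentwise order), and let $$P_1\mathbin{\check\times}P_2=\big((P_1\setminus\{\hat 0\})\times(P_2\setminus\{\hat 0\})\big)\cup\{\hat 0\},\qquad P_1\mathbin{\hat\times}P_2=\big((P_1\setminus\{\hat 1\})\times(P_2\setminus\{\hat 1\})\big)\cup\{\hat 1\}$$ be the lower and upper reduced products, regarded as subposets of $P_1\times P_2$, where $\hat 0=(\hat 0,\hat 0)$ and $\hat 1=(\hat 1,\hat 1)$. Let $\lambda_1,\lambda_2$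 be $CL$-labelings of $P_1,P_2$ with disjoint totally ordered label sets $S_1,S_2$, and let $S_1\cup S_2$ be totally ordered by a shuffle of $S_1$ and $S_2$ (a total order extending both given orders). The *product labeling* $\lambda_1\times\lambda_2$ labels a rooted cover relation $(\mathbf r,x\lessdot y)$ of $P_1\times P_2$ by $\lambda_i(p_i(\mathbf r),p_i(x)\lessdot p_i(y))$, where $p_1,p_2$ are the coordinate projections and $i$ is the coordinate with $p_i(x)\neq p_i(y)$. A labeling with label set $S$ is *orderly* if $S$ is partitioned as $S^-<S^A<S^+$ such that rooted cover relations $\hat 0\lessdot y$ have labels in $S^A$ and all other rooted cover relations have labels in $S^-\cup S^+$; it is *co-orderly* if the same holds with the relations $x\lessdot\hat 1$ in place of $\hat 0\lessdot y$. If $\lambda_1,\lambda_2$ are both orderly (respectively, both co-orderly), shuffle their label sets as $S_1^-<S_2^-<S_1^A<S_2^A<S_1^+<S_2^+$. The *lower reduced product labeling* $\lambda_1\mathbin{\check\times}\lambda_2$ of $P_1\mathbin{\check\times}P_2$ (respectively, the *upper reduced product labeling* $\lambda_1\mathbin{\hat\times}\lambda_2$ of $P_1\mathbin{\hat\times}P_2$)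 labels a rooted cover relation $(\mathbf r,x\lessdot y)$ with $x=\hat 0$ (respectively, $y=\hat 1$) by the two-letter word $$\lambda_1\big(p_1(\mathbf r),p_1(x)\lessdot p_1(y)\big)\,\lambda_2\big(p_2(\mathbf r),p_2(x)\lessdot p_2(y)\big),$$ and every other rooted cover relation by its label (a one-letter word) under $\lambda_1\times\lambda_2$; words over $S_1\cup S_2$ are ordered lexicographically. **Theorem.** Let $P_1,P_2$ be bounded posets with $CL$-ceds $\{\Sigma^{(1)}_s\}$, $\{\Sigma^{(2)}_t\}$ with respect to $CL$-labelings $\lambda_1,\lambda_2$ with disjoint totally ordered label sets. In each of the following cases let $\Sigma_{s,t}$ be the corresponding (direct, lower reduced, upper reduced) product of $\Sigma^{(1)}_s$ and $\Sigma^{(2)}_t$, and order these subposets lexicographically by $(s,t)$. 1. For every shuffle of the label sets, $\{\Sigma_{s,t}\}$ is a $CL$-ced of $P_1\times P_2$ with respect to the $CL$-labeling $\lambda_1\times\lambda_2$. 2. If $\lambda_1,\lambda_2$ are orderly, then $\{\Sigma_{s,t}\}$ is a $CL$-ced of $P_1\mathbin{\check\times}P_2$ with respect to the $CL$-labeling $\lambda_1\mathbin{\check\times}\lambda_2$.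 3. If $\lambda_1,\lambda_2$ are co-orderly, then $\{\Sigma_{s,t}\}$ is a $CL$-ced of $P_1\mathbin{\hat\times}P_2$ with respect to the $CL$-labeling $\lambda_1\mathbin{\hat\times}\lambda_2$. -/

import Mathlib

/-! ### Chains, roots and rank -/

/-- `c` is a maximal chain of the subset `S` of `P` (with the induced order). -/
def IsMaximalChainOf {P : Type*} [PartialOrder P] (S c : Set P) : Prop :=
  Maximal (fun d : Set P => d ⊆ S ∧ IsChain (· ≤ ·) d) c

/-- The induced subposet `S` has rank `k`: every maximal chain has length `k`, that is, it has
`k + 1` elements. -/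
def HasRank {P : Type*} [PartialOrder P] (S : Set P) (k : ℕ) : Prop :=
  ∀ c : Set P, IsMaximalChainOf S c → c.ncard = k + 1

/-- `r` is a root for `x`: a maximal chain from the bottom element to `x` (both included). -/
def IsRoot {P : Type*} [PartialOrder P] (r : Set P) (x : P) : Prop :=
  IsMaximalChainOf (Set.Iic x) r

/-- The list `l` describes a maximal chain `x ⋖ l₁ ⋖ ⋯ ⋖ lₙ = y` on the interval `[x, y]`
(its starting point `x` is not repeated in `l`). -/
def IsIntervalChain {P : Type*} [PartialOrder P] (x y : P) (l : List P) : Prop :=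
  List.IsChain (· ⋖ ·) (x :: l) ∧ (x :: l).getLast (List.cons_ne_nil x l) = y

/-! ### Chain edge labelings -/

/-- A chain edge labeling of `P`: the rooted cover relation `(r, x ⋖ y)` gets the label `lam r x y`.
Only the values at rooted cover relations (`IsRoot r x` and `x ⋖ y`) ever matter. -/
abbrev ChainEdgeLabeling (P Λ : Type*) := Set P → P → P → Λ

/-- The word of labels, read from the bottom, along the rooted chain `x ⋖ l₁ ⋖ l₂ ⋖ ⋯`
with root `r`. -/
def labelWord {P Λ : Type*} (lam : ChainEdgeLabeling P Λ) : Set P → P → List P → List Λ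
  | _, _, [] => []
  | r, x, z :: l => lam r x z :: labelWord lam (insert z r) z l

/-- Increasing words of labels: each label is strictly smaller than the next one. -/
def IsIncreasingWord {Λ : Type*} [LinearOrder Λ] (w : List Λ) : Prop :=
  List.IsChain (· < ·) w

/-- Descending words of labels: no ascents, that is, each label is at least the next one. -/
def IsDescendingWord {Λ : Type*} [LinearOrder Λ] (w : List Λ) : Prop :=
  List.IsChain (· ≥ ·) w

/-- `CL`-labelings: every rooted interval `[x, y]_r` has a unique increasing maximal chain, and
this chain is lexicographically first among all maximal chains of the rooted interval. -/
def IsCLLabeling {P Λ : Type*} [PartialOrder P] [LinearOrder Λ]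
    (lam : ChainEdgeLabeling P Λ) : Prop :=
  ∀ (r : Set P) (x y : P), IsRoot r x → x ≤ y →
    ∃ l : List P, IsIntervalChain x y l ∧ IsIncreasingWord (labelWord lam r x l) ∧
      (∀ l' : List P, IsIntervalChain x y l' → IsIncreasingWord (labelWord lam r x l') →
        l' = l) ∧
      (∀ l' : List P, IsIntervalChain x y l' → l' ≠ l →
        List.Lex (· < ·) (labelWord lam r x l) (labelWord lam r x l'))

/-! ### Face lattices of polytopes -/

/-- `L` is isomorphic to the face lattice of a convex polytope. The faces of the convex hull `X` of
finitely many points, including `∅` and `X` itself, are exactly the exposed subsets of `X`. -/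
def IsPolytopeFaceLattice (L : Type*) [PartialOrder L] : Prop :=
  ∃ (n : ℕ) (V : Finset (Fin n → ℝ)),
    Nonempty (L ≃o {F : Set (Fin n → ℝ) // IsExposed ℝ (convexHull ℝ (V : Set (Fin n → ℝ))) F})

/-! ### `CL`-ceds -/

/-- The maximal chains of the ear `Δ_s`: the maximal chains of `Σ_s` which are not maximal chains
of any earlier `Σ_t`. -/
def newChains {P ι : Type*} [PartialOrder P] [LinearOrder ι] (Sig : ι → Set P) (s : ι) :
    Set (Set P) :=
  {m | IsMaximalChainOf (Sig s) m ∧ ∀ t, t < s → ¬ IsMaximalChainOf (Sig t) m}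

/-- The chain `c` is a face of the ear `Δ_s`, that is, it extends to a maximal chain of `Δ_s`. -/
def IsFaceOfEar {P ι : Type*} [PartialOrder P] [LinearOrder ι] (Sig : ι → Set P) (s : ι)
    (c : Set P) : Prop :=
  ∃ m ∈ newChains Sig s, c ⊆ m

/-- The ordered collection `Sig` of rank `k` subposets is a chain lexicographic convex ear
decomposition of the rank `k` poset `P` with respect to the `CL`-labeling `lam`. -/
structure IsCLcedOfRank {P Λ ι : Type*} [PartialOrder P] [LinearOrder Λ] [LinearOrder ι] (k : ℕ)
    (lam : ChainEdgeLabeling P Λ) (Sig : ι → Set P) : Prop where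
  rank_poset : HasRank (Set.univ : Set P) k
  rank_subposet : ∀ s, HasRank (Sig s) k
  labeling : IsCLLabeling lam
  polytope : ∀ s, IsPolytopeFaceLattice (Sig s)
  desc : ∀ (s : ι) (r : Set P) (x y : P), IsRoot r x → ∀ l l' : List P,
    IsIntervalChain x y l → IsDescendingWord (labelWord lam r x l) →
      IsFaceOfEar Sig s {a | a ∈ x :: l} →
    IsIntervalChain x y l' → IsDescendingWord (labelWord lam r x l') →
      IsFaceOfEar Sig s {a | a ∈ x :: l'} →
    l = l'
  bdry : ∀ (s t : ι), t < s → ∀ c : Set P, IsChain (· ≤ ·) c → c.ncard < k + 1 →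
    IsFaceOfEar Sig s c → IsFaceOfEar Sig t c →
    ∃ m, IsMaximalChainOf (Sig s) m ∧ m ∉ newChains Sig s ∧ c ⊆ m
  union : ∀ c : Set P, IsChain (· ≤ ·) c → ∃ s, c ⊆ Sig s

/-- `Sig` is a `CL`-ced of `P` with respect to the `CL`-labeling `lam`. -/
def IsCLced {P Λ ι : Type*} [PartialOrder P] [LinearOrder Λ] [LinearOrder ι]
    (lam : ChainEdgeLabeling P Λ) (Sig : ι → Set P) : Prop :=
  ∃ k : ℕ, IsCLcedOfRank k lam Sig

/-! ### Reduced products of posets and of families of subposets -/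

/-- The lower reduced product `((P₁ ∖ {0̂}) × (P₂ ∖ {0̂})) ∪ {0̂}`, as a subposet of `P₁ × P₂`. -/
abbrev LowerProd (P₁ P₂ : Type*) [PartialOrder P₁] [BoundedOrder P₁] [PartialOrder P₂]
    [BoundedOrder P₂] :=
  {x : P₁ × P₂ // x = (⊥, ⊥) ∨ (x.1 ≠ ⊥ ∧ x.2 ≠ ⊥)}

/-- The upper reduced product `((P₁ ∖ {1̂}) × (P₂ ∖ {1̂})) ∪ {1̂}`, as a subposet of `P₁ × P₂`. -/
abbrev UpperProd (P₁ P₂ : Type*) [PartialOrder P₁] [BoundedOrder P₁] [PartialOrder P₂]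
    [BoundedOrder P₂] :=
  {x : P₁ × P₂ // x = (⊤, ⊤) ∨ (x.1 ≠ ⊤ ∧ x.2 ≠ ⊤)}

/-- The products `Σ_{s,t} = Σ_s × Σ_t` in `P₁ × P₂`, ordered lexicographically by `(s, t)`. -/
def prodFamily {P₁ P₂ ι₁ ι₂ : Type*} (Sig₁ : ι₁ → Set P₁) (Sig₂ : ι₂ → Set P₂) :
    ι₁ ×ₗ ι₂ → Set (P₁ × P₂) :=
  fun p => Sig₁ (ofLex p).1 ×ˢ Sig₂ (ofLex p).2

/-- The lower reduced products `Σ_{s,t}` of `Σ_s` and `Σ_t` in the lower reduced product of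
`P₁` and `P₂`, ordered lexicographically by `(s, t)`. -/
def lowerFamily {P₁ P₂ ι₁ ι₂ : Type*} [PartialOrder P₁] [BoundedOrder P₁] [PartialOrder P₂]
    [BoundedOrder P₂] (Sig₁ : ι₁ → Set P₁) (Sig₂ : ι₂ → Set P₂) :
    ι₁ ×ₗ ι₂ → Set (LowerProd P₁ P₂) :=
  fun p => {x | x.1 = (⊥, ⊥) ∨
    (x.1.1 ∈ Sig₁ (ofLex p).1 \ {⊥} ∧ x.1.2 ∈ Sig₂ (ofLex p).2 \ {⊥})}

/-- The upper reduced products `Σ_{s,t}` of `Σ_s` and `Σ_t` in the upper reduced product of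
`P₁` and `P₂`, ordered lexicographically by `(s, t)`. -/
def upperFamily {P₁ P₂ ι₁ ι₂ : Type*} [PartialOrder P₁] [BoundedOrder P₁] [PartialOrder P₂]
    [BoundedOrder P₂] (Sig₁ : ι₁ → Set P₁) (Sig₂ : ι₂ → Set P₂) :
    ι₁ ×ₗ ι₂ → Set (UpperProd P₁ P₂) :=
  fun p => {x | x.1 = (⊤, ⊤) ∨
    (x.1.1 ∈ Sig₁ (ofLex p).1 \ {⊤} ∧ x.1.2 ∈ Sig₂ (ofLex p).2 \ {⊤})}

/-! ### Orderly labelings, shuffles and product labelings -/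

/-- `lam` is orderly with respect to the partition `S⁻ < S^A < S⁺` of its label set into the
fibers of the monotone map `part` over `-1 < 0 < 1`: labels of rooted cover relations `0̂ ⋖ y` are
in `S^A`, labels of all other rooted cover relations are in `S⁻` or `S⁺`. -/
def IsOrderly {P Λ : Type*} [PartialOrder P] [BoundedOrder P] [LinearOrder Λ]
    (lam : ChainEdgeLabeling P Λ) (part : Λ → SignType) : Prop :=
  Monotone part ∧ ∀ (r : Set P) (x y : P), IsRoot r x → x ⋖ y →
    (x = ⊥ → part (lam r x y) = 0) ∧ (x ≠ ⊥ → part (lam r x y) ≠ 0)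

/-- `lam` is co-orderly with respect to the partition `S⁻ < S^A < S⁺` of its label set into the
fibers of `part`: labels of rooted cover relations `x ⋖ 1̂` are in `S^A`, labels of all other
rooted cover relations are in `S⁻` or `S⁺`. -/
def IsCoorderly {P Λ : Type*} [PartialOrder P] [BoundedOrder P] [LinearOrder Λ]
    (lam : ChainEdgeLabeling P Λ) (part : Λ → SignType) : Prop :=
  Monotone part ∧ ∀ (r : Set P) (x y : P), IsRoot r x → x ⋖ y →
    (y = ⊤ → part (lam r x y) = 0) ∧ (y ≠ ⊤ → part (lam r x y) ≠ 0)

/-- The totally ordered set `Λ` contains disjoint copies of `Λ₁` and `Λ₂`, and so orders their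
disjoint union by a shuffle. -/
structure IsShuffle {Λ₁ Λ₂ Λ : Type*} [LinearOrder Λ₁] [LinearOrder Λ₂] [LinearOrder Λ]
    (j₁ : Λ₁ → Λ) (j₂ : Λ₂ → Λ) : Prop where
  left : StrictMono j₁
  right : StrictMono j₂
  disjoint : ∀ a b, j₁ a ≠ j₂ b

/-- The particular shuffle `S₁⁻ < S₂⁻ < S₁^A < S₂^A < S₁⁺ < S₂⁺`. -/
structure IsOrderlyShuffle {Λ₁ Λ₂ Λ : Type*} [LinearOrder Λ₁] [LinearOrder Λ₂] [LinearOrder Λ]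
    (part₁ : Λ₁ → SignType) (part₂ : Λ₂ → SignType) (j₁ : Λ₁ → Λ) (j₂ : Λ₂ → Λ) : Prop
    extends IsShuffle j₁ j₂ where
  left_lt_right : ∀ a b, part₁ a ≤ part₂ b → j₁ a < j₂ b
  right_lt_left : ∀ a b, part₂ b < part₁ a → j₂ b < j₁ a

open Classical in
/-- The product labeling `λ₁ × λ₂`: a rooted cover relation is labeled by its projection to the
coordinate in which it moves. -/
noncomputable def prodLabeling {P₁ P₂ Λ₁ Λ₂ Λ : Type*} (j₁ : Λ₁ → Λ) (j₂ : Λ₂ → Λ)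
    (lam₁ : ChainEdgeLabeling P₁ Λ₁) (lam₂ : ChainEdgeLabeling P₂ Λ₂) :
    ChainEdgeLabeling (P₁ × P₂) Λ :=
  fun r x y =>
    if x.1 ≠ y.1 then j₁ (lam₁ (Prod.fst '' r) x.1 y.1)
    else j₂ (lam₂ (Prod.snd '' r) x.2 y.2)

open Classical in
/-- The lower reduced product labeling. Labels are words in the shuffled alphabet, ordered
lexicographically: rooted cover relations `0̂ ⋖ y` get the two-letter word of the labels of both
projections, all others the one-letter word of their label under the product labeling. -/
noncomputable def lowerLabeling {P₁ P₂ Λ₁ Λ₂ Λ : Type*} [PartialOrder P₁] [BoundedOrder P₁]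
    [PartialOrder P₂] [BoundedOrder P₂] (j₁ : Λ₁ → Λ) (j₂ : Λ₂ → Λ)
    (lam₁ : ChainEdgeLabeling P₁ Λ₁) (lam₂ : ChainEdgeLabeling P₂ Λ₂) :
    ChainEdgeLabeling (LowerProd P₁ P₂) (List Λ) :=
  fun r x y =>
    if x.1 = (⊥, ⊥) then
      [j₁ (lam₁ ((fun z => z.1.1) '' r) x.1.1 y.1.1), j₂ (lam₂ ((fun z => z.1.2) '' r) x.1.2 y.1.2)]
    else [prodLabeling j₁ j₂ lam₁ lam₂ (Subtype.val '' r) x.1 y.1]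

open Classical in
/-- The upper reduced product labeling. Labels are words in the shuffled alphabet, ordered
lexicographically: rooted cover relations `x ⋖ 1̂` get the two-letter word of the labels of both
projections, all others the one-letter word of their label under the product labeling. -/
noncomputable def upperLabeling {P₁ P₂ Λ₁ Λ₂ Λ : Type*} [PartialOrder P₁] [BoundedOrder P₁]
    [PartialOrder P₂] [BoundedOrder P₂] (j₁ : Λ₁ → Λ) (j₂ : Λ₂ → Λ)
    (lam₁ : ChainEdgeLabeling P₁ Λ₁) (lam₂ : ChainEdgeLabeling P₂ Λ₂) :
    ChainEdgeLabeling (UpperProd P₁ P₂) (List Λ) :=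
  fun r x y =>
    if y.1 = (⊤, ⊤) then
      [j₁ (lam₁ ((fun z => z.1.1) '' r) x.1.1 y.1.1), j₂ (lam₂ ((fun z => z.1.2) '' r) x.1.2 y.1.2)]
    else [prodLabeling j₁ j₂ lam₁ lam₂ (Subtype.val '' r) x.1 y.1]

/-! ### Interval chains as lists -/

section Chains

variable {P : Type*} [PartialOrder P]

/-! The three products share one argument. Each is a poset with two coordinate maps for which the
order is componentwise, a cover moves each coordinate by at most one cover, and a pair of full-rank
subposets pulls back to a saturated subposet (`IsProductLike`). Each labeling compares an earlier
and a later step that move the same coordinate exactly as the factor labeling does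
(`IsProductLabeling`). For the reduced products this is the purpose of the orderly shuffle: a letter
in the block `S₁^A` compares with the letters of `S₂⁻` and `S₂⁺` just as a letter in `S₂^A` does.

Labelings. Increasing and descending words stay so under projection
(`pairwise_labelWord_projChain`), and a chain with such a word is determined by its two projections
(`IsProductLabeling.eq_of_projChain_eq`). Indeed, if two such chains part, one moving only the first
coordinate and the other only the second, then the opening label of each occurs later in the other.
Monotonicity makes the two labels equal, although they come from disjoint alphabets. So uniqueness
of increasing chains, and of descending chains in an ear, is inherited from the factors.
Lexicographic minimality follows from a local exchange (`IsSwitchable`): a non-ascent can be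
replaced so that the word drops, so a chain with minimal word is increasing. Exchanges keep the
length, which also shows that the product is ranked.

Ears. A maximal chain is new in `Σ_{s,t}` iff both projections are new
(`IsProductLike.mem_newChains_iff`), and maximal chains of the factors through the projections of a
chain `c` lift to one maximal chain through `c` (`IsProductLike.exists_lift`). The boundary
condition is thus taken from a factor in which the index has dropped.

Polytopes. Direct, lower and upper reduced products of face lattices belong to joins, Cartesian
products and free sums of polytopes. A face is encoded by the indices of the spanning points at
which a linear functional attains an upper bound (`IsVertexFace`); a bound that is not attained
gives the empty face. -/

theorem isIntervalChain_nil {x y : P} : IsIntervalChain x y [] ↔ x = y := by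
  simp [IsIntervalChain]

theorem isIntervalChain_cons {x y z : P} {l : List P} :
    IsIntervalChain x y (z :: l) ↔ x ⋖ z ∧ IsIntervalChain z y l := by
  simp [IsIntervalChain, List.isChain_cons_cons, and_assoc]

theorem IsIntervalChain.le {x y : P} {l : List P} (h : IsIntervalChain x y l) : x ≤ y := by
  induction l generalizing x with
  | nil => exact (isIntervalChain_nil.1 h).le
  | cons z l ih =>
    obtain ⟨h1, h2⟩ := isIntervalChain_cons.1 h
    exact h1.le.trans (ih h2)

theorem IsIntervalChain.le_of_mem {x y a : P} {l : List P} (h : IsIntervalChain x y l)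
    (ha : a ∈ x :: l) : x ≤ a ∧ a ≤ y := by
  induction l generalizing x with
  | nil =>
    obtain rfl := isIntervalChain_nil.1 h
    obtain rfl : a = x := by simpa using ha
    exact ⟨le_rfl, le_rfl⟩
  | cons z l ih =>
    obtain ⟨h1, h2⟩ := isIntervalChain_cons.1 h
    rcases List.mem_cons.1 ha with rfl | ha
    · exact ⟨le_rfl, h.le⟩
    · exact ⟨h1.le.trans (ih h2 ha).1, (ih h2 ha).2⟩

theorem IsIntervalChain.lt_of_mem {x y a : P} {l : List P} (h : IsIntervalChain x y l)
    (ha : a ∈ l) : x < a := by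
  cases l with
  | nil => simp at ha
  | cons z l =>
    obtain ⟨h1, h2⟩ := isIntervalChain_cons.1 h
    exact h1.lt.trans_le (h2.le_of_mem ha).1

theorem IsIntervalChain.nodup {x y : P} {l : List P} (h : IsIntervalChain x y l) :
    (x :: l).Nodup := by
  induction l generalizing x with
  | nil => simp
  | cons z l ih =>
    refine List.nodup_cons.2 ⟨fun hx => (h.lt_of_mem hx).ne rfl, ?_⟩
    exact ih (isIntervalChain_cons.1 h).2

theorem IsIntervalChain.ncard {x y : P} {l : List P} (h : IsIntervalChain x y l) :
    {a | a ∈ x :: l}.ncard = l.length + 1 := by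
  classical
  have : {a | a ∈ x :: l} = ((x :: l).toFinset : Set P) := by ext; simp
  rw [this, Set.ncard_coe_finset, List.toFinset_card_of_nodup h.nodup, List.length_cons]

theorem IsIntervalChain.append {x y z : P} {l l' : List P} (h : IsIntervalChain x y l)
    (h' : IsIntervalChain y z l') : IsIntervalChain x z (l ++ l') := by
  induction l generalizing x with
  | nil => obtain rfl := isIntervalChain_nil.1 h; exact h'
  | cons w l ih =>
    obtain ⟨h1, h2⟩ := isIntervalChain_cons.1 h
    exact isIntervalChain_cons.2 ⟨h1, ih h2⟩

theorem finite_setOf_isIntervalChain [Finite P] (x y : P) : {l | IsIntervalChain x y l}.Finite := by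
  have := Fintype.ofFinite P
  refine (List.finite_length_le P (Fintype.card P)).subset fun l hl => ?_
  exact (List.nodup_cons.1 (IsIntervalChain.nodup hl)).2.length_le_card

/-! ### Saturated subposets -/

/-- Every `x < y` in `S` has a cover of `x` (in the ambient poset) below `y` inside `S`. -/
def IsSaturated (S : Set P) : Prop :=
  ∀ x ∈ S, ∀ y ∈ S, x < y → ∃ z ∈ S, x ⋖ z ∧ z ≤ y

theorem isSaturated_univ [Finite P] : IsSaturated (Set.univ : Set P) := fun _ _ _ _ h =>
  let ⟨z, h1, h2⟩ := exists_covBy_le_of_lt h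
  ⟨z, trivial, h1, h2⟩

theorem IsSaturated.exists_isIntervalChain [Finite P] {S : Set P} (hS : IsSaturated S) {x y : P}
    (hx : x ∈ S) (hy : y ∈ S) (h : x ≤ y) : ∃ l, IsIntervalChain x y l ∧ ∀ a ∈ l, a ∈ S := by
  induction x using (wellFounded_gt (α := P)).induction with
  | _ x ih =>
    rcases h.eq_or_lt with rfl | h
    · exact ⟨[], isIntervalChain_nil.2 rfl, by simp⟩
    · obtain ⟨z, hz, h1, h2⟩ := hS x hx y hy h
      obtain ⟨l, hl, hlS⟩ := ih z h1.lt hz h2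
      exact ⟨z :: l, isIntervalChain_cons.2 ⟨h1, hl⟩, by simpa [hz] using hlS⟩

theorem exists_isIntervalChain [Finite P] {x y : P} (h : x ≤ y) : ∃ l, IsIntervalChain x y l :=
  let ⟨l, hl, _⟩ := isSaturated_univ.exists_isIntervalChain trivial trivial h
  ⟨l, hl⟩

theorem exists_isMaximalChainOf [Finite P] {S c : Set P} (hc : IsChain (· ≤ ·) c) (hcS : c ⊆ S) :
    ∃ m, IsMaximalChainOf S m ∧ c ⊆ m := by
  obtain ⟨m, h1, h2⟩ := (Set.toFinite {d : Set P | d ⊆ S ∧ IsChain (· ≤ ·) d}).exists_le_maximal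
    (a := c) ⟨hcS, hc⟩
  exact ⟨m, h2, h1⟩

theorem IsMaximalChainOf.subset {S m : Set P} (h : IsMaximalChainOf S m) : m ⊆ S := h.prop.1

theorem IsMaximalChainOf.isChain {S m : Set P} (h : IsMaximalChainOf S m) : IsChain (· ≤ ·) m :=
  h.prop.2

theorem IsMaximalChainOf.eq_of_subset {S m m' : Set P} (h : IsMaximalChainOf S m) (hm : m ⊆ m')
    (h1 : m' ⊆ S) (h2 : IsChain (· ≤ ·) m') : m = m' :=
  Maximal.eq_of_subset h ⟨h1, h2⟩ hm

theorem IsMaximalChainOf.mem_of_forall {S m : Set P} (h : IsMaximalChainOf S m) {a : P}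
    (ha : a ∈ S) (hc : ∀ b ∈ m, a ≤ b ∨ b ≤ a) : a ∈ m := by
  rw [h.eq_of_subset (Set.subset_insert a m) (Set.insert_subset ha h.subset)
    (h.isChain.insert fun b hb _ => hc b hb)]
  exact Set.mem_insert _ _

theorem IsChain.le_or_lt {m : Set P} (h : IsChain (· ≤ ·) m) {a b : P} (ha : a ∈ m) (hb : b ∈ m) :
    a ≤ b ∨ b < a := by
  rcases h.total ha hb with h | h
  · exact .inl h
  · exact h.eq_or_lt.imp (fun h => h.ge) id

/-- An element strictly between `a` and its successor in `r` would lie in `S` by order convexity and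
be comparable to all of `r`, contradicting maximality. -/
theorem IsMaximalChainOf.isSaturated [Finite P] {S r : Set P} (hS : S.OrdConnected)
    (hr : IsMaximalChainOf S r) : IsSaturated r := by
  intro a ha b hb hab
  obtain ⟨z, hz⟩ := (Set.toFinite {z | z ∈ r ∧ a < z}).exists_minimal ⟨b, hb, hab⟩
  have key : ∀ d ∈ r, d ≤ a ∨ z ≤ d := by
    intro d hd
    rcases hr.isChain.le_or_lt hd ha with h | h
    · exact .inl h
    · exact .inr ((hr.isChain.total hz.prop.1 hd).elim id fun h' => hz.le_of_le ⟨hd, h⟩ h')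
  refine ⟨z, hz.prop.1, ⟨hz.prop.2, fun c hac hcz => ?_⟩, (key b hb).resolve_left hab.not_ge⟩
  have hc : c ∈ r := hr.mem_of_forall
    (hS.out (hr.subset ha) (hr.subset hz.prop.1) ⟨hac.le, hcz.le⟩) fun d hd =>
    (key d hd).elim (fun h => .inr (h.trans hac.le)) fun h => .inl (hcz.le.trans h)
  exact (key c hc).elim hac.not_ge hcz.not_ge

end Chains

/-! ### Roots, rank and subposets of full rank -/

section Roots

variable {P : Type*} [PartialOrder P]

theorem IsRoot.mem {r : Set P} {x : P} (h : IsRoot r x) : x ∈ r :=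
  IsMaximalChainOf.mem_of_forall h Set.self_mem_Iic fun _ hb => .inr (h.subset hb)

theorem IsRoot.le {r : Set P} {x a : P} (h : IsRoot r x) (ha : a ∈ r) : a ≤ x := h.subset ha

theorem IsRoot.insert {r : Set P} {x z : P} (h : IsRoot r x) (hz : x ⋖ z) :
    IsRoot (insert z r) z := by
  refine ⟨⟨?_, ?_⟩, ?_⟩
  · exact Set.insert_subset Set.self_mem_Iic fun a ha => (h.le ha).trans hz.le
  · exact h.isChain.insert fun b hb _ => .inr ((h.le hb).trans hz.le)
  · rintro d ⟨hd1, hd2⟩ hd a ha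
    -- Elements of `d` below `x` lie in `r` by maximality of `r`; any other element lies above `x`
    -- and at most at `z`, so it is `z`.
    have hrd : r ⊆ d := (Set.subset_insert _ _).trans hd
    rcases hd2.le_or_lt ha (hrd h.mem) with hax | hax
    · refine .inr (IsMaximalChainOf.mem_of_forall h hax fun b hb => hd2.total ha (hrd hb))
    · exact .inl ((hz.eq_or_eq hax.le (hd1 ha)).resolve_left hax.ne')

theorem IsRoot.append {r : Set P} {x y : P} {l : List P} (h : IsRoot r x)
    (hl : IsIntervalChain x y l) : IsRoot (r ∪ {a | a ∈ l}) y := by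
  induction l generalizing x r with
  | nil => obtain rfl := isIntervalChain_nil.1 hl; simpa using h
  | cons z l ih =>
    obtain ⟨h1, h2⟩ := isIntervalChain_cons.1 hl
    convert ih (h.insert h1) h2 using 1
    ext a; simp; tauto

theorem HasRank.isMaximalChainOf_univ [Finite P] {k : ℕ} {S m : Set P}
    (hP : HasRank (Set.univ : Set P) k) (hS : HasRank S k) (hm : IsMaximalChainOf S m) :
    IsMaximalChainOf Set.univ m := by
  obtain ⟨m', hm', h⟩ := exists_isMaximalChainOf hm.isChain (Set.subset_univ m)
  rwa [Set.eq_of_subset_of_ncard_le h (by rw [hP _ hm', hS _ hm]) (Set.toFinite _)]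

variable [BoundedOrder P]

theorem isRoot_bot : IsRoot ({⊥} : Set P) ⊥ := by
  refine ⟨⟨by simp, by simp⟩, ?_⟩
  rintro d ⟨hd1, -⟩ -
  simpa using hd1

theorem IsIntervalChain.isRoot {x : P} {l : List P} (hl : IsIntervalChain ⊥ x l) :
    IsRoot {a | a ∈ ⊥ :: l} x := by
  convert isRoot_bot.append hl using 1
  ext a; simp

theorem IsRoot.bot_mem {r : Set P} {x : P} (h : IsRoot r x) : ⊥ ∈ r :=
  IsMaximalChainOf.mem_of_forall h bot_le fun _ _ => .inl bot_le

theorem IsRoot.exists_list [Finite P] {r : Set P} {x : P} (h : IsRoot r x) :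
    ∃ l, IsIntervalChain ⊥ x l ∧ r = {a | a ∈ ⊥ :: l} := by
  obtain ⟨l, hl, hlr⟩ := (IsMaximalChainOf.isSaturated Set.ordConnected_Iic h).exists_isIntervalChain
    h.bot_mem h.mem bot_le
  refine ⟨l, hl, (hl.isRoot.eq_of_subset ?_ h.subset h.isChain).symm⟩
  intro a ha
  rcases List.mem_cons.1 ha with rfl | ha
  exacts [h.bot_mem, hlr a ha]

theorem isMaximalChainOf_univ {m : Set P} : IsMaximalChainOf Set.univ m ↔ IsRoot m ⊤ := by
  rw [IsRoot, Set.Iic_top]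

theorem hasRank_univ_iff [Finite P] {k : ℕ} :
    HasRank (Set.univ : Set P) k ↔ ∀ l, IsIntervalChain (⊥ : P) ⊤ l → l.length = k := by
  constructor
  · intro h l hl
    have := h _ (isMaximalChainOf_univ.2 hl.isRoot)
    rw [hl.ncard] at this
    omega
  · intro h c hc
    obtain ⟨l, hl, rfl⟩ := (isMaximalChainOf_univ.1 hc).exists_list
    rw [hl.ncard, h l hl]

/-- Saturated subposets containing the bounds: in a ranked poset these are the subposets of full
rank. -/
structure IsFullySaturated (S : Set P) : Prop where
  bot_mem : ⊥ ∈ S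
  top_mem : ⊤ ∈ S
  isSaturated : IsSaturated S

/-- By cardinality, maximal chains of `S` are maximal in `P`. Hence they contain the bounds, and one
through `x` and `y` supplies the cover. -/
theorem HasRank.isFullySaturated [Finite P] {k : ℕ} {S : Set P}
    (hP : HasRank (Set.univ : Set P) k) (hS : HasRank S k) : IsFullySaturated S := by
  obtain ⟨m, hm, -⟩ := exists_isMaximalChainOf (S := S) (c := ∅) (by simp) (by simp)
  have hr := _root_.isMaximalChainOf_univ.1 (hP.isMaximalChainOf_univ hS hm)
  refine ⟨hm.subset hr.bot_mem, hm.subset hr.mem, fun x hx y hy hxy => ?_⟩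
  obtain ⟨m, hm, h⟩ := exists_isMaximalChainOf (S := S) (c := {x, y})
    (IsChain.pair hxy.le) (Set.insert_subset hx (by simpa))
  obtain ⟨z, hz, h⟩ := (hP.isMaximalChainOf_univ hS hm).isSaturated Set.ordConnected_univ
    x (h (by simp)) y (h (by simp)) hxy
  exact ⟨z, hm.subset hz, h⟩

/-- Between consecutive elements of a maximal chain of `S`, saturation offers a cover of the lower
one inside `S`. It is comparable to the whole chain, so the chain has no gaps. -/
theorem IsFullySaturated.isMaximalChainOf_iff [Finite P] {S m : Set P} (hS : IsFullySaturated S) :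
    IsMaximalChainOf S m ↔ IsMaximalChainOf Set.univ m ∧ m ⊆ S := by
  constructor
  · intro hm
    refine ⟨?_, hm.subset⟩
    have hb : ⊥ ∈ m := hm.mem_of_forall hS.bot_mem fun _ _ => .inl bot_le
    have ht : ⊤ ∈ m := hm.mem_of_forall hS.top_mem fun _ _ => .inr le_top
    have hsat : IsSaturated m := by
      intro a ha b hb hab
      obtain ⟨y, hy⟩ := (Set.toFinite {z | z ∈ m ∧ a < z}).exists_minimal ⟨b, hb, hab⟩
      have key : ∀ d ∈ m, d ≤ a ∨ y ≤ d := by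
        intro d hd
        rcases hm.isChain.le_or_lt hd ha with h | h
        · exact .inl h
        · exact .inr ((hm.isChain.total hy.prop.1 hd).elim id fun h' => hy.le_of_le ⟨hd, h⟩ h')
      obtain ⟨z, hz, h1, h2⟩ := hS.isSaturated a (hm.subset ha) y (hm.subset hy.prop.1) hy.prop.2
      have hz : z ∈ m := hm.mem_of_forall hz fun d hd =>
        (key d hd).elim (fun h => .inr (h.trans h1.le)) fun h => .inl (h2.trans h)
      exact ⟨z, hz, h1, (h2.trans ((key b hb).resolve_left hab.not_ge))⟩
    obtain ⟨l, hl, hlm⟩ := hsat.exists_isIntervalChain hb ht bot_le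
    have hr := isMaximalChainOf_univ.2 hl.isRoot
    rwa [← hr.eq_of_subset (m' := m) (fun a ha => ?_) (Set.subset_univ _) hm.isChain]
    rcases List.mem_cons.1 ha with rfl | ha
    exacts [hb, hlm a ha]
  · rintro ⟨hm, h⟩
    exact ⟨⟨h, hm.isChain⟩, fun d hd hmd => hm.le_of_ge ⟨Set.subset_univ _, hd.2⟩ hmd⟩

theorem IsFullySaturated.hasRank [Finite P] {k : ℕ} {S : Set P}
    (hP : HasRank (Set.univ : Set P) k) (hS : IsFullySaturated S) : HasRank S k :=
  fun _ hm => hP _ (hS.isMaximalChainOf_iff.1 hm).1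

end Roots

/-! ### A local criterion for `CL`-labelings -/

section CLCriterion

variable {P Λ : Type*} [PartialOrder P] [LinearOrder Λ]

/-- Every rooted chain `x ⋖ a ⋖ b` whose label word is not increasing can be replaced by one with
lexicographically smaller label word. -/
def IsSwitchable (lam : ChainEdgeLabeling P Λ) : Prop :=
  ∀ (r : Set P) (x a b : P), IsRoot r x → x ⋖ a → a ⋖ b →
    ¬ lam r x a < lam (insert a r) a b → ∃ a', x ⋖ a' ∧ a' ⋖ b ∧
      (lam r x a' < lam r x a ∨
        lam r x a' = lam r x a ∧ lam (insert a' r) a' b < lam (insert a r) a b)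

/-- The switch is made at the first non-ascent. It changes the roots, and so perhaps the labels,
further up, but the word has dropped before that point. -/
theorem IsSwitchable.exists_lt {lam : ChainEdgeLabeling P Λ} (h : IsSwitchable lam) {r : Set P}
    {x y : P} (hr : IsRoot r x) {l : List P} (hl : IsIntervalChain x y l)
    (hw : ¬ IsIncreasingWord (labelWord lam r x l)) :
    ∃ l', IsIntervalChain x y l' ∧ l'.length = l.length ∧
      List.Lex (· < ·) (labelWord lam r x l') (labelWord lam r x l) := by
  induction l generalizing r x with
  | nil => exact absurd List.isChain_nil hw
  | cons a l ih =>
    obtain ⟨ha, hl⟩ := isIntervalChain_cons.1 hl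
    cases l with
    | nil => exact absurd (List.isChain_singleton _) hw
    | cons b l =>
      by_cases hab : lam r x a < lam (insert a r) a b
      · have hw' : ¬ IsIncreasingWord (labelWord lam (insert a r) a (b :: l)) :=
          fun h => hw (List.isChain_cons_cons.2 ⟨hab, h⟩)
        obtain ⟨l', h1, h2, h3⟩ := ih (hr.insert ha) hl hw'
        exact ⟨a :: l', isIntervalChain_cons.2 ⟨ha, h1⟩, by simpa using h2, .cons h3⟩
      · obtain ⟨hb, hl⟩ := isIntervalChain_cons.1 hl
        obtain ⟨a', h1, h2, h3⟩ := h r x a b hr ha hb hab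
        refine ⟨a' :: b :: l, isIntervalChain_cons.2 ⟨h1, isIntervalChain_cons.2 ⟨h2, hl⟩⟩,
          by simp, ?_⟩
        rcases h3 with h3 | ⟨h3, h4⟩
        · exact .rel h3
        · simp only [labelWord, h3]
          exact .cons (.rel h4)

/-- Among the finitely many chains of this length whose word is no larger, one with minimal word
admits no switch and is therefore increasing. -/
theorem IsSwitchable.exists_increasing_le [Finite P] {lam : ChainEdgeLabeling P Λ}
    (h : IsSwitchable lam) {r : Set P} {x y : P} (hr : IsRoot r x) {l : List P}
    (hl : IsIntervalChain x y l) :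
    ∃ l', IsIntervalChain x y l' ∧ l'.length = l.length ∧
      IsIncreasingWord (labelWord lam r x l') ∧ labelWord lam r x l' ≤ labelWord lam r x l := by
  have hfin : {l' | IsIntervalChain x y l' ∧ l'.length = l.length ∧
      labelWord lam r x l' ≤ labelWord lam r x l}.Finite :=
    (finite_setOf_isIntervalChain x y).subset fun _ h => h.1
  obtain ⟨m, hm⟩ := (hfin.image (labelWord lam r x)).exists_minimal ⟨_, l, ⟨hl, rfl, le_rfl⟩, rfl⟩
  obtain ⟨⟨l', ⟨h1, h2, h3⟩, rfl⟩, hmin⟩ := hm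
  refine ⟨l', h1, h2, ?_, h3⟩
  by_contra hw
  obtain ⟨l'', h4, h5, h6⟩ := h.exists_lt hr h1 hw
  have h6 : labelWord lam r x l'' < labelWord lam r x l' := h6
  exact h6.not_ge (hmin ⟨l'', ⟨h4, h5.trans h2, h6.le.trans h3⟩, rfl⟩ h6.le)

/-- Every rooted interval has at most one increasing chain. -/
def HasUniqueIncreasing (lam : ChainEdgeLabeling P Λ) : Prop :=
  ∀ (r : Set P) (x y : P), IsRoot r x → ∀ l l', IsIntervalChain x y l → IsIntervalChain x y l' →
    IsIncreasingWord (labelWord lam r x l) → IsIncreasingWord (labelWord lam r x l') → l = l'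

theorem IsSwitchable.isCLLabeling [Finite P] {lam : ChainEdgeLabeling P Λ} (h : IsSwitchable lam)
    (hu : HasUniqueIncreasing lam) : IsCLLabeling lam := by
  intro r x y hr hxy
  obtain ⟨l₀, hl₀⟩ := exists_isIntervalChain hxy
  obtain ⟨l, hl, -, hinc, -⟩ := h.exists_increasing_le hr hl₀
  refine ⟨l, hl, hinc, fun l' hl' h' => hu r x y hr l' l hl' hl h' hinc, fun l' hl' hne => ?_⟩
  have hw : ¬ IsIncreasingWord (labelWord lam r x l') :=
    fun h' => hne (hu r x y hr l' l hl' hl h' hinc)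
  -- One switch makes the word strictly smaller; descending from there ends at the only increasing
  -- chain, `l`.
  obtain ⟨m, h1, -, h2⟩ := h.exists_lt hr hl' hw
  obtain ⟨m', h3, -, h4, h5⟩ := h.exists_increasing_le hr h1
  obtain rfl := hu r x y hr l m' hl h3 hinc h4
  exact h5.trans_lt (show labelWord lam r x m < labelWord lam r x l' from h2)

/-- Switching preserves length, so every maximal chain is as long as the unique increasing one. -/
theorem IsSwitchable.exists_hasRank [Finite P] [BoundedOrder P] {lam : ChainEdgeLabeling P Λ}
    (h : IsSwitchable lam) (hu : HasUniqueIncreasing lam) :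
    ∃ k, HasRank (Set.univ : Set P) k := by
  obtain ⟨l₀, hl₀⟩ := exists_isIntervalChain (bot_le : (⊥ : P) ≤ ⊤)
  refine ⟨l₀.length, hasRank_univ_iff.2 fun l hl => ?_⟩
  obtain ⟨m, h1, h2, h3, -⟩ := h.exists_increasing_le isRoot_bot hl
  obtain ⟨m', h1', h2', h3', -⟩ := h.exists_increasing_le isRoot_bot hl₀
  rw [← h2, ← h2', hu _ _ _ isRoot_bot m m' h1 h1' h3 h3']

theorem HasRank.length_eq [Finite P] [BoundedOrder P] {k : ℕ} (hP : HasRank (Set.univ : Set P) k)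
    {x y : P} {l l' : List P} (hl : IsIntervalChain x y l) (hl' : IsIntervalChain x y l') :
    l.length = l'.length := by
  obtain ⟨a, ha⟩ := exists_isIntervalChain (bot_le : ⊥ ≤ x)
  obtain ⟨b, hb⟩ := exists_isIntervalChain (le_top : y ≤ ⊤)
  have h1 := hasRank_univ_iff.1 hP _ (ha.append (hl.append hb))
  have h2 := hasRank_univ_iff.1 hP _ (ha.append (hl'.append hb))
  simp only [List.length_append] at h1 h2
  omega

theorem lex_pair {a b c d : Λ} (h : List.Lex (· < ·) [a, b] [c, d]) : a < c ∨ a = c ∧ b < d := by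
  cases h with
  | rel h => exact .inl h
  | cons h =>
    cases h with
    | rel h => exact .inr ⟨rfl, h⟩
    | cons h => cases h

/-- The rank forces the increasing chain of `[x, b]` to have two steps; its middle element is the
replacement for `a`. -/
theorem IsCLLabeling.exists_switch [Finite P] [BoundedOrder P] {k : ℕ}
    {lam : ChainEdgeLabeling P Λ} (h : IsCLLabeling lam) (hP : HasRank (Set.univ : Set P) k)
    {r : Set P} {x a b : P} (hr : IsRoot r x) (ha : x ⋖ a) (hb : a ⋖ b)
    (hab : ¬ lam r x a < lam (insert a r) a b) : ∃ a', x ⋖ a' ∧ a' ⋖ b ∧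
      lam r x a' < lam (insert a' r) a' b ∧
      (lam r x a' < lam r x a ∨
        lam r x a' = lam r x a ∧ lam (insert a' r) a' b < lam (insert a r) a b) := by
  have hl' : IsIntervalChain x b [a, b] := by simp [isIntervalChain_cons, isIntervalChain_nil, *]
  obtain ⟨l, hl, hinc, -, hlex⟩ := h r x b hr (ha.le.trans hb.le)
  have hlen := hP.length_eq hl hl'
  obtain ⟨a', b', rfl⟩ := List.length_eq_two.1 hlen
  obtain ⟨h1, h2, rfl⟩ : x ⋖ a' ∧ a' ⋖ b' ∧ b' = b := by
    simpa [isIntervalChain_cons, isIntervalChain_nil] using hl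
  have hlt : lam r x a' < lam (insert a' r) a' b' := by
    simpa [IsIncreasingWord, labelWord] using hinc
  refine ⟨a', h1, h2, hlt, ?_⟩
  have hne : [a, b'] ≠ [a', b'] := by
    rintro h
    obtain rfl : a = a' := by simpa using h
    exact hab hlt
  have := hlex _ hl' hne
  exact lex_pair this

end CLCriterion

/-! ### Projections of interval chains -/

section Projections

variable {Q P Λ' Λ : Type*}

open Classical in
/-- The image of the list `l` under `f`, where steps which `f` does not move are skipped; `x` is the
starting point. -/
noncomputable def projChain (f : Q → P) : Q → List Q → List P
  | _, [] => []
  | x, z :: l => if f x = f z then projChain f z l else f z :: projChain f z l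

variable {f : Q → P}

@[simp]
theorem projChain_nil (x : Q) : projChain f x [] = [] := rfl

theorem projChain_cons_of_eq {x z : Q} {l : List Q} (h : f x = f z) :
    projChain f x (z :: l) = projChain f z l := if_pos h

theorem projChain_cons_of_ne {x z : Q} {l : List Q} (h : f x ≠ f z) :
    projChain f x (z :: l) = f z :: projChain f z l := if_neg h

theorem projChain_head_eq {x a a' : Q} {m m' : List Q}
    (h : projChain f x (a :: m) = projChain f x (a' :: m')) (ha : f x ≠ f a) (ha' : f x ≠ f a') :
    f a = f a' := by
  rw [projChain_cons_of_ne ha, projChain_cons_of_ne ha', List.cons.injEq] at h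
  exact h.1

theorem projChain_tail_eq {x a : Q} {m m' : List Q}
    (h : projChain f x (a :: m) = projChain f x (a :: m')) :
    projChain f a m = projChain f a m' := by
  by_cases ha : f x = f a
  · rwa [projChain_cons_of_eq ha, projChain_cons_of_eq ha] at h
  · rw [projChain_cons_of_ne ha, projChain_cons_of_ne ha, List.cons.injEq] at h
    exact h.2

theorem image_insert_of_eq {r : Set Q} {x z : Q} (hx : x ∈ r) (h : f x = f z) :
    f '' insert z r = f '' r := by
  rw [Set.image_insert_eq, Set.insert_eq_of_mem (h ▸ Set.mem_image_of_mem f hx)]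

theorem image_eq_projChain (f : Q → P) (x : Q) (l : List Q) :
    f '' {a | a ∈ x :: l} = {b | b ∈ f x :: projChain f x l} := by
  induction l generalizing x with
  | nil => simp
  | cons z l ih =>
    have e : {a | a ∈ x :: z :: l} = insert x {a | a ∈ z :: l} := by ext; simp
    rw [e, Set.image_insert_eq, ih z]
    by_cases h : f x = f z
    · rw [projChain_cons_of_eq h, h]
      ext; simp
    · rw [projChain_cons_of_ne h]
      ext; simp

variable [PartialOrder Q]

theorem exists_step_of_mem_labelWord_projChain {lam : ChainEdgeLabeling Q Λ'}
    {lam₁ : ChainEdgeLabeling P Λ} {r : Set Q} {x y : Q} (hr : IsRoot r x) {l : List Q}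
    (hl : IsIntervalChain x y l) {a : Λ}
    (ha : a ∈ labelWord lam₁ (f '' r) (f x) (projChain f x l)) :
    ∃ r' x' z', IsRoot r' x' ∧ x' ⋖ z' ∧ x ≤ x' ∧ f x' ≠ f z' ∧
      lam r' x' z' ∈ labelWord lam r x l ∧ a = lam₁ (f '' r') (f x') (f z') := by
  induction l generalizing r x with
  | nil => simp [labelWord] at ha
  | cons z l ih =>
    obtain ⟨h1, h2⟩ := isIntervalChain_cons.1 hl
    have step : a ∈ labelWord lam₁ (f '' insert z r) (f z) (projChain f z l) →
        ∃ r' x' z', IsRoot r' x' ∧ x' ⋖ z' ∧ x ≤ x' ∧ f x' ≠ f z' ∧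
          lam r' x' z' ∈ labelWord lam r x (z :: l) ∧ a = lam₁ (f '' r') (f x') (f z') := by
      intro h
      obtain ⟨r', x', z', h3, h4, h5, h6, h7, h8⟩ := ih (hr.insert h1) h2 h
      exact ⟨r', x', z', h3, h4, h1.le.trans h5, h6, List.mem_cons_of_mem _ h7, h8⟩
    by_cases h : f x = f z
    · rw [projChain_cons_of_eq h, h, ← image_insert_of_eq hr.mem h] at ha
      exact step ha
    · rw [projChain_cons_of_ne h, labelWord, List.mem_cons, ← Set.image_insert_eq] at ha
      rcases ha with rfl | ha
      · exact ⟨r, x, z, hr, h1, le_rfl, h, List.mem_cons_self, rfl⟩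
      · exact step ha

/-- The step found is the first one that `f` moves; until then the image of the growing root is
still `f '' r`. -/
theorem exists_step_of_projChain_eq_cons (lam : ChainEdgeLabeling Q Λ') {r : Set Q} {x y : Q}
    (hr : IsRoot r x) {l : List Q} (hl : IsIntervalChain x y l) {b : P} {p : List P}
    (hb : projChain f x l = b :: p) :
    ∃ r' x' z', IsRoot r' x' ∧ x' ⋖ z' ∧ x ≤ x' ∧ f '' r' = f '' r ∧ f x' = f x ∧ f z' = b ∧
      lam r' x' z' ∈ labelWord lam r x l := by
  induction l generalizing r x with
  | nil => simp at hb
  | cons z l ih =>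
    obtain ⟨h1, h2⟩ := isIntervalChain_cons.1 hl
    by_cases h : f x = f z
    · rw [projChain_cons_of_eq h] at hb
      obtain ⟨r', x', z', h3, h4, h5, h6, h7, h8, h9⟩ := ih (hr.insert h1) h2 hb
      exact ⟨r', x', z', h3, h4, h1.le.trans h5, h6.trans (image_insert_of_eq hr.mem h),
        h7.trans h.symm, h8, List.mem_cons_of_mem _ h9⟩
    · rw [projChain_cons_of_ne h, List.cons.injEq] at hb
      exact ⟨r, x, z, hr, h1, le_rfl, rfl, rfl, hb.1, List.mem_cons_self⟩

/-- Neighbours in the projection need not be neighbours in `l`, hence `Pairwise`; for the transitive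
relations `<` and `≥` this agrees with comparing adjacent letters. -/
theorem pairwise_labelWord_projChain {lam : ChainEdgeLabeling Q Λ'}
    {lam₁ : ChainEdgeLabeling P Λ} {R : Λ' → Λ' → Prop} {R₁ : Λ → Λ → Prop}
    (hR : ∀ r x z r' x' z', IsRoot r x → x ⋖ z → f x ≠ f z → IsRoot r' x' → x' ⋖ z' →
      f x' ≠ f z' → z ≤ x' → R (lam r x z) (lam r' x' z') →
        R₁ (lam₁ (f '' r) (f x) (f z)) (lam₁ (f '' r') (f x') (f z')))
    {r : Set Q} {x y : Q} (hr : IsRoot r x) {l : List Q} (hl : IsIntervalChain x y l)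
    (hw : (labelWord lam r x l).Pairwise R) :
    (labelWord lam₁ (f '' r) (f x) (projChain f x l)).Pairwise R₁ := by
  induction l generalizing r x with
  | nil => simp [labelWord]
  | cons z l ih =>
    obtain ⟨h1, h2⟩ := isIntervalChain_cons.1 hl
    obtain ⟨hw1, hw2⟩ := List.pairwise_cons.1 hw
    have := ih (hr.insert h1) h2 hw2
    by_cases h : f x = f z
    · rw [projChain_cons_of_eq h, h, ← image_insert_of_eq hr.mem h]
      exact this
    · rw [projChain_cons_of_ne h, labelWord, ← Set.image_insert_eq]
      refine List.pairwise_cons.2 ⟨fun a ha => ?_, this⟩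
      obtain ⟨r', x', z', h3, h4, h5, h6, h7, rfl⟩ :=
        exists_step_of_mem_labelWord_projChain (lam := lam) (hr.insert h1) h2 ha
      exact hR _ _ _ _ _ _ hr h1 h h3 h4 h6 h5 (hw1 _ h7)

variable [PartialOrder P]

theorem IsIntervalChain.eq_nil {x : P} {l : List P}
    (h : IsIntervalChain x x l) : l = [] := by
  cases l with
  | nil => rfl
  | cons z l =>
    obtain ⟨h1, h2⟩ := isIntervalChain_cons.1 h
    exact absurd h2.le h1.lt.not_ge

theorem IsIntervalChain.projChain (hf : ∀ x z, x ⋖ z → f x ⩿ f z) {x y : Q} {l : List Q}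
    (hl : IsIntervalChain x y l) : IsIntervalChain (f x) (f y) (projChain f x l) := by
  induction l generalizing x with
  | nil => exact isIntervalChain_nil.2 (congrArg f (isIntervalChain_nil.1 hl))
  | cons z l ih =>
    obtain ⟨h1, h2⟩ := isIntervalChain_cons.1 hl
    by_cases h : f x = f z
    · rw [projChain_cons_of_eq h, h]
      exact ih h2
    · rw [projChain_cons_of_ne h]
      exact isIntervalChain_cons.2 ⟨(hf x z h1).covBy_of_ne h, ih h2⟩

theorem IsRoot.image [Finite Q] [BoundedOrder Q] [BoundedOrder P]
    (hf : ∀ x z, x ⋖ z → f x ⩿ f z) (hbot : f ⊥ = ⊥) {r : Set Q} {x : Q} (hr : IsRoot r x) :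
    IsRoot (f '' r) (f x) := by
  obtain ⟨l, hl, rfl⟩ := hr.exists_list
  rw [image_eq_projChain, hbot]
  have := hl.projChain hf
  rw [hbot] at this
  exact this.isRoot

end Projections

/-! ### Posets and labelings which behave like products -/

section ProductLike

variable {Q P₁ P₂ Λ' Λ₁ Λ₂ : Type*} [PartialOrder Q]

variable [LinearOrder Λ'] [LinearOrder Λ₁] [LinearOrder Λ₂]

/-- The labeling `lam` restricts to `lam₁` and `lam₂` on the two coordinates. -/
structure IsProductLabeling (f₁ : Q → P₁) (f₂ : Q → P₂) (lam₁ : ChainEdgeLabeling P₁ Λ₁)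
    (lam₂ : ChainEdgeLabeling P₂ Λ₂) (lam : ChainEdgeLabeling Q Λ') : Prop where
  lt_iff_left : ∀ r x z r' x' z', IsRoot r x → x ⋖ z → f₁ x ≠ f₁ z → IsRoot r' x' → x' ⋖ z' →
    f₁ x' ≠ f₁ z' → z ≤ x' → (lam r x z < lam r' x' z' ↔
      lam₁ (f₁ '' r) (f₁ x) (f₁ z) < lam₁ (f₁ '' r') (f₁ x') (f₁ z'))
  lt_iff_right : ∀ r x z r' x' z', IsRoot r x → x ⋖ z → f₂ x ≠ f₂ z → IsRoot r' x' → x' ⋖ z' →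
    f₂ x' ≠ f₂ z' → z ≤ x' → (lam r x z < lam r' x' z' ↔
      lam₂ (f₂ '' r) (f₂ x) (f₂ z) < lam₂ (f₂ '' r') (f₂ x') (f₂ z'))
  eq_left : ∀ r x z r' x' z', IsRoot r x → x ⋖ z → f₂ x = f₂ z → IsRoot r' x' → x' ⋖ z' →
    x ≤ x' → f₁ '' r' = f₁ '' r → f₁ x' = f₁ x → f₁ z' = f₁ z → lam r' x' z' = lam r x z
  eq_right : ∀ r x z r' x' z', IsRoot r x → x ⋖ z → f₁ x = f₁ z → IsRoot r' x' → x' ⋖ z' →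
    x ≤ x' → f₂ '' r' = f₂ '' r → f₂ x' = f₂ x → f₂ z' = f₂ z → lam r' x' z' = lam r x z
  ne : ∀ r x z z', IsRoot r x → x ⋖ z → x ⋖ z' → f₂ x = f₂ z → f₁ x = f₁ z' →
    lam r x z ≠ lam r x z'
  isSwitchable : IsSwitchable lam

variable {f₁ : Q → P₁} {f₂ : Q → P₂} {lam₁ : ChainEdgeLabeling P₁ Λ₁}
  {lam₂ : ChainEdgeLabeling P₂ Λ₂} {lam : ChainEdgeLabeling Q Λ'}

/-- Since the projections agree, the move opening either chain recurs later in the other with the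
same label. So the two opening labels are related by `R` in both directions, hence equal, against
`ne`. The hypothesis `hR` serves both `<`, where it is vacuous, and `≥`. -/
theorem IsProductLabeling.not_moves_apart (hlam : IsProductLabeling f₁ f₂ lam₁ lam₂ lam)
    {R : Λ' → Λ' → Prop} (hR : ∀ a b, R a b → R b a → a = b)
    {r : Set Q} {x y a a' : Q} {m m' : List Q} (hr : IsRoot r x)
    (hl : IsIntervalChain x y (a :: m)) (hl' : IsIntervalChain x y (a' :: m'))
    (hw : (labelWord lam r x (a :: m)).Pairwise R)
    (hw' : (labelWord lam r x (a' :: m')).Pairwise R)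
    (h₁ : projChain f₁ x (a :: m) = projChain f₁ x (a' :: m'))
    (h₂ : projChain f₂ x (a :: m) = projChain f₂ x (a' :: m'))
    (ha₁ : f₁ x ≠ f₁ a) (ha₂ : f₂ x = f₂ a) (ha₁' : f₁ x = f₁ a') (ha₂' : f₂ x ≠ f₂ a') :
    False := by
  obtain ⟨hxa, hm⟩ := isIntervalChain_cons.1 hl
  obtain ⟨hxa', hm'⟩ := isIntervalChain_cons.1 hl'
  rw [projChain_cons_of_ne ha₁, projChain_cons_of_eq ha₁'] at h₁
  rw [projChain_cons_of_eq ha₂, projChain_cons_of_ne ha₂'] at h₂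
  obtain ⟨s, q, q', h3, h4, h5, h6, h7, h8, h9⟩ :=
    exists_step_of_projChain_eq_cons lam (hr.insert hxa) hm h₂
  obtain ⟨s', p, p', h3', h4', h5', h6', h7', h8', h9'⟩ :=
    exists_step_of_projChain_eq_cons lam (hr.insert hxa') hm' h₁.symm
  have e1 := hlam.eq_right r x a' s q q' hr hxa' ha₁' h3 h4 (hxa.le.trans h5)
    (h6.trans (image_insert_of_eq hr.mem ha₂)) (h7.trans ha₂.symm) h8
  have e2 := hlam.eq_left r x a s' p p' hr hxa ha₂ h3' h4' (hxa'.le.trans h5')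
    (h6'.trans (image_insert_of_eq hr.mem ha₁')) (h7'.trans ha₁'.symm) h8'
  refine hlam.ne r x a a' hr hxa hxa' ha₂ ha₁' (hR _ _ ?_ ?_)
  · rw [← e1]
    exact (List.pairwise_cons.1 hw).1 _ h9
  · rw [← e2]
    exact (List.pairwise_cons.1 hw').1 _ h9'

variable [PartialOrder P₁] [PartialOrder P₂] [BoundedOrder Q] [BoundedOrder P₁] [BoundedOrder P₂]

/-- The two maps exhibit `Q` as a poset of pairs in which cover relations move each coordinate by at
most one cover relation, and in which products of saturated subposets are saturated. -/
structure IsProductLike (f₁ : Q → P₁) (f₂ : Q → P₂) : Prop where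
  le_iff : ∀ x y, x ≤ y ↔ f₁ x ≤ f₁ y ∧ f₂ x ≤ f₂ y
  wcovBy_left : ∀ x y, x ⋖ y → f₁ x ⩿ f₁ y
  wcovBy_right : ∀ x y, x ⋖ y → f₂ x ⩿ f₂ y
  bot_left : f₁ ⊥ = ⊥
  bot_right : f₂ ⊥ = ⊥
  top_left : f₁ ⊤ = ⊤
  top_right : f₂ ⊤ = ⊤
  isSaturated : ∀ S₁ S₂, IsFullySaturated S₁ → IsFullySaturated S₂ →
    IsSaturated {q | f₁ q ∈ S₁ ∧ f₂ q ∈ S₂}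

theorem IsProductLike.ext (hf : IsProductLike f₁ f₂) {x y : Q} (h₁ : f₁ x = f₁ y)
    (h₂ : f₂ x = f₂ y) : x = y :=
  le_antisymm ((hf.le_iff _ _).2 ⟨h₁.le, h₂.le⟩) ((hf.le_iff _ _).2 ⟨h₁.ge, h₂.ge⟩)

theorem IsProductLabeling.eq_of_projChain_eq (hf : IsProductLike f₁ f₂)
    (hlam : IsProductLabeling f₁ f₂ lam₁ lam₂ lam)
    {R : Λ' → Λ' → Prop} (hR : ∀ a b, R a b → R b a → a = b)
    {r : Set Q} {x y : Q} {l l' : List Q} (hr : IsRoot r x)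
    (hl : IsIntervalChain x y l) (hl' : IsIntervalChain x y l')
    (hw : (labelWord lam r x l).Pairwise R) (hw' : (labelWord lam r x l').Pairwise R)
    (h₁ : projChain f₁ x l = projChain f₁ x l') (h₂ : projChain f₂ x l = projChain f₂ x l') :
    l = l' := by
  induction l generalizing r x l' with
  | nil =>
    obtain rfl := isIntervalChain_nil.1 hl
    exact hl'.eq_nil.symm
  | cons a m ih =>
    cases l' with
    | nil =>
      obtain rfl := isIntervalChain_nil.1 hl'
      exact hl.eq_nil
    | cons a' m' =>
      obtain ⟨hxa, hm⟩ := isIntervalChain_cons.1 hl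
      obtain ⟨hxa', hm'⟩ := isIntervalChain_cons.1 hl'
      have key : a = a' := by
        -- Comparable covers of `x` coincide. This settles the cases where both steps move one
        -- coordinate and at least one of them fixes the other coordinate.
        have hle : ∀ {b b'}, x ⋖ b → x ⋖ b' → f₁ b ≤ f₁ b' → f₂ b ≤ f₂ b' → b = b' :=
          fun {b b'} hb hb' e₁ e₂ =>
            (hb'.eq_or_eq hb.le ((hf.le_iff _ _).2 ⟨e₁, e₂⟩)).resolve_left hb.lt.ne'
        have hmono : ∀ {b}, x ⋖ b → f₁ x ≤ f₁ b ∧ f₂ x ≤ f₂ b :=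
          fun {b} hb => (hf.le_iff _ _).1 hb.le
        by_cases ha₁ : f₁ x = f₁ a
        · by_cases ha₁' : f₁ x = f₁ a'
          · have ha₂ : f₂ x ≠ f₂ a := fun h => hxa.ne (hf.ext ha₁ h)
            have ha₂' : f₂ x ≠ f₂ a' := fun h => hxa'.ne (hf.ext ha₁' h)
            exact hf.ext (ha₁.symm.trans ha₁') (projChain_head_eq h₂ ha₂ ha₂')
          · have ha₂ : f₂ x ≠ f₂ a := fun h => hxa.ne (hf.ext ha₁ h)
            by_cases ha₂' : f₂ x = f₂ a'
            · exact (hlam.not_moves_apart hR hr hl' hl hw' hw h₁.symm h₂.symm ha₁' ha₂' ha₁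
                ha₂).elim
            · exact hle hxa hxa' (ha₁ ▸ (hmono hxa').1) (projChain_head_eq h₂ ha₂ ha₂').le
        · by_cases ha₁' : f₁ x = f₁ a'
          · have ha₂' : f₂ x ≠ f₂ a' := fun h => hxa'.ne (hf.ext ha₁' h)
            by_cases ha₂ : f₂ x = f₂ a
            · exact (hlam.not_moves_apart hR hr hl hl' hw hw' h₁ h₂ ha₁ ha₂ ha₁' ha₂').elim
            · exact (hle hxa' hxa (ha₁' ▸ (hmono hxa).1)
                (projChain_head_eq h₂ ha₂ ha₂').ge).symm
          · have e := projChain_head_eq h₁ ha₁ ha₁'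
            by_cases ha₂ : f₂ x = f₂ a
            · exact hle hxa hxa' e.le (ha₂ ▸ (hmono hxa').2)
            · by_cases ha₂' : f₂ x = f₂ a'
              · exact (hle hxa' hxa e.ge (ha₂' ▸ (hmono hxa).2)).symm
              · exact hf.ext e (projChain_head_eq h₂ ha₂ ha₂')
      subst key
      rw [labelWord, List.pairwise_cons] at hw hw'
      rw [ih (hr.insert hxa) hm hm' hw.2 hw'.2 (projChain_tail_eq h₁) (projChain_tail_eq h₂)]

end ProductLike

/-! ### Ears of `CL`-ceds -/

section Ears

variable {P Λ ι : Type*} [PartialOrder P] [BoundedOrder P] [Finite P] [LinearOrder Λ]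
  [LinearOrder ι] {Sig : ι → Set P}

theorem mem_newChains_iff (hS : ∀ s, IsFullySaturated (Sig s)) {s : ι} {m : Set P} :
    m ∈ newChains Sig s ↔
      IsMaximalChainOf Set.univ m ∧ m ⊆ Sig s ∧ ∀ t, t < s → ¬ m ⊆ Sig t := by
  simp only [newChains, Set.mem_ofPred_eq, (hS _).isMaximalChainOf_iff]
  tauto

theorem IsCLcedOfRank.isFullySaturated {k : ℕ} {lam : ChainEdgeLabeling P Λ}
    (h : IsCLcedOfRank k lam Sig) (s : ι) : IsFullySaturated (Sig s) :=
  h.rank_poset.isFullySaturated (h.rank_subposet s)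

/-- The boundary condition without its length bound, because a non-maximal chain of the product can
project to a maximal chain of a factor. A maximal chain cannot lie in two different ears. -/
theorem IsCLcedOfRank.exists_earlier {k : ℕ} {lam : ChainEdgeLabeling P Λ}
    (h : IsCLcedOfRank k lam Sig) {s t : ι} (hts : t < s) {c : Set P} (hc : IsChain (· ≤ ·) c)
    (hs : IsFaceOfEar Sig s c) (ht : IsFaceOfEar Sig t c) :
    ∃ m, IsMaximalChainOf Set.univ m ∧ c ⊆ m ∧ m ⊆ Sig s ∧ m ∉ newChains Sig s := by
  have hS := h.isFullySaturated
  by_cases hck : c.ncard < k + 1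
  · obtain ⟨m, h1, h2, h3⟩ := h.bdry s t hts c hc hck hs ht
    obtain ⟨h4, h5⟩ := (hS s).isMaximalChainOf_iff.1 h1
    exact ⟨m, h4, h3, h5, h2⟩
  · obtain ⟨m, hm, hcm⟩ := hs
    obtain ⟨m', hm', hcm'⟩ := ht
    have key : ∀ u, ∀ n ∈ newChains Sig u, c ⊆ n → c = n := fun u n hn hcn =>
      Set.eq_of_subset_of_ncard_le hcn
        (by rw [h.rank_poset _ ((mem_newChains_iff hS).1 hn).1]; omega) (Set.toFinite _)
    obtain rfl := key _ _ hm hcm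
    obtain rfl := key _ _ hm' hcm'
    exact absurd hm'.1.subset (((mem_newChains_iff hS).1 hm).2.2 t hts)

end Ears

/-! ### `CL`-ceds of posets which behave like products -/

section ProductCed

variable {Q P₁ P₂ Λ' Λ₁ Λ₂ ι₁ ι₂ : Type*} {f₁ : Q → P₁} {f₂ : Q → P₂}
  {Sig₁ : ι₁ → Set P₁} {Sig₂ : ι₂ → Set P₂}

/-- The products of the members of two families of subposets. -/
def pairFamily (f₁ : Q → P₁) (f₂ : Q → P₂) (Sig₁ : ι₁ → Set P₁) (Sig₂ : ι₂ → Set P₂) :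
    ι₁ ×ₗ ι₂ → Set Q :=
  fun p => {q | f₁ q ∈ Sig₁ (ofLex p).1 ∧ f₂ q ∈ Sig₂ (ofLex p).2}

theorem subset_pairFamily_iff {c : Set Q} {p : ι₁ ×ₗ ι₂} :
    c ⊆ pairFamily f₁ f₂ Sig₁ Sig₂ p ↔
      f₁ '' c ⊆ Sig₁ (ofLex p).1 ∧ f₂ '' c ⊆ Sig₂ (ofLex p).2 := by
  simp only [Set.image_subset_iff, ← Set.subset_inter_iff]
  rfl

variable [PartialOrder Q] [PartialOrder P₁] [PartialOrder P₂]
  [BoundedOrder Q] [BoundedOrder P₁] [BoundedOrder P₂]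

theorem IsProductLike.isFullySaturated (hf : IsProductLike f₁ f₂) {S₁ : Set P₁} {S₂ : Set P₂}
    (h₁ : IsFullySaturated S₁) (h₂ : IsFullySaturated S₂) :
    IsFullySaturated {q | f₁ q ∈ S₁ ∧ f₂ q ∈ S₂} where
  bot_mem := ⟨hf.bot_left ▸ h₁.bot_mem, hf.bot_right ▸ h₂.bot_mem⟩
  top_mem := ⟨hf.top_left ▸ h₁.top_mem, hf.top_right ▸ h₂.top_mem⟩
  isSaturated := hf.isSaturated _ _ h₁ h₂

theorem IsProductLike.isFullySaturated_pairFamily (hf : IsProductLike f₁ f₂)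
    (hS₁ : ∀ s, IsFullySaturated (Sig₁ s)) (hS₂ : ∀ s, IsFullySaturated (Sig₂ s))
    (p : ι₁ ×ₗ ι₂) : IsFullySaturated (pairFamily f₁ f₂ Sig₁ Sig₂ p) :=
  hf.isFullySaturated (hS₁ _) (hS₂ _)

theorem IsMaximalChainOf.isFullySaturated {P : Type*} [PartialOrder P] [BoundedOrder P] [Finite P]
    {m : Set P} (hm : IsMaximalChainOf Set.univ m) : IsFullySaturated m where
  bot_mem := (isMaximalChainOf_univ.1 hm).bot_mem
  top_mem := (isMaximalChainOf_univ.1 hm).mem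
  isSaturated := hm.isSaturated Set.ordConnected_univ

theorem IsProductLike.isChain_image_left (hf : IsProductLike f₁ f₂) {c : Set Q}
    (hc : IsChain (· ≤ ·) c) : IsChain (· ≤ ·) (f₁ '' c) := by
  rintro _ ⟨x, hx, rfl⟩ _ ⟨y, hy, rfl⟩ -
  exact (hc.total hx hy).imp (fun h => ((hf.le_iff _ _).1 h).1) fun h => ((hf.le_iff _ _).1 h).1

theorem IsProductLike.isChain_image_right (hf : IsProductLike f₁ f₂) {c : Set Q}
    (hc : IsChain (· ≤ ·) c) : IsChain (· ≤ ·) (f₂ '' c) := by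
  rintro _ ⟨x, hx, rfl⟩ _ ⟨y, hy, rfl⟩ -
  exact (hc.total hx hy).imp (fun h => ((hf.le_iff _ _).1 h).2) fun h => ((hf.le_iff _ _).1 h).2

variable [Finite Q]

theorem IsProductLike.image_left (hf : IsProductLike f₁ f₂) {m : Set Q}
    (hm : IsMaximalChainOf Set.univ m) : IsMaximalChainOf Set.univ (f₁ '' m) := by
  have := (isMaximalChainOf_univ.1 hm).image hf.wcovBy_left hf.bot_left
  rw [hf.top_left] at this
  exact isMaximalChainOf_univ.2 this

theorem IsProductLike.image_right (hf : IsProductLike f₁ f₂) {m : Set Q}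
    (hm : IsMaximalChainOf Set.univ m) : IsMaximalChainOf Set.univ (f₂ '' m) := by
  have := (isMaximalChainOf_univ.1 hm).image hf.wcovBy_right hf.bot_right
  rw [hf.top_right] at this
  exact isMaximalChainOf_univ.2 this

variable [LinearOrder Λ'] [LinearOrder Λ₁] [LinearOrder Λ₂]
  {lam₁ : ChainEdgeLabeling P₁ Λ₁} {lam₂ : ChainEdgeLabeling P₂ Λ₂} {lam : ChainEdgeLabeling Q Λ'}

theorem IsProductLabeling.hasUniqueIncreasing (hf : IsProductLike f₁ f₂)
    (hlam : IsProductLabeling f₁ f₂ lam₁ lam₂ lam) (h₁ : IsCLLabeling lam₁)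
    (h₂ : IsCLLabeling lam₂) : HasUniqueIncreasing lam := by
  intro r x y hr l l' hl hl' hw hw'
  rw [IsIncreasingWord, List.isChain_iff_pairwise] at hw hw'
  refine hlam.eq_of_projChain_eq hf (fun a b h h' => (lt_asymm h h').elim) hr hl hl' hw hw' ?_ ?_
  · have key : ∀ m, IsIntervalChain x y m → (labelWord lam r x m).Pairwise (· < ·) →
        IsIncreasingWord (labelWord lam₁ (f₁ '' r) (f₁ x) (projChain f₁ x m)) := fun m hm hw =>
      List.isChain_iff_pairwise.2 <| pairwise_labelWord_projChain
        (fun r x z r' x' z' h1 h2 h3 h4 h5 h6 h7 =>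
          (hlam.lt_iff_left r x z r' x' z' h1 h2 h3 h4 h5 h6 h7).1) hr hm hw
    obtain ⟨l₀, -, -, hu, -⟩ := h₁ (f₁ '' r) (f₁ x) (f₁ y) (hr.image hf.wcovBy_left hf.bot_left)
      (hl.projChain hf.wcovBy_left).le
    rw [hu _ (hl.projChain hf.wcovBy_left) (key l hl hw),
      hu _ (hl'.projChain hf.wcovBy_left) (key l' hl' hw')]
  · have key : ∀ m, IsIntervalChain x y m → (labelWord lam r x m).Pairwise (· < ·) →
        IsIncreasingWord (labelWord lam₂ (f₂ '' r) (f₂ x) (projChain f₂ x m)) := fun m hm hw =>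
      List.isChain_iff_pairwise.2 <| pairwise_labelWord_projChain
        (fun r x z r' x' z' h1 h2 h3 h4 h5 h6 h7 =>
          (hlam.lt_iff_right r x z r' x' z' h1 h2 h3 h4 h5 h6 h7).1) hr hm hw
    obtain ⟨l₀, -, -, hu, -⟩ := h₂ (f₂ '' r) (f₂ x) (f₂ y) (hr.image hf.wcovBy_right hf.bot_right)
      (hl.projChain hf.wcovBy_right).le
    rw [hu _ (hl.projChain hf.wcovBy_right) (key l hl hw),
      hu _ (hl'.projChain hf.wcovBy_right) (key l' hl' hw')]

variable [Finite P₁] [Finite P₂]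

/-- A maximal chain of the pullback of `m₁` and `m₂` is maximal in `Q`, since the pullback is
saturated. Its projections are maximal chains inside `m₁` and `m₂`, hence equal to them. -/
theorem IsProductLike.exists_lift (hf : IsProductLike f₁ f₂) {m₁ : Set P₁} {m₂ : Set P₂} {c : Set Q}
    (hm₁ : IsMaximalChainOf Set.univ m₁) (hm₂ : IsMaximalChainOf Set.univ m₂)
    (hc : IsChain (· ≤ ·) c) (h₁ : f₁ '' c ⊆ m₁) (h₂ : f₂ '' c ⊆ m₂) :
    ∃ m, IsMaximalChainOf Set.univ m ∧ c ⊆ m ∧ f₁ '' m = m₁ ∧ f₂ '' m = m₂ := by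
  obtain ⟨m, hm, hcm⟩ := exists_isMaximalChainOf (S := {q | f₁ q ∈ m₁ ∧ f₂ q ∈ m₂}) hc
    fun q hq => ⟨h₁ (Set.mem_image_of_mem _ hq), h₂ (Set.mem_image_of_mem _ hq)⟩
  obtain ⟨hm, hmS⟩ := (hf.isFullySaturated hm₁.isFullySaturated
    hm₂.isFullySaturated).isMaximalChainOf_iff.1 hm
  refine ⟨m, hm, hcm, ?_, ?_⟩
  · exact (hf.image_left hm).eq_of_subset (Set.image_subset_iff.2 fun q hq => (hmS hq).1)
      (Set.subset_univ _) hm₁.isChain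
  · exact (hf.image_right hm).eq_of_subset (Set.image_subset_iff.2 fun q hq => (hmS hq).2)
      (Set.subset_univ _) hm₂.isChain

variable [LinearOrder ι₁] [LinearOrder ι₂]

/-- Lowering one index alone gives a lexicographically smaller pair, and a smaller pair has a
smaller index in some coordinate. -/
theorem IsProductLike.mem_newChains_iff (hf : IsProductLike f₁ f₂)
    (hS₁ : ∀ s, IsFullySaturated (Sig₁ s)) (hS₂ : ∀ s, IsFullySaturated (Sig₂ s))
    {p : ι₁ ×ₗ ι₂} {m : Set Q} (hm : IsMaximalChainOf Set.univ m) :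
    m ∈ newChains (pairFamily f₁ f₂ Sig₁ Sig₂) p ↔
      f₁ '' m ∈ newChains Sig₁ (ofLex p).1 ∧ f₂ '' m ∈ newChains Sig₂ (ofLex p).2 := by
  rw [_root_.mem_newChains_iff (hf.isFullySaturated_pairFamily hS₁ hS₂),
    _root_.mem_newChains_iff hS₁, _root_.mem_newChains_iff hS₂]
  simp only [hm, hf.image_left hm, hf.image_right hm, true_and, subset_pairFamily_iff]
  constructor
  · rintro ⟨⟨h1, h2⟩, h3⟩
    refine ⟨⟨h1, fun t ht h => h3 (toLex (t, (ofLex p).2)) ?_ ⟨h, h2⟩⟩,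
      ⟨h2, fun t ht h => h3 (toLex ((ofLex p).1, t)) ?_ ⟨h1, h⟩⟩⟩
    · exact Prod.Lex.lt_iff.2 (.inl ht)
    · exact Prod.Lex.lt_iff.2 (.inr ⟨rfl, ht⟩)
  · rintro ⟨⟨h1, h2⟩, h3, h4⟩
    refine ⟨⟨h1, h3⟩, fun t ht h => ?_⟩
    rcases Prod.Lex.lt_iff.1 ht with ht | ⟨-, ht⟩
    · exact h2 _ ht h.1
    · exact h4 _ ht h.2

theorem IsProductLike.isFaceOfEar (hf : IsProductLike f₁ f₂)
    (hS₁ : ∀ s, IsFullySaturated (Sig₁ s)) (hS₂ : ∀ s, IsFullySaturated (Sig₂ s))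
    {p : ι₁ ×ₗ ι₂} {c : Set Q} (hc : IsFaceOfEar (pairFamily f₁ f₂ Sig₁ Sig₂) p c) :
    IsFaceOfEar Sig₁ (ofLex p).1 (f₁ '' c) ∧ IsFaceOfEar Sig₂ (ofLex p).2 (f₂ '' c) := by
  obtain ⟨m, hm, hcm⟩ := hc
  have hm' := ((_root_.mem_newChains_iff (hf.isFullySaturated_pairFamily hS₁ hS₂)).1 hm).1
  obtain ⟨h1, h2⟩ := (hf.mem_newChains_iff hS₁ hS₂ hm').1 hm
  exact ⟨⟨_, h1, Set.image_mono hcm⟩, ⟨_, h2, Set.image_mono hcm⟩⟩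

theorem IsProductLike.exists_earlier (hf : IsProductLike f₁ f₂)
    (hS₁ : ∀ s, IsFullySaturated (Sig₁ s)) (hS₂ : ∀ s, IsFullySaturated (Sig₂ s))
    {p : ι₁ ×ₗ ι₂} {m₁ : Set P₁} {m₂ : Set P₂} {c : Set Q}
    (hm₁ : IsMaximalChainOf Set.univ m₁) (hm₂ : IsMaximalChainOf Set.univ m₂)
    (hc : IsChain (· ≤ ·) c) (h₁ : f₁ '' c ⊆ m₁) (h₂ : f₂ '' c ⊆ m₂)
    (h₁' : m₁ ⊆ Sig₁ (ofLex p).1) (h₂' : m₂ ⊆ Sig₂ (ofLex p).2)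
    (hnew : ¬ (m₁ ∈ newChains Sig₁ (ofLex p).1 ∧ m₂ ∈ newChains Sig₂ (ofLex p).2)) :
    ∃ m, IsMaximalChainOf (pairFamily f₁ f₂ Sig₁ Sig₂ p) m ∧
      m ∉ newChains (pairFamily f₁ f₂ Sig₁ Sig₂) p ∧ c ⊆ m := by
  obtain ⟨m, hm, hcm, rfl, rfl⟩ := hf.exists_lift hm₁ hm₂ hc h₁ h₂
  refine ⟨m, ?_, fun h => hnew ((hf.mem_newChains_iff hS₁ hS₂ hm).1 h), hcm⟩
  exact (hf.isFullySaturated_pairFamily hS₁ hS₂ p).isMaximalChainOf_iff.2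
    ⟨hm, subset_pairFamily_iff.2 ⟨h₁', h₂'⟩⟩

theorem IsProductLabeling.eq_of_descending {k₁ k₂ : ℕ} (hf : IsProductLike f₁ f₂)
    (hlam : IsProductLabeling f₁ f₂ lam₁ lam₂ lam)
    (h₁ : IsCLcedOfRank k₁ lam₁ Sig₁) (h₂ : IsCLcedOfRank k₂ lam₂ Sig₂)
    (p : ι₁ ×ₗ ι₂) (r : Set Q) (x y : Q) (hr : IsRoot r x) (l l' : List Q)
    (hl : IsIntervalChain x y l) (hw : IsDescendingWord (labelWord lam r x l))
    (hface : IsFaceOfEar (pairFamily f₁ f₂ Sig₁ Sig₂) p {a | a ∈ x :: l})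
    (hl' : IsIntervalChain x y l') (hw' : IsDescendingWord (labelWord lam r x l'))
    (hface' : IsFaceOfEar (pairFamily f₁ f₂ Sig₁ Sig₂) p {a | a ∈ x :: l'}) : l = l' := by
  rw [IsDescendingWord, List.isChain_iff_pairwise] at hw hw'
  obtain ⟨hface₁, hface₂⟩ := hf.isFaceOfEar h₁.isFullySaturated h₂.isFullySaturated hface
  obtain ⟨hface₁', hface₂'⟩ := hf.isFaceOfEar h₁.isFullySaturated h₂.isFullySaturated hface'
  rw [image_eq_projChain] at hface₁ hface₂ hface₁' hface₂'
  refine hlam.eq_of_projChain_eq hf (fun a b h h' => le_antisymm h' h) hr hl hl' hw hw' ?_ ?_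
  · have key : ∀ m, IsIntervalChain x y m → (labelWord lam r x m).Pairwise (· ≥ ·) →
        IsDescendingWord (labelWord lam₁ (f₁ '' r) (f₁ x) (projChain f₁ x m)) := fun m hm hw =>
      List.isChain_iff_pairwise.2 <| pairwise_labelWord_projChain (R₁ := (· ≥ ·))
        (fun r x z r' x' z' h1 h2 h3 h4 h5 h6 h7 h8 => not_lt.1 fun h => h8.not_gt
          ((hlam.lt_iff_left r x z r' x' z' h1 h2 h3 h4 h5 h6 h7).2 h)) hr hm hw
    exact h₁.desc _ _ _ _ (hr.image hf.wcovBy_left hf.bot_left) _ _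
      (hl.projChain hf.wcovBy_left) (key l hl hw) hface₁
      (hl'.projChain hf.wcovBy_left) (key l' hl' hw') hface₁'
  · have key : ∀ m, IsIntervalChain x y m → (labelWord lam r x m).Pairwise (· ≥ ·) →
        IsDescendingWord (labelWord lam₂ (f₂ '' r) (f₂ x) (projChain f₂ x m)) := fun m hm hw =>
      List.isChain_iff_pairwise.2 <| pairwise_labelWord_projChain (R₁ := (· ≥ ·))
        (fun r x z r' x' z' h1 h2 h3 h4 h5 h6 h7 h8 => not_lt.1 fun h => h8.not_gt
          ((hlam.lt_iff_right r x z r' x' z' h1 h2 h3 h4 h5 h6 h7).2 h)) hr hm hw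
    exact h₂.desc _ _ _ _ (hr.image hf.wcovBy_right hf.bot_right) _ _
      (hl.projChain hf.wcovBy_right) (key l hl hw) hface₂
      (hl'.projChain hf.wcovBy_right) (key l' hl' hw') hface₂'

theorem IsProductLabeling.isCLced {k₁ k₂ : ℕ} (hf : IsProductLike f₁ f₂)
    (hlam : IsProductLabeling f₁ f₂ lam₁ lam₂ lam)
    (h₁ : IsCLcedOfRank k₁ lam₁ Sig₁) (h₂ : IsCLcedOfRank k₂ lam₂ Sig₂)
    (hpoly : ∀ p, IsPolytopeFaceLattice (pairFamily f₁ f₂ Sig₁ Sig₂ p)) :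
    IsCLced lam (pairFamily f₁ f₂ Sig₁ Sig₂) := by
  have hS₁ := h₁.isFullySaturated
  have hS₂ := h₂.isFullySaturated
  have hu := hlam.hasUniqueIncreasing hf h₁.labeling h₂.labeling
  obtain ⟨k, hk⟩ := hlam.isSwitchable.exists_hasRank hu
  refine ⟨k, hk, fun p => (hf.isFullySaturated_pairFamily hS₁ hS₂ p).hasRank hk,
    hlam.isSwitchable.isCLLabeling hu, hpoly, hlam.eq_of_descending hf h₁ h₂, ?_, ?_⟩
  · intro p q hqp c hc _ hp hq
    obtain ⟨hp₁, hp₂⟩ := hf.isFaceOfEar hS₁ hS₂ hp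
    obtain ⟨hq₁, hq₂⟩ := hf.isFaceOfEar hS₁ hS₂ hq
    -- In a coordinate where the index of `q` is smaller, the projection of `c` extends to a chain
    -- that is not new. Paired with any extension of the other projection, it lifts to the required
    -- chain.
    rcases Prod.Lex.lt_iff.1 hqp with h | ⟨h, h'⟩
    · obtain ⟨m₁, h3, h4, h5, h6⟩ :=
        h₁.exists_earlier h (hf.isChain_image_left hc) hp₁ hq₁
      obtain ⟨m₂, h7, h8⟩ := hp₂
      rw [mem_newChains_iff hS₂] at h7
      exact hf.exists_earlier hS₁ hS₂ h3 h7.1 hc h4 h8 h5 h7.2.1 fun h => h6 h.1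
    · obtain ⟨m₂, h3, h4, h5, h6⟩ :=
        h₂.exists_earlier h' (hf.isChain_image_right hc) hp₂ hq₂
      obtain ⟨m₁, h7, h8⟩ := hp₁
      rw [mem_newChains_iff hS₁] at h7
      exact hf.exists_earlier hS₁ hS₂ h7.1 h3 hc h8 h4 h7.2.1 h5 fun h => h6 h.2
  · intro c hc
    obtain ⟨s, hs⟩ := h₁.union _ (hf.isChain_image_left hc)
    obtain ⟨t, ht⟩ := h₂.union _ (hf.isChain_image_right hc)
    exact ⟨toLex (s, t), subset_pairFamily_iff.2 ⟨hs, ht⟩⟩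

end ProductCed

/-! ### Direct products -/

section DirectProduct

variable {P₁ P₂ Λ₁ Λ₂ Λ : Type*} {j₁ : Λ₁ → Λ} {j₂ : Λ₂ → Λ} {lam₁ : ChainEdgeLabeling P₁ Λ₁}
  {lam₂ : ChainEdgeLabeling P₂ Λ₂}

theorem prodLabeling_of_fst_ne {r : Set (P₁ × P₂)} {x y : P₁ × P₂} (h : x.1 ≠ y.1) :
    prodLabeling j₁ j₂ lam₁ lam₂ r x y = j₁ (lam₁ (Prod.fst '' r) x.1 y.1) := if_pos h

theorem prodLabeling_of_fst_eq {r : Set (P₁ × P₂)} {x y : P₁ × P₂} (h : x.1 = y.1) :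
    prodLabeling j₁ j₂ lam₁ lam₂ r x y = j₂ (lam₂ (Prod.snd '' r) x.2 y.2) :=
  if_neg (not_not.2 h)

theorem prodLabeling_mk_of_ne {r : Set (P₁ × P₂)} {x₁ y₁ : P₁} {x₂ y₂ : P₂} (h : x₁ ≠ y₁) :
    prodLabeling j₁ j₂ lam₁ lam₂ r (x₁, x₂) (y₁, y₂) = j₁ (lam₁ (Prod.fst '' r) x₁ y₁) :=
  if_pos h

theorem prodLabeling_mk_right {r : Set (P₁ × P₂)} {x₁ : P₁} {x₂ y₂ : P₂} :
    prodLabeling j₁ j₂ lam₁ lam₂ r (x₁, x₂) (x₁, y₂) = j₂ (lam₂ (Prod.snd '' r) x₂ y₂) :=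
  if_neg (not_not.2 rfl)

variable [PartialOrder P₁] [PartialOrder P₂]

theorem exists_covBy_prod {S₁ : Set P₁} {S₂ : Set P₂} (h₁ : IsSaturated S₁)
    (h₂ : IsSaturated S₂) {x y : P₁ × P₂} (hx₁ : x.1 ∈ S₁) (hx₂ : x.2 ∈ S₂) (hy₁ : y.1 ∈ S₁)
    (hy₂ : y.2 ∈ S₂) (hxy : x < y) : ∃ z : P₁ × P₂, z.1 ∈ S₁ ∧ z.2 ∈ S₂ ∧ x ⋖ z ∧ z ≤ y := by
  rcases hxy.le.1.eq_or_lt with h | h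
  · have h' : x.2 < y.2 := hxy.le.2.lt_of_ne fun h' => hxy.ne (Prod.ext h h')
    obtain ⟨z, hz, h3, h4⟩ := h₂ _ hx₂ _ hy₂ h'
    exact ⟨(x.1, z), hx₁, hz, Prod.covBy_iff.2 (.inr ⟨h3, rfl⟩), ⟨h.le, h4⟩⟩
  · obtain ⟨z, hz, h3, h4⟩ := h₁ _ hx₁ _ hy₁ h
    exact ⟨(z, x.2), hz, hx₂, Prod.covBy_iff.2 (.inl ⟨h3, rfl⟩), ⟨h4, hxy.le.2⟩⟩

theorem isProductLike_prod [BoundedOrder P₁] [BoundedOrder P₂] :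
    IsProductLike (Prod.fst : P₁ × P₂ → P₁) (Prod.snd : P₁ × P₂ → P₂) where
  le_iff _ _ := Iff.rfl
  wcovBy_left x y h := by
    rcases Prod.covBy_iff.1 h with h | h
    exacts [h.1.wcovBy, h.2 ▸ WCovBy.refl _]
  wcovBy_right x y h := by
    rcases Prod.covBy_iff.1 h with h | h
    exacts [h.2 ▸ WCovBy.refl _, h.1.wcovBy]
  bot_left := rfl
  bot_right := rfl
  top_left := rfl
  top_right := rfl
  isSaturated S₁ S₂ h₁ h₂ := by
    rintro x ⟨hx₁, hx₂⟩ y ⟨hy₁, hy₂⟩ hxy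
    obtain ⟨z, h3, h4, h5⟩ := exists_covBy_prod h₁.isSaturated h₂.isSaturated hx₁ hx₂ hy₁ hy₂ hxy
    exact ⟨z, ⟨h3, h4⟩, h5⟩

theorem prodLabeling_of_snd_ne {r : Set (P₁ × P₂)} {x y : P₁ × P₂} (hxy : x ⋖ y)
    (h : x.2 ≠ y.2) :
    prodLabeling j₁ j₂ lam₁ lam₂ r x y = j₂ (lam₂ (Prod.snd '' r) x.2 y.2) :=
  prodLabeling_of_fst_eq ((Prod.covBy_iff.1 hxy).elim (fun h' => (h h'.2).elim) fun h' => h'.2)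

variable [LinearOrder Λ₁] [LinearOrder Λ₂] [LinearOrder Λ]

/-- Only the projections of `r` are required to be roots: the image in `P₁ × P₂` of a root in a
reduced product need not be a root. -/
theorem exists_switch_prodLabeling [BoundedOrder P₁] [BoundedOrder P₂] [Finite P₁] [Finite P₂]
    {k₁ k₂ : ℕ} (hP₁ : HasRank (Set.univ : Set P₁) k₁) (hP₂ : HasRank (Set.univ : Set P₂) k₂)
    (h₁ : IsCLLabeling lam₁) (h₂ : IsCLLabeling lam₂) (hj : IsShuffle j₁ j₂)
    {r : Set (P₁ × P₂)} {x a b : P₁ × P₂} (hx : x ∈ r) (hr₁ : IsRoot (Prod.fst '' r) x.1)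
    (hr₂ : IsRoot (Prod.snd '' r) x.2) (ha : x ⋖ a) (hb : a ⋖ b)
    (hab : ¬ prodLabeling j₁ j₂ lam₁ lam₂ r x a <
      prodLabeling j₁ j₂ lam₁ lam₂ (insert a r) a b) :
    ∃ a', x ⋖ a' ∧ a' ⋖ b ∧
      (prodLabeling j₁ j₂ lam₁ lam₂ r x a' < prodLabeling j₁ j₂ lam₁ lam₂ r x a ∨
        prodLabeling j₁ j₂ lam₁ lam₂ r x a' = prodLabeling j₁ j₂ lam₁ lam₂ r x a ∧
        prodLabeling j₁ j₂ lam₁ lam₂ (insert a' r) a' b <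
          prodLabeling j₁ j₂ lam₁ lam₂ (insert a r) a b) := by
  obtain ⟨x₁, x₂⟩ := x
  obtain ⟨a₁, a₂⟩ := a
  obtain ⟨b₁, b₂⟩ := b
  have hx₁ : insert x₁ (Prod.fst '' r) = Prod.fst '' r :=
    Set.insert_eq_of_mem (Set.mem_image_of_mem Prod.fst hx)
  have hx₂ : insert x₂ (Prod.snd '' r) = Prod.snd '' r :=
    Set.insert_eq_of_mem (Set.mem_image_of_mem Prod.snd hx)
  rcases Prod.mk_covBy_mk_iff.1 ha with ⟨hA, rfl⟩ | ⟨hA, rfl⟩ <;>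
    rcases Prod.mk_covBy_mk_iff.1 hb with ⟨hB, rfl⟩ | ⟨hB, rfl⟩
  · rw [prodLabeling_mk_of_ne hA.ne, prodLabeling_mk_of_ne hB.ne, hj.left.lt_iff_lt,
      Set.image_insert_eq] at hab
    obtain ⟨a', h3, h4, -, h5⟩ := h₁.exists_switch hP₁ hr₁ hA hB hab
    refine ⟨(a', x₂), Prod.mk_covBy_mk_iff.2 (.inl ⟨h3, rfl⟩),
      Prod.mk_covBy_mk_iff.2 (.inl ⟨h4, rfl⟩), ?_⟩
    rw [prodLabeling_mk_of_ne hA.ne, prodLabeling_mk_of_ne hB.ne, prodLabeling_mk_of_ne h3.ne,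
      prodLabeling_mk_of_ne h4.ne, hj.left.lt_iff_lt, hj.left.lt_iff_lt, hj.left.injective.eq_iff,
      Set.image_insert_eq, Set.image_insert_eq]
    exact h5
  -- The square is traversed the other way, so the former second label comes first. Disjointness of
  -- the alphabets turns the non-ascent into a strict descent.
  · refine ⟨(x₁, b₂), Prod.mk_covBy_mk_iff.2 (.inr ⟨hB, rfl⟩),
      Prod.mk_covBy_mk_iff.2 (.inl ⟨hA, rfl⟩), .inl ?_⟩
    rw [prodLabeling_mk_of_ne hA.ne, prodLabeling_mk_right, Set.image_insert_eq, hx₂] at hab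
    rw [prodLabeling_mk_of_ne hA.ne, prodLabeling_mk_right]
    exact (not_lt.1 hab).lt_of_ne (hj.disjoint _ _).symm
  · refine ⟨(b₁, x₂), Prod.mk_covBy_mk_iff.2 (.inl ⟨hB, rfl⟩),
      Prod.mk_covBy_mk_iff.2 (.inr ⟨hA, rfl⟩), .inl ?_⟩
    rw [prodLabeling_mk_of_ne hB.ne, prodLabeling_mk_right, Set.image_insert_eq, hx₁] at hab
    rw [prodLabeling_mk_of_ne hB.ne, prodLabeling_mk_right]
    exact (not_lt.1 hab).lt_of_ne (hj.disjoint _ _)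
  · rw [prodLabeling_mk_right, prodLabeling_mk_right, hj.right.lt_iff_lt,
      Set.image_insert_eq] at hab
    obtain ⟨a', h3, h4, -, h5⟩ := h₂.exists_switch hP₂ hr₂ hA hB hab
    refine ⟨(x₁, a'), Prod.mk_covBy_mk_iff.2 (.inr ⟨h3, rfl⟩),
      Prod.mk_covBy_mk_iff.2 (.inr ⟨h4, rfl⟩), ?_⟩
    rw [prodLabeling_mk_right, prodLabeling_mk_right, prodLabeling_mk_right,
      prodLabeling_mk_right, hj.right.lt_iff_lt, hj.right.lt_iff_lt,
      hj.right.injective.eq_iff, Set.image_insert_eq, Set.image_insert_eq]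
    exact h5

theorem isProductLabeling_prodLabeling [BoundedOrder P₁] [BoundedOrder P₂] [Finite P₁] [Finite P₂]
    {k₁ k₂ : ℕ} (hP₁ : HasRank (Set.univ : Set P₁) k₁) (hP₂ : HasRank (Set.univ : Set P₂) k₂)
    (h₁ : IsCLLabeling lam₁) (h₂ : IsCLLabeling lam₂) (hj : IsShuffle j₁ j₂) :
    IsProductLabeling Prod.fst Prod.snd lam₁ lam₂ (prodLabeling j₁ j₂ lam₁ lam₂) where
  lt_iff_left r x z r' x' z' _ _ hm _ _ hm' _ := by
    rw [prodLabeling_of_fst_ne hm, prodLabeling_of_fst_ne hm', hj.left.lt_iff_lt]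
  lt_iff_right r x z r' x' z' _ hz hm _ hz' hm' _ := by
    rw [prodLabeling_of_snd_ne hz hm, prodLabeling_of_snd_ne hz' hm', hj.right.lt_iff_lt]
  eq_left r x z r' x' z' _ hz hm _ _ _ e₁ e₂ e₃ := by
    have hm' : x.1 ≠ z.1 := fun h => hz.ne (Prod.ext h hm)
    rw [prodLabeling_of_fst_ne hm', prodLabeling_of_fst_ne (by rwa [e₂, e₃]), e₁, e₂, e₃]
  eq_right r x z r' x' z' _ hz hm _ hz' _ e₁ e₂ e₃ := by
    have hm' : x.2 ≠ z.2 := fun h => hz.ne (Prod.ext hm h)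
    rw [prodLabeling_of_fst_eq hm, prodLabeling_of_snd_ne hz' (by rwa [e₂, e₃]), e₁, e₂, e₃]
  ne r x z z' _ hz hz' hm hm' := by
    rw [prodLabeling_of_fst_ne fun h => hz.ne (Prod.ext h hm), prodLabeling_of_fst_eq hm']
    exact hj.disjoint _ _
  isSwitchable r x a b hr ha hb hab :=
    exists_switch_prodLabeling hP₁ hP₂ h₁ h₂ hj hr.mem
      (hr.image isProductLike_prod.wcovBy_left rfl) (hr.image isProductLike_prod.wcovBy_right rfl)
      ha hb hab

end DirectProduct

/-! ### Orderly labelings -/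

section Orderly

variable {P Λ : Type*} [PartialOrder P] [BoundedOrder P] [Finite P] [LinearOrder Λ]
  {lam : ChainEdgeLabeling P Λ} {part : Λ → SignType}

/-- The first label drops strictly. If it stayed the same, the new second label would exceed a
letter of `S^A` yet be smaller than a letter not above `S^A`, and so would itself lie in `S^A`. -/
theorem IsOrderly.exists_switch {k : ℕ} (ho : IsOrderly lam part) (h : IsCLLabeling lam)
    (hP : HasRank (Set.univ : Set P) k) {r : Set P} {a b : P} (hr : IsRoot r ⊥) (ha : ⊥ ⋖ a)
    (hb : a ⋖ b) (hab : ¬ lam r ⊥ a < lam (insert a r) a b) :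
    ∃ a', ⊥ ⋖ a' ∧ a' ⋖ b ∧ lam r ⊥ a' < lam r ⊥ a := by
  obtain ⟨a', h1, h2, h3, h4⟩ := h.exists_switch hP hr ha hb hab
  refine ⟨a', h1, h2, h4.resolve_right fun ⟨_, h5⟩ => ?_⟩
  have e1 := (ho.2 _ _ _ hr h1).1 rfl
  have e2 := (ho.2 _ _ _ hr ha).1 rfl
  have e3 := (ho.2 _ _ _ (hr.insert h1) h2).2 h1.lt.ne'
  have m1 := ho.1 h3.le
  have m2 := ho.1 (not_lt.1 hab)
  have m3 := ho.1 h5.le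
  exact e3 (le_antisymm (m3.trans (m2.trans e2.le)) (e1.ge.trans m1))

/-- An unchanged first label would lie below one letter of `S^A` and not below another, hence in
`S^A`, which is reserved for covers by the top. -/
theorem IsCoorderly.exists_switch {k : ℕ} (ho : IsCoorderly lam part) (h : IsCLLabeling lam)
    (hP : HasRank (Set.univ : Set P) k) {r : Set P} {x a : P} (hr : IsRoot r x) (ha : x ⋖ a)
    (hb : a ⋖ ⊤) (hab : ¬ lam r x a < lam (insert a r) a ⊤) :
    ∃ a', x ⋖ a' ∧ a' ⋖ ⊤ ∧ lam r x a' < lam r x a := by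
  obtain ⟨a', h1, h2, h3, h4⟩ := h.exists_switch hP hr ha hb hab
  refine ⟨a', h1, h2, h4.resolve_right fun ⟨h5, _⟩ => ?_⟩
  have e1 := (ho.2 _ _ _ hr h1).2 h2.lt.ne
  have e2 := (ho.2 _ _ _ (hr.insert ha) hb).1 rfl
  have e3 := (ho.2 _ _ _ (hr.insert h1) h2).1 rfl
  have m1 := ho.1 h3.le
  have m2 := ho.1 (not_lt.1 hab)
  rw [← h5] at m2
  exact e1 (le_antisymm (m1.trans e3.le) (e2.ge.trans m2))

end Orderly

/-! ### Comparing one-letter and two-letter words -/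

section Words

variable {Λ : Type*} [LinearOrder Λ]

theorem singleton_lt_singleton {a b : Λ} : [a] < [b] ↔ a < b := by
  simp [List.cons_lt_cons_iff]

theorem pair_lt_singleton {a b c : Λ} : [a, b] < [c] ↔ a < c := by
  simp [List.cons_lt_cons_iff]

/-- A proper prefix precedes its extensions, so equal first letters count as an ascent here, unlike
in `pair_lt_singleton`. -/
theorem singleton_lt_pair {a b c : Λ} : [a] < [b, c] ↔ a ≤ b := by
  simp [List.cons_lt_cons_iff, le_iff_lt_or_eq]

variable {Λ₁ Λ₂ : Type*} [LinearOrder Λ₁] [LinearOrder Λ₂] {part₁ : Λ₁ → SignType}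
  {part₂ : Λ₂ → SignType} {j₁ : Λ₁ → Λ} {j₂ : Λ₂ → Λ}

/-- Letters in different blocks compare by their blocks alone, so `a` may be traded for any `b` in
the corresponding block. -/
theorem IsOrderlyShuffle.left_lt_right_iff (hj : IsOrderlyShuffle part₁ part₂ j₁ j₂)
    (hm : Monotone part₂) {a : Λ₁} {b b' : Λ₂} (h : part₁ a = part₂ b)
    (hb : part₂ b' ≠ part₂ b) : j₁ a < j₂ b' ↔ b < b' := by
  rcases hb.lt_or_gt with hb | hb
  · exact iff_of_false (hj.right_lt_left a b' (h ▸ hb)).not_gt fun h => (hm h.le).not_gt hb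
  · exact iff_of_true (hj.left_lt_right a b' (h ▸ hb.le)) (hm.reflect_lt hb)

theorem IsOrderlyShuffle.right_le_left_iff (hj : IsOrderlyShuffle part₁ part₂ j₁ j₂)
    (hm : Monotone part₂) {a : Λ₁} {b b' : Λ₂} (h : part₁ a = part₂ b)
    (hb : part₂ b' ≠ part₂ b) : j₂ b' ≤ j₁ a ↔ b' < b := by
  rw [← not_lt, hj.left_lt_right_iff hm h hb, not_lt,
    le_iff_lt_or_eq, or_iff_left fun e => hb (congrArg part₂ e)]

end Words

/-! ### Lower reduced products -/

theorem Subtype.covBy_iff_of_forall {α : Type*} [PartialOrder α] {p : α → Prop} {x y : Subtype p}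
    (h : ∀ c, x.1 < c → c < y.1 → p c) : x ⋖ y ↔ x.1 ⋖ y.1 :=
  ⟨fun hxy => ⟨hxy.1, fun c h1 h2 => hxy.2 (c := ⟨c, h c h1 h2⟩) h1 h2⟩,
    fun hxy => ⟨hxy.1, fun _ h1 h2 => hxy.2 h1 h2⟩⟩

section LowerProduct

variable {P₁ P₂ : Type*} [PartialOrder P₁] [BoundedOrder P₁] [PartialOrder P₂] [BoundedOrder P₂]

instance lowerBoundedOrder [Nontrivial P₁] [Nontrivial P₂] : BoundedOrder (LowerProd P₁ P₂) where
  bot := ⟨(⊥, ⊥), .inl rfl⟩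
  bot_le x := show (⊥, ⊥) ≤ x.1 from ⟨bot_le, bot_le⟩
  top := ⟨(⊤, ⊤), .inr ⟨top_ne_bot, top_ne_bot⟩⟩
  le_top x := show x.1 ≤ (⊤, ⊤) from ⟨le_top, le_top⟩

theorem LowerProd.ne_bot {x : LowerProd P₁ P₂} (hx : x.1 ≠ (⊥, ⊥)) : x.1.1 ≠ ⊥ ∧ x.1.2 ≠ ⊥ :=
  x.2.resolve_left hx

theorem LowerProd.fst_eq_bot {x : LowerProd P₁ P₂} (hx : x.1 = (⊥, ⊥)) : x.1.1 = ⊥ :=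
  congrArg Prod.fst hx

theorem LowerProd.snd_eq_bot {x : LowerProd P₁ P₂} (hx : x.1 = (⊥, ⊥)) : x.1.2 = ⊥ :=
  congrArg Prod.snd hx

theorem LowerProd.ne_bot_of_le {x y : LowerProd P₁ P₂} (hx : x.1 ≠ (⊥, ⊥)) (h : x ≤ y) :
    y.1 ≠ (⊥, ⊥) := fun hy =>
  hx (le_antisymm (le_of_le_of_eq (show x.1 ≤ y.1 from h) hy) ⟨bot_le, bot_le⟩)

theorem LowerProd.ne_bot_of_lt {x y : LowerProd P₁ P₂} (h : x < y) : y.1 ≠ (⊥, ⊥) := fun hy =>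
  (lt_of_lt_of_eq (show x.1 < y.1 from h) hy).not_ge ⟨bot_le, bot_le⟩

theorem LowerProd.covBy_iff {x y : LowerProd P₁ P₂} (hx : x.1 ≠ (⊥, ⊥)) :
    x ⋖ y ↔ x.1 ⋖ y.1 :=
  Subtype.covBy_iff_of_forall fun _ h _ => .inr
    ⟨ne_bot_of_le_ne_bot (ne_bot hx).1 h.le.1, ne_bot_of_le_ne_bot (ne_bot hx).2 h.le.2⟩

/-- A nonzero element below one coordinate of `y` can replace that coordinate without leaving the
reduced product, so both coordinates of an atom are atoms. -/
theorem LowerProd.covBy_iff_of_eq_bot {x y : LowerProd P₁ P₂} (hx : x.1 = (⊥, ⊥)) :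
    x ⋖ y ↔ x.1.1 ⋖ y.1.1 ∧ x.1.2 ⋖ y.1.2 := by
  obtain ⟨⟨x₁, x₂⟩, px⟩ := x
  obtain ⟨rfl, rfl⟩ := Prod.mk.inj hx
  constructor
  · intro h
    obtain ⟨h1, h2⟩ := ne_bot (ne_bot_of_lt h.lt)
    refine ⟨⟨h1.bot_lt, fun c hc hc' => ?_⟩, ⟨h2.bot_lt, fun c hc hc' => ?_⟩⟩
    · refine h.2 (c := ⟨(c, y.1.2), .inr ⟨hc.ne', h2⟩⟩) ?_ ?_
      · exact Prod.mk_lt_mk.2 (.inl ⟨hc, bot_le⟩)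
      · exact show (c, y.1.2) < y.1 from Prod.lt_iff.2 (.inl ⟨hc', le_rfl⟩)
    · refine h.2 (c := ⟨(y.1.1, c), .inr ⟨h1, hc.ne'⟩⟩) ?_ ?_
      · exact Prod.mk_lt_mk.2 (.inr ⟨bot_le, hc⟩)
      · exact show (y.1.1, c) < y.1 from Prod.lt_iff.2 (.inr ⟨le_rfl, hc'⟩)
  · rintro ⟨h1, h2⟩
    refine ⟨Prod.lt_iff.2 (.inl ⟨h1.lt, h2.le⟩), fun c hc hc' => ?_⟩
    obtain ⟨h3, h4⟩ := ne_bot (ne_bot_of_lt hc)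
    refine hc'.ne (Subtype.ext (Prod.ext ?_ ?_))
    · exact (h1.eq_or_eq bot_le hc'.le.1).resolve_left h3
    · exact (h2.eq_or_eq bot_le hc'.le.2).resolve_left h4

theorem LowerProd.isProductLike [Nontrivial P₁] [Nontrivial P₂] :
    IsProductLike (fun x : LowerProd P₁ P₂ => x.1.1) (fun x : LowerProd P₁ P₂ => x.1.2) where
  le_iff _ _ := Iff.rfl
  wcovBy_left x y h := by
    by_cases hx : x.1 = (⊥, ⊥)
    · exact ((covBy_iff_of_eq_bot hx).1 h).1.wcovBy
    · exact isProductLike_prod.wcovBy_left _ _ ((covBy_iff hx).1 h)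
  wcovBy_right x y h := by
    by_cases hx : x.1 = (⊥, ⊥)
    · exact ((covBy_iff_of_eq_bot hx).1 h).2.wcovBy
    · exact isProductLike_prod.wcovBy_right _ _ ((covBy_iff hx).1 h)
  bot_left := rfl
  bot_right := rfl
  top_left := rfl
  top_right := rfl
  isSaturated S₁ S₂ h₁ h₂ := by
    rintro x ⟨hx₁, hx₂⟩ y ⟨hy₁, hy₂⟩ hxy
    by_cases hx : x.1 = (⊥, ⊥)
    · obtain ⟨h3, h4⟩ := ne_bot (ne_bot_of_lt hxy)
      obtain ⟨z₁, hz₁, h5, h6⟩ := h₁.isSaturated _ h₁.bot_mem _ hy₁ h3.bot_lt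
      obtain ⟨z₂, hz₂, h7, h8⟩ := h₂.isSaturated _ h₂.bot_mem _ hy₂ h4.bot_lt
      exact ⟨⟨(z₁, z₂), .inr ⟨h5.lt.ne', h7.lt.ne'⟩⟩, ⟨hz₁, hz₂⟩,
        (covBy_iff_of_eq_bot hx).2 ⟨by rwa [fst_eq_bot hx], by rwa [snd_eq_bot hx]⟩, ⟨h6, h8⟩⟩
    · obtain ⟨z, h3, h4, h5, h6⟩ := exists_covBy_prod h₁.isSaturated h₂.isSaturated hx₁ hx₂ hy₁ hy₂
        (show x.1 < y.1 from hxy)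
      exact ⟨⟨z, .inr ⟨ne_bot_of_le_ne_bot (ne_bot hx).1 h5.le.1,
        ne_bot_of_le_ne_bot (ne_bot hx).2 h5.le.2⟩⟩, ⟨h3, h4⟩, (covBy_iff hx).2 h5, h6⟩

theorem lowerFamily_eq_pairFamily {ι₁ ι₂ : Type*} {Sig₁ : ι₁ → Set P₁} {Sig₂ : ι₂ → Set P₂}
    (hS₁ : ∀ s, ⊥ ∈ Sig₁ s) (hS₂ : ∀ s, ⊥ ∈ Sig₂ s) : lowerFamily Sig₁ Sig₂ =
      pairFamily (fun x : LowerProd P₁ P₂ => x.1.1) (fun x : LowerProd P₁ P₂ => x.1.2)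
        Sig₁ Sig₂ := by
  funext p
  ext x
  constructor
  · rintro (hx | ⟨h1, h2⟩)
    · exact ⟨Set.mem_of_eq_of_mem (LowerProd.fst_eq_bot hx) (hS₁ _),
        Set.mem_of_eq_of_mem (LowerProd.snd_eq_bot hx) (hS₂ _)⟩
    · exact ⟨h1.1, h2.1⟩
  · rintro ⟨h1, h2⟩
    exact x.2.imp id fun h => ⟨⟨h1, h.1⟩, ⟨h2, h.2⟩⟩

variable {Λ₁ Λ₂ Λ : Type*} {j₁ : Λ₁ → Λ} {j₂ : Λ₂ → Λ} {lam₁ : ChainEdgeLabeling P₁ Λ₁}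
  {lam₂ : ChainEdgeLabeling P₂ Λ₂}

theorem lowerLabeling_of_eq_bot {r : Set (LowerProd P₁ P₂)} {x y : LowerProd P₁ P₂}
    (hx : x.1 = (⊥, ⊥)) : lowerLabeling j₁ j₂ lam₁ lam₂ r x y =
      [j₁ (lam₁ ((fun z => z.1.1) '' r) x.1.1 y.1.1),
        j₂ (lam₂ ((fun z => z.1.2) '' r) x.1.2 y.1.2)] := if_pos hx

theorem lowerLabeling_of_ne_bot {r : Set (LowerProd P₁ P₂)} {x y : LowerProd P₁ P₂}
    (hx : x.1 ≠ (⊥, ⊥)) : lowerLabeling j₁ j₂ lam₁ lam₂ r x y =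
      [prodLabeling j₁ j₂ lam₁ lam₂ (Subtype.val '' r) x.1 y.1] := if_neg hx

theorem lowerLabeling_of_fst_ne {r : Set (LowerProd P₁ P₂)} {x y : LowerProd P₁ P₂}
    (hx : x.1 ≠ (⊥, ⊥)) (h : x.1.1 ≠ y.1.1) : lowerLabeling j₁ j₂ lam₁ lam₂ r x y =
      [j₁ (lam₁ ((fun z => z.1.1) '' r) x.1.1 y.1.1)] := by
  rw [lowerLabeling_of_ne_bot hx, prodLabeling_of_fst_ne h, Set.image_image]

theorem lowerLabeling_of_fst_eq {r : Set (LowerProd P₁ P₂)} {x y : LowerProd P₁ P₂}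
    (hx : x.1 ≠ (⊥, ⊥)) (h : x.1.1 = y.1.1) : lowerLabeling j₁ j₂ lam₁ lam₂ r x y =
      [j₂ (lam₂ ((fun z => z.1.2) '' r) x.1.2 y.1.2)] := by
  rw [lowerLabeling_of_ne_bot hx, prodLabeling_of_fst_eq h, Set.image_image]

theorem lowerLabeling_of_snd_ne {r : Set (LowerProd P₁ P₂)} {x y : LowerProd P₁ P₂} (hxy : x ⋖ y)
    (hx : x.1 ≠ (⊥, ⊥)) (h : x.1.2 ≠ y.1.2) : lowerLabeling j₁ j₂ lam₁ lam₂ r x y =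
      [j₂ (lam₂ ((fun z => z.1.2) '' r) x.1.2 y.1.2)] := by
  rw [lowerLabeling_of_ne_bot hx, prodLabeling_of_snd_ne ((LowerProd.covBy_iff hx).1 hxy) h,
    Set.image_image]

theorem LowerProd.ne_bot_of_fst_eq {x z : LowerProd P₁ P₂} (hz : x ⋖ z) (h : x.1.1 = z.1.1) :
    x.1 ≠ (⊥, ⊥) := fun hx =>
  ((covBy_iff_of_eq_bot hx).1 hz).1.ne h

theorem LowerProd.ne_bot_of_snd_eq {x z : LowerProd P₁ P₂} (hz : x ⋖ z) (h : x.1.2 = z.1.2) :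
    x.1 ≠ (⊥, ⊥) := fun hx =>
  ((covBy_iff_of_eq_bot hx).1 hz).2.ne h

variable [LinearOrder Λ₁] [LinearOrder Λ₂] [LinearOrder Λ]
  {part₁ : Λ₁ → SignType} {part₂ : Λ₂ → SignType}

theorem lowerLabeling_lt_iff_left (hj : IsShuffle j₁ j₂) {r r' : Set (LowerProd P₁ P₂)}
    {x z x' z' : LowerProd P₁ P₂} (hz : x ⋖ z) (hm : x.1.1 ≠ z.1.1) (hm' : x'.1.1 ≠ z'.1.1)
    (h : z ≤ x') :
    lowerLabeling j₁ j₂ lam₁ lam₂ r x z < lowerLabeling j₁ j₂ lam₁ lam₂ r' x' z' ↔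
      lam₁ ((fun z => z.1.1) '' r) x.1.1 z.1.1 < lam₁ ((fun z => z.1.1) '' r') x'.1.1 z'.1.1 := by
  rw [lowerLabeling_of_fst_ne (LowerProd.ne_bot_of_lt (hz.lt.trans_le h)) hm']
  by_cases hx : x.1 = (⊥, ⊥)
  · rw [lowerLabeling_of_eq_bot hx, pair_lt_singleton, hj.left.lt_iff_lt]
  · rw [lowerLabeling_of_fst_ne hx hm, singleton_lt_singleton, hj.left.lt_iff_lt]

variable [Finite P₁] [Finite P₂] [Nontrivial P₁] [Nontrivial P₂]

/-- The word of a bottom step is judged by its first letter, which belongs to the other factor. As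
that letter is in `S₁^A` and the later one is not in `S₂^A`, the comparison is the same as for the
second letter. -/
theorem lowerLabeling_lt_iff_right (hj : IsOrderlyShuffle part₁ part₂ j₁ j₂)
    (ho₁ : IsOrderly lam₁ part₁) (ho₂ : IsOrderly lam₂ part₂)
    {r r' : Set (LowerProd P₁ P₂)} {x z x' z' : LowerProd P₁ P₂} (hr : IsRoot r x) (hz : x ⋖ z)
    (hm : x.1.2 ≠ z.1.2) (hr' : IsRoot r' x') (hz' : x' ⋖ z') (hm' : x'.1.2 ≠ z'.1.2)
    (h : z ≤ x') :
    lowerLabeling j₁ j₂ lam₁ lam₂ r x z < lowerLabeling j₁ j₂ lam₁ lam₂ r' x' z' ↔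
      lam₂ ((fun z => z.1.2) '' r) x.1.2 z.1.2 < lam₂ ((fun z => z.1.2) '' r') x'.1.2 z'.1.2 := by
  have hx' := LowerProd.ne_bot_of_lt (hz.lt.trans_le h)
  have hf := LowerProd.isProductLike (P₁ := P₁) (P₂ := P₂)
  rw [lowerLabeling_of_snd_ne hz' hx' hm']
  by_cases hx : x.1 = (⊥, ⊥)
  · rw [lowerLabeling_of_eq_bot hx, pair_lt_singleton]
    have hz₁ := (LowerProd.covBy_iff_of_eq_bot hx).1 hz
    have e1 := (ho₁.2 _ _ _ (hr.image hf.wcovBy_left hf.bot_left) hz₁.1).1 (LowerProd.fst_eq_bot hx)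
    have e2 := (ho₂.2 _ _ _ (hr.image hf.wcovBy_right hf.bot_right) hz₁.2).1 (LowerProd.snd_eq_bot hx)
    have e3 := (ho₂.2 _ _ _ (hr'.image hf.wcovBy_right hf.bot_right)
      ((hf.wcovBy_right _ _ hz').covBy_of_ne hm')).2 (LowerProd.ne_bot hx').2
    exact hj.left_lt_right_iff ho₂.1 (e1.trans e2.symm) (e3.trans_eq e2.symm)
  · rw [lowerLabeling_of_snd_ne hz hx hm, singleton_lt_singleton, hj.right.lt_iff_lt]

theorem isSwitchable_lowerLabeling {k₁ k₂ : ℕ} (hP₁ : HasRank (Set.univ : Set P₁) k₁)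
    (hP₂ : HasRank (Set.univ : Set P₂) k₂) (h₁ : IsCLLabeling lam₁) (h₂ : IsCLLabeling lam₂)
    (hj : IsOrderlyShuffle part₁ part₂ j₁ j₂) (ho₁ : IsOrderly lam₁ part₁)
    (ho₂ : IsOrderly lam₂ part₂) : IsSwitchable (lowerLabeling j₁ j₂ lam₁ lam₂) := by
  intro r x a b hr ha hb hab
  have hf := LowerProd.isProductLike (P₁ := P₁) (P₂ := P₂)
  have hr₁ := hr.image hf.wcovBy_left hf.bot_left
  have hr₂ := hr.image hf.wcovBy_right hf.bot_right
  by_cases hx : x.1 = (⊥, ⊥)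
  · obtain ⟨⟨x₁, x₂⟩, px⟩ := x
    obtain ⟨⟨a₁, a₂⟩, pa⟩ := a
    obtain ⟨⟨b₁, b₂⟩, pb⟩ := b
    obtain ⟨rfl, rfl⟩ := Prod.mk.inj hx
    obtain ⟨ha₁, ha₂⟩ : ⊥ ⋖ a₁ ∧ ⊥ ⋖ a₂ := (LowerProd.covBy_iff_of_eq_bot hx).1 ha
    have hab' : (a₁, a₂) ≠ (⊥, ⊥) := LowerProd.ne_bot_of_lt ha.lt
    -- Replacing the atom in the coordinate that moves next lowers one letter of the two-letter word
    -- and keeps the other.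
    rcases Prod.mk_covBy_mk_iff.1 ((LowerProd.covBy_iff hab').1 hb) with ⟨hB, rfl⟩ | ⟨hB, rfl⟩
    · rw [lowerLabeling_lt_iff_left hj.toIsShuffle ha ha₁.ne hB.ne le_rfl,
        Set.image_insert_eq] at hab
      obtain ⟨a', h3, h4, h5⟩ := ho₁.exists_switch h₁ hP₁ hr₁ ha₁ hB hab
      have ha' : (a', a₂) ≠ (⊥, ⊥) := fun h => h3.ne' (congrArg Prod.fst h)
      refine ⟨⟨(a', a₂), .inr ⟨h3.ne', ha₂.ne'⟩⟩, (LowerProd.covBy_iff_of_eq_bot hx).2 ⟨h3, ha₂⟩,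
        (LowerProd.covBy_iff ha').2 (Prod.mk_covBy_mk_iff.2 (.inl ⟨h4, rfl⟩)), .inl ?_⟩
      rw [lowerLabeling_of_eq_bot hx, lowerLabeling_of_eq_bot hx]
      exact .rel (hj.left h5)
    · rw [lowerLabeling_lt_iff_right hj ho₁ ho₂ hr ha ha₂.ne (hr.insert ha) hb hB.ne le_rfl,
        Set.image_insert_eq] at hab
      obtain ⟨a', h3, h4, h5⟩ := ho₂.exists_switch h₂ hP₂ hr₂ ha₂ hB hab
      have ha' : (a₁, a') ≠ (⊥, ⊥) := fun h => h3.ne' (congrArg Prod.snd h)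
      refine ⟨⟨(a₁, a'), .inr ⟨ha₁.ne', h3.ne'⟩⟩, (LowerProd.covBy_iff_of_eq_bot hx).2 ⟨ha₁, h3⟩,
        (LowerProd.covBy_iff ha').2 (Prod.mk_covBy_mk_iff.2 (.inr ⟨h4, rfl⟩)), .inl ?_⟩
      rw [lowerLabeling_of_eq_bot hx, lowerLabeling_of_eq_bot hx]
      exact .cons (.rel (hj.right h5))
  · have hxa := LowerProd.ne_bot_of_le hx ha.le
    rw [lowerLabeling_of_ne_bot hx, lowerLabeling_of_ne_bot hxa, singleton_lt_singleton,
      Set.image_insert_eq] at hab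
    obtain ⟨a', h3, h4, h5⟩ := exists_switch_prodLabeling hP₁ hP₂ h₁ h₂ hj.toIsShuffle
      (Set.mem_image_of_mem Subtype.val hr.mem) (by rwa [Set.image_image])
      (by rwa [Set.image_image]) ((LowerProd.covBy_iff hx).1 ha) ((LowerProd.covBy_iff hxa).1 hb)
      hab
    have pa' : a'.1 ≠ ⊥ ∧ a'.2 ≠ ⊥ := ⟨ne_bot_of_le_ne_bot (LowerProd.ne_bot hx).1 h3.le.1,
      ne_bot_of_le_ne_bot (LowerProd.ne_bot hx).2 h3.le.2⟩
    have ha' : a' ≠ (⊥, ⊥) := fun h => pa'.1 (congrArg Prod.fst h)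
    refine ⟨⟨a', .inr pa'⟩, (LowerProd.covBy_iff hx).2 h3, (LowerProd.covBy_iff ha').2 h4, ?_⟩
    rw [lowerLabeling_of_ne_bot hx, lowerLabeling_of_ne_bot hxa, lowerLabeling_of_ne_bot hx,
      lowerLabeling_of_ne_bot ha', singleton_lt_singleton, singleton_lt_singleton,
      Set.image_insert_eq, Set.image_insert_eq, List.cons.injEq]
    simpa only [and_true] using h5

theorem isProductLabeling_lowerLabeling {k₁ k₂ : ℕ} (hP₁ : HasRank (Set.univ : Set P₁) k₁)
    (hP₂ : HasRank (Set.univ : Set P₂) k₂) (h₁ : IsCLLabeling lam₁) (h₂ : IsCLLabeling lam₂)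
    (hj : IsOrderlyShuffle part₁ part₂ j₁ j₂) (ho₁ : IsOrderly lam₁ part₁)
    (ho₂ : IsOrderly lam₂ part₂) :
    IsProductLabeling (fun x : LowerProd P₁ P₂ => x.1.1) (fun x : LowerProd P₁ P₂ => x.1.2)
      lam₁ lam₂ (lowerLabeling j₁ j₂ lam₁ lam₂) where
  lt_iff_left _ _ _ _ _ _ _ hz hm _ _ hm' h := lowerLabeling_lt_iff_left hj.toIsShuffle hz hm hm' h
  lt_iff_right _ _ _ _ _ _ hr hz hm hr' hz' hm' h :=
    lowerLabeling_lt_iff_right hj ho₁ ho₂ hr hz hm hr' hz' hm' h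
  eq_left r x z r' x' z' _ hz hm _ _ hxx e₁ e₂ e₃ := by
    have hx := LowerProd.ne_bot_of_snd_eq hz hm
    have hm' : x.1.1 ≠ z.1.1 := fun h => hz.ne (Subtype.ext (Prod.ext h hm))
    rw [lowerLabeling_of_fst_ne hx hm', lowerLabeling_of_fst_ne (LowerProd.ne_bot_of_le hx hxx)
      (by rwa [e₂, e₃]), e₁, e₂, e₃]
  eq_right r x z r' x' z' _ hz hm _ hz' hxx e₁ e₂ e₃ := by
    have hx := LowerProd.ne_bot_of_fst_eq hz hm
    have hm' : x.1.2 ≠ z.1.2 := fun h => hz.ne (Subtype.ext (Prod.ext hm h))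
    rw [lowerLabeling_of_fst_eq hx hm, lowerLabeling_of_snd_ne hz'
      (LowerProd.ne_bot_of_le hx hxx) (by rwa [e₂, e₃]), e₁, e₂, e₃]
  ne r x z z' _ hz hz' hm hm' := by
    have hx := LowerProd.ne_bot_of_snd_eq hz hm
    rw [lowerLabeling_of_fst_ne hx fun h => hz.ne (Subtype.ext (Prod.ext h hm)),
      lowerLabeling_of_fst_eq hx hm', Ne, List.cons.injEq]
    exact fun h => hj.disjoint _ _ h.1
  isSwitchable := isSwitchable_lowerLabeling hP₁ hP₂ h₁ h₂ hj ho₁ ho₂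

end LowerProduct

/-! ### Upper reduced products -/

section UpperProduct

variable {P₁ P₂ : Type*} [PartialOrder P₁] [BoundedOrder P₁] [PartialOrder P₂] [BoundedOrder P₂]

instance upperBoundedOrder [Nontrivial P₁] [Nontrivial P₂] : BoundedOrder (UpperProd P₁ P₂) where
  bot := ⟨(⊥, ⊥), .inr ⟨bot_ne_top, bot_ne_top⟩⟩
  bot_le x := show (⊥, ⊥) ≤ x.1 from ⟨bot_le, bot_le⟩
  top := ⟨(⊤, ⊤), .inl rfl⟩
  le_top x := show x.1 ≤ (⊤, ⊤) from ⟨le_top, le_top⟩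

theorem UpperProd.ne_top {x : UpperProd P₁ P₂} (hx : x.1 ≠ (⊤, ⊤)) : x.1.1 ≠ ⊤ ∧ x.1.2 ≠ ⊤ :=
  x.2.resolve_left hx

theorem UpperProd.fst_eq_top {x : UpperProd P₁ P₂} (hx : x.1 = (⊤, ⊤)) : x.1.1 = ⊤ :=
  congrArg Prod.fst hx

theorem UpperProd.snd_eq_top {x : UpperProd P₁ P₂} (hx : x.1 = (⊤, ⊤)) : x.1.2 = ⊤ :=
  congrArg Prod.snd hx

theorem UpperProd.ne_top_of_lt {x y : UpperProd P₁ P₂} (h : x < y) : x.1 ≠ (⊤, ⊤) := fun hx =>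
  (lt_of_eq_of_lt hx.symm (show x.1 < y.1 from h)).not_ge ⟨le_top, le_top⟩

theorem UpperProd.covBy_iff {x y : UpperProd P₁ P₂} (hy : y.1 ≠ (⊤, ⊤)) :
    x ⋖ y ↔ x.1 ⋖ y.1 :=
  Subtype.covBy_iff_of_forall fun _ _ h => .inr
    ⟨ne_top_of_le_ne_top (ne_top hy).1 h.le.1, ne_top_of_le_ne_top (ne_top hy).2 h.le.2⟩

theorem UpperProd.covBy_iff_of_eq_top {x y : UpperProd P₁ P₂} (hy : y.1 = (⊤, ⊤)) :
    x ⋖ y ↔ x.1.1 ⋖ y.1.1 ∧ x.1.2 ⋖ y.1.2 := by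
  obtain ⟨⟨y₁, y₂⟩, py⟩ := y
  obtain ⟨rfl, rfl⟩ := Prod.mk.inj hy
  constructor
  · intro h
    obtain ⟨h1, h2⟩ := ne_top (ne_top_of_lt h.lt)
    refine ⟨⟨h1.lt_top, fun c hc hc' => ?_⟩, ⟨h2.lt_top, fun c hc hc' => ?_⟩⟩
    · refine h.2 (c := ⟨(c, x.1.2), .inr ⟨hc'.ne, h2⟩⟩) ?_ ?_
      · exact Prod.lt_iff.2 (.inl ⟨hc, le_rfl⟩)
      · exact Prod.mk_lt_mk.2 (.inl ⟨hc', le_top⟩)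
    · refine h.2 (c := ⟨(x.1.1, c), .inr ⟨h1, hc'.ne⟩⟩) ?_ ?_
      · exact Prod.lt_iff.2 (.inr ⟨le_rfl, hc⟩)
      · exact Prod.mk_lt_mk.2 (.inr ⟨le_top, hc'⟩)
  · rintro ⟨h1, h2⟩
    refine ⟨Prod.lt_iff.2 (.inl ⟨h1.lt, h2.le⟩), fun c hc hc' => ?_⟩
    obtain ⟨h3, h4⟩ := ne_top (ne_top_of_lt hc')
    refine hc.ne' (Subtype.ext (Prod.ext ?_ ?_))
    · exact (h1.eq_or_eq hc.le.1 le_top).resolve_right h3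
    · exact (h2.eq_or_eq hc.le.2 le_top).resolve_right h4

theorem UpperProd.isProductLike [Nontrivial P₁] [Nontrivial P₂] :
    IsProductLike (fun x : UpperProd P₁ P₂ => x.1.1) (fun x : UpperProd P₁ P₂ => x.1.2) where
  le_iff _ _ := Iff.rfl
  wcovBy_left x y h := by
    by_cases hy : y.1 = (⊤, ⊤)
    · exact ((covBy_iff_of_eq_top hy).1 h).1.wcovBy
    · exact isProductLike_prod.wcovBy_left _ _ ((covBy_iff hy).1 h)
  wcovBy_right x y h := by
    by_cases hy : y.1 = (⊤, ⊤)
    · exact ((covBy_iff_of_eq_top hy).1 h).2.wcovBy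
    · exact isProductLike_prod.wcovBy_right _ _ ((covBy_iff hy).1 h)
  bot_left := rfl
  bot_right := rfl
  top_left := rfl
  top_right := rfl
  isSaturated S₁ S₂ h₁ h₂ := by
    rintro x ⟨hx₁, hx₂⟩ y ⟨hy₁, hy₂⟩ hxy
    by_cases hy : y.1 = (⊤, ⊤)
    · obtain ⟨h3, h4⟩ := ne_top (ne_top_of_lt hxy)
      obtain ⟨z₁, hz₁, h5, -⟩ := h₁.isSaturated _ hx₁ _ h₁.top_mem h3.lt_top
      obtain ⟨z₂, hz₂, h7, -⟩ := h₂.isSaturated _ hx₂ _ h₂.top_mem h4.lt_top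
      have hle : ∀ z : UpperProd P₁ P₂, z ≤ y := fun z =>
        (show z.1 ≤ (⊤, ⊤) from ⟨le_top, le_top⟩).trans_eq hy.symm
      -- A coordinate that can move without reaching the top is moved alone; if neither can, `x` is
      -- already covered by the top.
      by_cases hz₁' : z₁ = ⊤
      · by_cases hz₂' : z₂ = ⊤
        · subst hz₁' hz₂'
          exact ⟨y, ⟨hy₁, hy₂⟩, (covBy_iff_of_eq_top hy).2
            ⟨by rwa [fst_eq_top hy], by rwa [snd_eq_top hy]⟩, le_rfl⟩
        · exact ⟨⟨(x.1.1, z₂), .inr ⟨h3, hz₂'⟩⟩, ⟨hx₁, hz₂⟩,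
            (covBy_iff fun h => hz₂' (congrArg Prod.snd h)).2 (Prod.covBy_iff.2 (.inr ⟨h7, rfl⟩)),
            hle _⟩
      · exact ⟨⟨(z₁, x.1.2), .inr ⟨hz₁', h4⟩⟩, ⟨hz₁, hx₂⟩,
          (covBy_iff fun h => hz₁' (congrArg Prod.fst h)).2 (Prod.covBy_iff.2 (.inl ⟨h5, rfl⟩)),
          hle _⟩
    · obtain ⟨z, h3, h4, h5, h6⟩ := exists_covBy_prod h₁.isSaturated h₂.isSaturated hx₁ hx₂ hy₁ hy₂
        (show x.1 < y.1 from hxy)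
      have pz : z.1 ≠ ⊤ ∧ z.2 ≠ ⊤ := ⟨ne_top_of_le_ne_top (ne_top hy).1 h6.1,
        ne_top_of_le_ne_top (ne_top hy).2 h6.2⟩
      exact ⟨⟨z, .inr pz⟩, ⟨h3, h4⟩, (covBy_iff fun h => pz.1 (congrArg Prod.fst h)).2 h5, h6⟩

theorem upperFamily_eq_pairFamily {ι₁ ι₂ : Type*} {Sig₁ : ι₁ → Set P₁} {Sig₂ : ι₂ → Set P₂}
    (hS₁ : ∀ s, ⊤ ∈ Sig₁ s) (hS₂ : ∀ s, ⊤ ∈ Sig₂ s) : upperFamily Sig₁ Sig₂ =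
      pairFamily (fun x : UpperProd P₁ P₂ => x.1.1) (fun x : UpperProd P₁ P₂ => x.1.2)
        Sig₁ Sig₂ := by
  funext p
  ext x
  constructor
  · rintro (hx | ⟨h1, h2⟩)
    · exact ⟨Set.mem_of_eq_of_mem (UpperProd.fst_eq_top hx) (hS₁ _),
        Set.mem_of_eq_of_mem (UpperProd.snd_eq_top hx) (hS₂ _)⟩
    · exact ⟨h1.1, h2.1⟩
  · rintro ⟨h1, h2⟩
    exact x.2.imp id fun h => ⟨⟨h1, h.1⟩, ⟨h2, h.2⟩⟩

variable {Λ₁ Λ₂ Λ : Type*} {j₁ : Λ₁ → Λ} {j₂ : Λ₂ → Λ} {lam₁ : ChainEdgeLabeling P₁ Λ₁}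
  {lam₂ : ChainEdgeLabeling P₂ Λ₂}

theorem upperLabeling_of_eq_top {r : Set (UpperProd P₁ P₂)} {x y : UpperProd P₁ P₂}
    (hy : y.1 = (⊤, ⊤)) : upperLabeling j₁ j₂ lam₁ lam₂ r x y =
      [j₁ (lam₁ ((fun z => z.1.1) '' r) x.1.1 y.1.1),
        j₂ (lam₂ ((fun z => z.1.2) '' r) x.1.2 y.1.2)] := if_pos hy

theorem upperLabeling_of_ne_top {r : Set (UpperProd P₁ P₂)} {x y : UpperProd P₁ P₂}
    (hy : y.1 ≠ (⊤, ⊤)) : upperLabeling j₁ j₂ lam₁ lam₂ r x y =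
      [prodLabeling j₁ j₂ lam₁ lam₂ (Subtype.val '' r) x.1 y.1] := if_neg hy

theorem upperLabeling_of_fst_ne {r : Set (UpperProd P₁ P₂)} {x y : UpperProd P₁ P₂}
    (hy : y.1 ≠ (⊤, ⊤)) (h : x.1.1 ≠ y.1.1) : upperLabeling j₁ j₂ lam₁ lam₂ r x y =
      [j₁ (lam₁ ((fun z => z.1.1) '' r) x.1.1 y.1.1)] := by
  rw [upperLabeling_of_ne_top hy, prodLabeling_of_fst_ne h, Set.image_image]

theorem upperLabeling_of_fst_eq {r : Set (UpperProd P₁ P₂)} {x y : UpperProd P₁ P₂}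
    (hy : y.1 ≠ (⊤, ⊤)) (h : x.1.1 = y.1.1) : upperLabeling j₁ j₂ lam₁ lam₂ r x y =
      [j₂ (lam₂ ((fun z => z.1.2) '' r) x.1.2 y.1.2)] := by
  rw [upperLabeling_of_ne_top hy, prodLabeling_of_fst_eq h, Set.image_image]

theorem upperLabeling_of_snd_ne {r : Set (UpperProd P₁ P₂)} {x y : UpperProd P₁ P₂} (hxy : x ⋖ y)
    (hy : y.1 ≠ (⊤, ⊤)) (h : x.1.2 ≠ y.1.2) : upperLabeling j₁ j₂ lam₁ lam₂ r x y =
      [j₂ (lam₂ ((fun z => z.1.2) '' r) x.1.2 y.1.2)] := by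
  rw [upperLabeling_of_ne_top hy, prodLabeling_of_snd_ne ((UpperProd.covBy_iff hy).1 hxy) h,
    Set.image_image]

theorem UpperProd.ne_top_of_fst_eq {x z : UpperProd P₁ P₂} (hz : x ⋖ z) (h : x.1.1 = z.1.1) :
    z.1 ≠ (⊤, ⊤) := fun hy => ((covBy_iff_of_eq_top hy).1 hz).1.ne h

theorem UpperProd.ne_top_of_snd_eq {x z : UpperProd P₁ P₂} (hz : x ⋖ z) (h : x.1.2 = z.1.2) :
    z.1 ≠ (⊤, ⊤) := fun hy => ((covBy_iff_of_eq_top hy).1 hz).2.ne h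

variable [LinearOrder Λ₁] [LinearOrder Λ₂] [LinearOrder Λ]
  {part₁ : Λ₁ → SignType} {part₂ : Λ₂ → SignType}
  [Finite P₁] [Finite P₂] [Nontrivial P₁] [Nontrivial P₂]

/-- Against the two-letter word of a top step only `≤` is seen. Equality is excluded because only
top steps have labels in `S₁^A`. -/
theorem upperLabeling_lt_iff_left (hj : IsShuffle j₁ j₂) (ho₁ : IsCoorderly lam₁ part₁)
    {r r' : Set (UpperProd P₁ P₂)}
    {x z x' z' : UpperProd P₁ P₂} (hr : IsRoot r x) (hz : x ⋖ z) (hm : x.1.1 ≠ z.1.1)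
    (hr' : IsRoot r' x') (hz' : x' ⋖ z') (hm' : x'.1.1 ≠ z'.1.1) (h : z ≤ x') :
    upperLabeling j₁ j₂ lam₁ lam₂ r x z < upperLabeling j₁ j₂ lam₁ lam₂ r' x' z' ↔
      lam₁ ((fun z => z.1.1) '' r) x.1.1 z.1.1 < lam₁ ((fun z => z.1.1) '' r') x'.1.1 z'.1.1 := by
  have hzt := UpperProd.ne_top_of_lt (h.trans_lt hz'.lt)
  have hf := UpperProd.isProductLike (P₁ := P₁) (P₂ := P₂)
  rw [upperLabeling_of_fst_ne hzt hm]
  by_cases hy : z'.1 = (⊤, ⊤)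
  · rw [upperLabeling_of_eq_top hy, singleton_lt_pair, hj.left.le_iff_le, le_iff_lt_or_eq,
      or_iff_left]
    intro e
    have e1 := (ho₁.2 _ _ _ (hr'.image hf.wcovBy_left hf.bot_left)
      ((hf.wcovBy_left _ _ hz').covBy_of_ne hm')).1 (UpperProd.fst_eq_top hy)
    have e2 := (ho₁.2 _ _ _ (hr.image hf.wcovBy_left hf.bot_left)
      ((hf.wcovBy_left _ _ hz).covBy_of_ne hm)).2 (UpperProd.ne_top hzt).1
    exact e2 ((congrArg part₁ e).trans e1)
  · rw [upperLabeling_of_fst_ne hy hm', singleton_lt_singleton, hj.left.lt_iff_lt]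

theorem upperLabeling_lt_iff_right (hj : IsOrderlyShuffle part₁ part₂ j₁ j₂)
    (ho₁ : IsCoorderly lam₁ part₁) (ho₂ : IsCoorderly lam₂ part₂)
    {r r' : Set (UpperProd P₁ P₂)} {x z x' z' : UpperProd P₁ P₂} (hr : IsRoot r x) (hz : x ⋖ z)
    (hm : x.1.2 ≠ z.1.2) (hr' : IsRoot r' x') (hz' : x' ⋖ z') (hm' : x'.1.2 ≠ z'.1.2)
    (h : z ≤ x') :
    upperLabeling j₁ j₂ lam₁ lam₂ r x z < upperLabeling j₁ j₂ lam₁ lam₂ r' x' z' ↔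
      lam₂ ((fun z => z.1.2) '' r) x.1.2 z.1.2 < lam₂ ((fun z => z.1.2) '' r') x'.1.2 z'.1.2 := by
  have hzt := UpperProd.ne_top_of_lt (h.trans_lt hz'.lt)
  have hf := UpperProd.isProductLike (P₁ := P₁) (P₂ := P₂)
  rw [upperLabeling_of_snd_ne hz hzt hm]
  by_cases hy : z'.1 = (⊤, ⊤)
  · rw [upperLabeling_of_eq_top hy, singleton_lt_pair]
    have hz₁ := (UpperProd.covBy_iff_of_eq_top hy).1 hz'
    have e1 := (ho₁.2 _ _ _ (hr'.image hf.wcovBy_left hf.bot_left) hz₁.1).1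
      (UpperProd.fst_eq_top hy)
    have e2 := (ho₂.2 _ _ _ (hr'.image hf.wcovBy_right hf.bot_right) hz₁.2).1
      (UpperProd.snd_eq_top hy)
    have e3 := (ho₂.2 _ _ _ (hr.image hf.wcovBy_right hf.bot_right)
      ((hf.wcovBy_right _ _ hz).covBy_of_ne hm)).2 (UpperProd.ne_top hzt).2
    exact hj.right_le_left_iff ho₂.1 (e1.trans e2.symm) (e3.trans_eq e2.symm)
  · rw [upperLabeling_of_snd_ne hz' hy hm', singleton_lt_singleton, hj.right.lt_iff_lt]

theorem isSwitchable_upperLabeling {k₁ k₂ : ℕ} (hP₁ : HasRank (Set.univ : Set P₁) k₁)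
    (hP₂ : HasRank (Set.univ : Set P₂) k₂) (h₁ : IsCLLabeling lam₁) (h₂ : IsCLLabeling lam₂)
    (hj : IsOrderlyShuffle part₁ part₂ j₁ j₂) (ho₁ : IsCoorderly lam₁ part₁)
    (ho₂ : IsCoorderly lam₂ part₂) : IsSwitchable (upperLabeling j₁ j₂ lam₁ lam₂) := by
  intro r x a b hr ha hb hab
  have hf := UpperProd.isProductLike (P₁ := P₁) (P₂ := P₂)
  have hr₁ := hr.image hf.wcovBy_left hf.bot_left
  have hr₂ := hr.image hf.wcovBy_right hf.bot_right
  have hat := UpperProd.ne_top_of_lt hb.lt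
  have ha' := (UpperProd.covBy_iff hat).1 ha
  by_cases hy : b.1 = (⊤, ⊤)
  · obtain ⟨⟨x₁, x₂⟩, px⟩ := x
    obtain ⟨⟨a₁, a₂⟩, pa⟩ := a
    obtain ⟨⟨b₁, b₂⟩, pb⟩ := b
    obtain ⟨rfl, rfl⟩ := Prod.mk.inj hy
    obtain ⟨hb₁, hb₂⟩ : a₁ ⋖ ⊤ ∧ a₂ ⋖ ⊤ := (UpperProd.covBy_iff_of_eq_top hy).1 hb
    rcases Prod.mk_covBy_mk_iff.1 ha' with ⟨hA, rfl⟩ | ⟨hA, rfl⟩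
    · rw [upperLabeling_lt_iff_left hj.toIsShuffle ho₁ hr ha hA.ne (hr.insert ha) hb hb₁.ne le_rfl,
        Set.image_insert_eq] at hab
      obtain ⟨a', h3, h4, h5⟩ := ho₁.exists_switch h₁ hP₁ hr₁ hA hb₁ hab
      have hat' : (a', x₂) ≠ (⊤, ⊤) := fun h => h4.ne (congrArg Prod.fst h)
      refine ⟨⟨(a', x₂), .inr ⟨h4.ne, hb₂.ne⟩⟩,
        (UpperProd.covBy_iff hat').2 (Prod.mk_covBy_mk_iff.2 (.inl ⟨h3, rfl⟩)),
        (UpperProd.covBy_iff_of_eq_top hy).2 ⟨h4, hb₂⟩, .inl ?_⟩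
      rw [upperLabeling_of_fst_ne hat' h3.ne, upperLabeling_of_fst_ne hat hA.ne]
      exact .rel (hj.left h5)
    · rw [upperLabeling_lt_iff_right hj ho₁ ho₂ hr ha hA.ne (hr.insert ha) hb hb₂.ne le_rfl,
        Set.image_insert_eq] at hab
      obtain ⟨a', h3, h4, h5⟩ := ho₂.exists_switch h₂ hP₂ hr₂ hA hb₂ hab
      have hat' : (x₁, a') ≠ (⊤, ⊤) := fun h => h4.ne (congrArg Prod.snd h)
      have hc : (⟨(x₁, x₂), px⟩ : UpperProd P₁ P₂) ⋖ ⟨(x₁, a'), .inr ⟨hb₁.ne, h4.ne⟩⟩ :=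
        (UpperProd.covBy_iff hat').2 (Prod.mk_covBy_mk_iff.2 (.inr ⟨h3, rfl⟩))
      refine ⟨⟨(x₁, a'), .inr ⟨hb₁.ne, h4.ne⟩⟩, hc,
        (UpperProd.covBy_iff_of_eq_top hy).2 ⟨hb₁, h4⟩, .inl ?_⟩
      rw [upperLabeling_of_snd_ne hc hat' h3.ne, upperLabeling_of_snd_ne ha hat hA.ne]
      exact .rel (hj.right h5)
  · rw [upperLabeling_of_ne_top hat, upperLabeling_of_ne_top hy, singleton_lt_singleton,
      Set.image_insert_eq] at hab
    obtain ⟨a', h3, h4, h5⟩ := exists_switch_prodLabeling hP₁ hP₂ h₁ h₂ hj.toIsShuffle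
      (Set.mem_image_of_mem Subtype.val hr.mem) (by rwa [Set.image_image])
      (by rwa [Set.image_image]) ha' ((UpperProd.covBy_iff hy).1 hb) hab
    have pa' : a'.1 ≠ ⊤ ∧ a'.2 ≠ ⊤ := ⟨ne_top_of_le_ne_top (UpperProd.ne_top hy).1 h4.le.1,
      ne_top_of_le_ne_top (UpperProd.ne_top hy).2 h4.le.2⟩
    have hat' : a' ≠ (⊤, ⊤) := fun h => pa'.1 (congrArg Prod.fst h)
    refine ⟨⟨a', .inr pa'⟩, (UpperProd.covBy_iff hat').2 h3, (UpperProd.covBy_iff hy).2 h4, ?_⟩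
    rw [upperLabeling_of_ne_top hat, upperLabeling_of_ne_top hy, upperLabeling_of_ne_top hat',
      upperLabeling_of_ne_top hy, singleton_lt_singleton, singleton_lt_singleton,
      Set.image_insert_eq, Set.image_insert_eq, List.cons.injEq]
    simpa only [and_true] using h5

theorem isProductLabeling_upperLabeling {k₁ k₂ : ℕ} (hP₁ : HasRank (Set.univ : Set P₁) k₁)
    (hP₂ : HasRank (Set.univ : Set P₂) k₂) (h₁ : IsCLLabeling lam₁) (h₂ : IsCLLabeling lam₂)
    (hj : IsOrderlyShuffle part₁ part₂ j₁ j₂) (ho₁ : IsCoorderly lam₁ part₁)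
    (ho₂ : IsCoorderly lam₂ part₂) :
    IsProductLabeling (fun x : UpperProd P₁ P₂ => x.1.1) (fun x : UpperProd P₁ P₂ => x.1.2)
      lam₁ lam₂ (upperLabeling j₁ j₂ lam₁ lam₂) where
  lt_iff_left _ _ _ _ _ _ hr hz hm hr' hz' hm' h :=
    upperLabeling_lt_iff_left hj.toIsShuffle ho₁ hr hz hm hr' hz' hm' h
  lt_iff_right _ _ _ _ _ _ hr hz hm hr' hz' hm' h :=
    upperLabeling_lt_iff_right hj ho₁ ho₂ hr hz hm hr' hz' hm' h
  eq_left r x z r' x' z' _ hz hm _ _ hxx e₁ e₂ e₃ := by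
    have hy := UpperProd.ne_top_of_snd_eq hz hm
    have hm' : x.1.1 ≠ z.1.1 := fun h => hz.ne (Subtype.ext (Prod.ext h hm))
    have hy' : z'.1 ≠ (⊤, ⊤) := fun h =>
      (UpperProd.ne_top hy).1 (e₃.symm.trans (UpperProd.fst_eq_top h))
    rw [upperLabeling_of_fst_ne hy hm', upperLabeling_of_fst_ne hy' (by rwa [e₂, e₃]), e₁, e₂, e₃]
  eq_right r x z r' x' z' _ hz hm _ hz' hxx e₁ e₂ e₃ := by
    have hy := UpperProd.ne_top_of_fst_eq hz hm
    have hm' : x.1.2 ≠ z.1.2 := fun h => hz.ne (Subtype.ext (Prod.ext hm h))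
    have hy' : z'.1 ≠ (⊤, ⊤) := fun h =>
      (UpperProd.ne_top hy).2 (e₃.symm.trans (UpperProd.snd_eq_top h))
    rw [upperLabeling_of_fst_eq hy hm, upperLabeling_of_snd_ne hz' hy' (by rwa [e₂, e₃]),
      e₁, e₂, e₃]
  ne r x z z' _ hz hz' hm hm' := by
    rw [upperLabeling_of_fst_ne (UpperProd.ne_top_of_snd_eq hz hm)
        fun h => hz.ne (Subtype.ext (Prod.ext h hm)),
      upperLabeling_of_fst_eq (UpperProd.ne_top_of_fst_eq hz' hm') hm', Ne, List.cons.injEq]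
    exact fun h => hj.disjoint _ _ h.1
  isSwitchable := isSwitchable_upperLabeling hP₁ hP₂ h₁ h₂ hj ho₁ ho₂

end UpperProduct

/-! ### Face lattices of polytopes in terms of vertex sets -/

section VertexFaces

/-- The index set `W` is cut out of the point family `v` by a supporting half-space. -/
def IsVertexFace {I E : Type*} [AddCommGroup E] [Module ℝ E] [TopologicalSpace E] (v : I → E)
    (W : Set I) : Prop :=
  ∃ (l : StrongDual ℝ E) (m : ℝ), (∀ i, l (v i) ≤ m) ∧ ∀ i, i ∈ W ↔ l (v i) = m

/-- The map `g` identifies the poset `L` with the vertex faces of the point family `v`. -/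
structure IsFaceMap {L I E : Type*} [PartialOrder L] [AddCommGroup E] [Module ℝ E]
    [TopologicalSpace E] (v : I → E) (g : L → Set I) : Prop where
  le_iff : ∀ x y, x ≤ y ↔ g x ⊆ g y
  isVertexFace_iff : ∀ W, IsVertexFace v W ↔ ∃ x, g x = W

variable {I I' E E' : Type*} [AddCommGroup E] [Module ℝ E] [TopologicalSpace E]
  [AddCommGroup E'] [Module ℝ E'] [TopologicalSpace E']

theorem isVertexFace_empty (v : I → E) : IsVertexFace v ∅ := ⟨0, 1, by simp, by simp⟩

theorem isVertexFace_univ (v : I → E) : IsVertexFace v Set.univ := ⟨0, 0, by simp, by simp⟩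

theorem IsVertexFace.preimage {v : I → E} {v' : I' → E'} {W : Set I} (h : IsVertexFace v W)
    (f : I' → I) (T : E' →L[ℝ] E) (c : E) (hf : ∀ i, v (f i) = T (v' i) + c) :
    IsVertexFace v' (f ⁻¹' W) := by
  obtain ⟨l, m, h1, h2⟩ := h
  refine ⟨l.comp T, m - l c, fun i => ?_, fun i => ?_⟩
  · have := h1 (f i)
    rw [hf, map_add] at this
    exact le_sub_iff_add_le.2 this
  · rw [Set.mem_preimage, h2, hf, map_add]
    exact eq_sub_iff_add_eq.symm

section FaceMap

variable {L : Type*} [PartialOrder L] {v : I → E} {g : L → Set I}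

theorem IsFaceMap.injective (hg : IsFaceMap v g) : Function.Injective g := fun _ _ h =>
  le_antisymm ((hg.le_iff _ _).2 h.le) ((hg.le_iff _ _).2 h.ge)

theorem IsFaceMap.isVertexFace (hg : IsFaceMap v g) (x : L) : IsVertexFace v (g x) :=
  (hg.isVertexFace_iff _).2 ⟨x, rfl⟩

theorem IsFaceMap.eq_empty_iff (hg : IsFaceMap v g) {x₀ : L} (hx₀ : ∀ y, x₀ ≤ y) {x : L} :
    g x = ∅ ↔ x = x₀ := by
  obtain ⟨y, hy⟩ := (hg.isVertexFace_iff _).1 (isVertexFace_empty v)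
  have h₀ : g x₀ = ∅ := Set.subset_empty_iff.1 (hy ▸ (hg.le_iff _ _).1 (hx₀ y))
  rw [← h₀, hg.injective.eq_iff]

theorem IsFaceMap.eq_univ_iff (hg : IsFaceMap v g) {x₀ : L} (hx₀ : ∀ y, y ≤ x₀) {x : L} :
    g x = Set.univ ↔ x = x₀ := by
  obtain ⟨y, hy⟩ := (hg.isVertexFace_iff _).1 (isVertexFace_univ v)
  have h₀ : g x₀ = Set.univ := Set.univ_subset_iff.1 (hy ▸ (hg.le_iff _ _).1 (hx₀ y))
  rw [← h₀, hg.injective.eq_iff]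

theorem IsFaceMap.congr (hg : IsFaceMap v g) {v' : I → E'} (T : E' →L[ℝ] E) (c : E)
    (h : ∀ i, v i = T (v' i) + c) (T' : E →L[ℝ] E') (c' : E') (h' : ∀ i, v' i = T' (v i) + c') :
    IsFaceMap v' g where
  le_iff := hg.le_iff
  isVertexFace_iff W := by
    rw [← hg.isVertexFace_iff]
    exact ⟨fun hW => hW.preimage id T' c' h', fun hW => hW.preimage id T c h⟩

end FaceMap

/-- By Krein–Milman an exposed face is the closed hull of its extreme points, and these are extreme
in the polytope, hence among the `v i`. The points `v i` need not all be vertices. -/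
theorem isExposed_subset_iff [Finite I] [IsTopologicalAddGroup E] [ContinuousSMul ℝ E] [T2Space E]
    [LocallyConvexSpace ℝ E] {v : I → E} {F F' : Set E}
    (hF : IsExposed ℝ (convexHull ℝ (Set.range v)) F)
    (hF' : IsExposed ℝ (convexHull ℝ (Set.range v)) F') : F ⊆ F' ↔ v ⁻¹' F ⊆ v ⁻¹' F' := by
  refine ⟨Set.preimage_mono, fun h => ?_⟩
  have hK : IsCompact (convexHull ℝ (Set.range v)) := (Set.finite_range v).isCompact_convexHull ℝ
  have hconv := convex_convexHull ℝ (Set.range v)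
  rw [← closure_convexHull_extremePoints (hF.isCompact hK) (hF.convex hconv)]
  refine closure_minimal (convexHull_min (fun x hx => ?_) (hF'.convex hconv))
    (hF'.isCompact hK).isClosed
  obtain ⟨i, rfl⟩ := extremePoints_convexHull_subset
    (hF.isExtreme.extremePoints_subset_extremePoints hx)
  exact h (a := i) (extremePoints_subset (𝕜 := ℝ) (A := F) hx)

theorem le_of_mem_convexHull_range {v : I → E} {l : StrongDual ℝ E} {m : ℝ}
    (h : ∀ i, l (v i) ≤ m) {y : E} (hy : y ∈ convexHull ℝ (Set.range v)) : l y ≤ m :=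
  convexHull_min (t := {y | l y ≤ m}) (Set.range_subset_iff.2 h)
    (convex_halfSpace_le l.toLinearMap.isLinear m) hy

theorem isVertexFace_iff_exists_isExposed {v : I → E} {W : Set I} :
    IsVertexFace v W ↔ ∃ F, IsExposed ℝ (convexHull ℝ (Set.range v)) F ∧ v ⁻¹' F = W := by
  have hv : ∀ i, v i ∈ convexHull ℝ (Set.range v) := fun i =>
    subset_convexHull ℝ _ (Set.mem_range_self i)
  constructor
  · rintro ⟨l, m, h1, h2⟩
    rcases W.eq_empty_or_nonempty with rfl | ⟨i₀, hi₀⟩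
    -- The bound `m` is not attained here, so `l` does not expose the empty face; `∅` is exposed by
    -- convention.
    · exact ⟨∅, fun h => absurd h Set.not_nonempty_empty, rfl⟩
    · refine ⟨_, fun _ => ⟨l, rfl⟩, ?_⟩
      ext i
      rw [h2]
      constructor
      · rintro ⟨-, h⟩
        exact le_antisymm (h1 i) ((h2 i₀).1 hi₀ ▸ h _ (hv i₀))
      · intro h
        exact ⟨hv i, fun y hy => h ▸ le_of_mem_convexHull_range h1 hy⟩
  · rintro ⟨F, hF, rfl⟩
    rcases F.eq_empty_or_nonempty with rfl | hne
    · exact isVertexFace_empty v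
    · obtain ⟨l, rfl⟩ := hF hne
      obtain ⟨x₀, hx₀, h⟩ := hne
      refine ⟨l, l x₀, fun i => h _ (hv i), fun i => ⟨?_, ?_⟩⟩
      · rintro ⟨-, h'⟩
        exact le_antisymm (h _ (hv i)) (h' _ hx₀)
      · intro e
        exact ⟨hv i, fun y hy => e ▸ h y hy⟩

theorem IsPolytopeFaceLattice.exists_isFaceMap {L : Type*} [PartialOrder L]
    (h : IsPolytopeFaceLattice L) :
    ∃ (n : ℕ) (I : Type) (_ : Finite I) (v : I → Fin n → ℝ) (g : L → Set I), IsFaceMap v g := by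
  obtain ⟨n, V, ⟨e⟩⟩ := h
  have hV : Set.range ((↑) : V → Fin n → ℝ) = (V : Set (Fin n → ℝ)) := Subtype.range_coe
  rw [← hV] at e
  refine ⟨n, V, inferInstance, (↑), fun x => (↑) ⁻¹' (e x).1, fun x y => ?_, fun W => ?_⟩
  · rw [← isExposed_subset_iff (e x).2 (e y).2, ← e.le_iff_le]
    rfl
  · rw [isVertexFace_iff_exists_isExposed]
    constructor
    · rintro ⟨F, hF, rfl⟩
      exact ⟨e.symm ⟨F, hF⟩, by simp⟩
    · rintro ⟨x, rfl⟩
      exact ⟨_, (e x).2, rfl⟩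

theorem IsFaceMap.isPolytopeFaceLattice {L I E : Type*} [PartialOrder L] [Finite I]
    [NormedAddCommGroup E] [NormedSpace ℝ E] [FiniteDimensional ℝ E] {v : I → E} {g : L → Set I}
    (hg : IsFaceMap v g) : IsPolytopeFaceLattice L := by
  classical
  have e : E ≃L[ℝ] (Fin (Module.finrank ℝ E) → ℝ) :=
    ContinuousLinearEquiv.ofFinrankEq (by simp)
  have hg' : IsFaceMap (fun i => e (v i)) g :=
    hg.congr e.symm.toContinuousLinearMap 0 (by simp) e.toContinuousLinearMap 0 (by simp)
  obtain ⟨V, hV⟩ := (Set.finite_range fun i => e (v i)).exists_finset_coe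
  refine ⟨_, V, ?_⟩
  rw [hV]
  choose F hF hFg using fun x => isVertexFace_iff_exists_isExposed.1 (hg'.isVertexFace x)
  refine ⟨RelIso.ofSurjective (OrderEmbedding.ofMapLEIff (fun x => ⟨F x, hF x⟩) fun x y => ?_) ?_⟩
  · rw [Subtype.mk_le_mk, isExposed_subset_iff (hF x) (hF y), hFg, hFg,
      ← hg.le_iff]
  · rintro ⟨F', hF'⟩
    obtain ⟨x, hx⟩ := (hg'.isVertexFace_iff _).1
      (isVertexFace_iff_exists_isExposed.2 ⟨F', hF', rfl⟩)
    refine ⟨x, Subtype.ext (Set.Subset.antisymm ?_ ?_)⟩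
    · exact (isExposed_subset_iff (hF x) hF').2 (by rw [hFg, hx])
    · exact (isExposed_subset_iff hF' (hF x)).2 (by rw [hFg, hx])

end VertexFaces

/-! ### Joins, products and free sums of polytopes -/

section Constructions

variable {I₁ I₂ E₁ E₂ : Type*}
  [NormedAddCommGroup E₁] [NormedSpace ℝ E₁] [NormedAddCommGroup E₂] [NormedSpace ℝ E₂]
  {v₁ : I₁ → E₁} {v₂ : I₂ → E₂}

theorem isVertexFace_join_iff {W : Set (I₁ ⊕ I₂)} :
    IsVertexFace (Sum.elim (fun i => (v₁ i, (0 : E₂), (0 : ℝ))) fun j => (0, v₂ j, 1)) W ↔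
      IsVertexFace v₁ (Sum.inl ⁻¹' W) ∧ IsVertexFace v₂ (Sum.inr ⁻¹' W) := by
  constructor
  · intro h
    refine ⟨h.preimage Sum.inl (.inl ℝ E₁ (E₂ × ℝ)) 0 ?_,
      h.preimage Sum.inr ((ContinuousLinearMap.inr ℝ E₁ (E₂ × ℝ)).comp (.inl ℝ E₂ ℝ))
        (0, 0, 1) ?_⟩ <;>
    simp
  · rintro ⟨⟨l₁, m₁, h1, h2⟩, l₂, m₂, h3, h4⟩
    -- The second family sits at height one, so the weight `m₁ - m₂` on the height shifts its bound
    -- from `m₂` to `m₁`.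
    refine ⟨l₁.coprod (l₂.coprod ((m₁ - m₂) • ContinuousLinearMap.id ℝ ℝ)), m₁, ?_, ?_⟩
    · rintro (i | j)
      · simpa using h1 i
      · have := h3 j
        simp only [Sum.elim_inr, ContinuousLinearMap.coprod_apply, map_zero, zero_add,
          smul_apply, ContinuousLinearMap.id_apply, smul_eq_mul, mul_one]
        linarith
    · rintro (i | j)
      · simpa using h2 i
      · have := h4 j
        rw [Set.mem_preimage] at this
        rw [this]
        simp only [Sum.elim_inr, ContinuousLinearMap.coprod_apply, map_zero, zero_add,
          smul_apply, ContinuousLinearMap.id_apply, smul_eq_mul, mul_one]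
        constructor <;> intro h <;> linarith

theorem isVertexFace_product {W₁ : Set I₁} {W₂ : Set I₂} (h₁ : IsVertexFace v₁ W₁)
    (h₂ : IsVertexFace v₂ W₂) : IsVertexFace (fun p : I₁ × I₂ => (v₁ p.1, v₂ p.2)) (W₁ ×ˢ W₂) := by
  obtain ⟨l₁, m₁, h1, h2⟩ := h₁
  obtain ⟨l₂, m₂, h3, h4⟩ := h₂
  refine ⟨l₁.coprod l₂, m₁ + m₂, fun p => ?_, fun p => ?_⟩
  · simpa using add_le_add (h1 p.1) (h3 p.2)
  · rw [Set.mem_prod, h2, h4, ContinuousLinearMap.coprod_apply]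
    have := h1 p.1
    have := h3 p.2
    constructor
    · rintro ⟨e1, e2⟩
      rw [e1, e2]
    · intro e
      constructor <;> linarith

/-- A functional on the product is a sum `a i + b j`, so it is maximal at `(i, j)` iff it is at `(i,
j₀)` and at `(i₀, j)`, where `(i₀, j₀)` is a point of `W`. -/
theorem IsVertexFace.exists_eq_prod {W : Set (I₁ × I₂)}
    (h : IsVertexFace (fun p : I₁ × I₂ => (v₁ p.1, v₂ p.2)) W) (hne : W.Nonempty) :
    ∃ W₁ W₂, IsVertexFace v₁ W₁ ∧ IsVertexFace v₂ W₂ ∧ W = W₁ ×ˢ W₂ := by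
  obtain ⟨⟨i₀, j₀⟩, h₀⟩ := hne
  refine ⟨(fun i => (i, j₀)) ⁻¹' W, (fun j => (i₀, j)) ⁻¹' W,
    h.preimage _ (.inl ℝ E₁ E₂) (0, v₂ j₀) (by simp),
    h.preimage _ (.inr ℝ E₁ E₂) (v₁ i₀, 0) (by simp), ?_⟩
  obtain ⟨l, m, h1, h2⟩ := h
  have hl : ∀ p : E₁ × E₂, l p = l.comp (.inl ℝ E₁ E₂) p.1 + l.comp (.inr ℝ E₁ E₂) p.2 :=
    fun p => by simp [← map_add]
  simp only [hl] at h1 h2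
  have e₀ := (h2 _).1 h₀
  ext ⟨i, j⟩
  have e1 := h1 (i, j₀)
  have e2 := h1 (i₀, j)
  rw [Set.mem_prod, Set.mem_preimage, Set.mem_preimage, h2, h2, h2]
  dsimp only at e₀ e1 e2 ⊢
  constructor
  · intro e
    constructor <;> linarith
  · rintro ⟨e3, e4⟩
    linarith

theorem eq_univ_of_nonpos [Finite I₁] (hsum : ∑ᶠ i, v₁ i = 0) {l : StrongDual ℝ E₁}
    (h : ∀ i, l (v₁ i) ≤ 0) (i : I₁) : l (v₁ i) = 0 := by
  have := Fintype.ofFinite I₁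
  rw [finsum_eq_sum_of_fintype] at hsum
  have : ∑ i, l (v₁ i) = 0 := by rw [← map_sum, hsum, map_zero]
  exact (Finset.sum_eq_zero_iff_of_nonpos fun i _ => h i).1 this i (Finset.mem_univ i)

theorem bound_nonneg [Finite I₁] [Nonempty I₁] (hsum : ∑ᶠ i, v₁ i = 0) {l : StrongDual ℝ E₁}
    {m : ℝ} (h : ∀ i, l (v₁ i) ≤ m) : 0 ≤ m := by
  by_contra! hm
  obtain ⟨i⟩ := ‹Nonempty I₁›
  have := eq_univ_of_nonpos hsum (fun i => (h i).trans hm.le) i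
  have := h i
  linarith

/-- With barycenter zero the bound is nonnegative, and it vanishes only if the functional vanishes
on all points. For a proper face it can thus be scaled to `1`. -/
theorem IsVertexFace.exists_of_ne_univ [Finite I₁] [Nonempty I₁] (hsum : ∑ᶠ i, v₁ i = 0)
    {W : Set I₁} (h : IsVertexFace v₁ W) (hW : W ≠ Set.univ) :
    ∃ l : StrongDual ℝ E₁, (∀ i, l (v₁ i) ≤ 1) ∧ ∀ i, i ∈ W ↔ l (v₁ i) = 1 := by
  obtain ⟨l, m, h1, h2⟩ := h
  have hm : 0 < m := by
    refine (bound_nonneg hsum h1).lt_of_ne ?_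
    rintro rfl
    exact hW (Set.eq_univ_of_forall fun i => (h2 i).2 (eq_univ_of_nonpos hsum h1 i))
  refine ⟨m⁻¹ • l, fun i => ?_, fun i => ?_⟩
  · rw [smul_apply, smul_eq_mul, inv_mul_le_one₀ hm]
    exact h1 i
  · rw [smul_apply, smul_eq_mul, inv_mul_eq_one₀ hm.ne', h2, eq_comm]

/-- A common bound `0` gives the whole of both families; a positive one gives a proper face of each,
because a constant positive value would contradict the zero barycenter. Conversely, functionals with
bound `1` on both summands combine. -/
theorem isVertexFace_sum_iff [Finite I₁] [Nonempty I₁] [Finite I₂] [Nonempty I₂]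
    (hsum₁ : ∑ᶠ i, v₁ i = 0) (hsum₂ : ∑ᶠ i, v₂ i = 0) {W : Set (I₁ ⊕ I₂)} :
    IsVertexFace (Sum.elim (fun i => (v₁ i, (0 : E₂))) fun j => (0, v₂ j)) W ↔
      IsVertexFace v₁ (Sum.inl ⁻¹' W) ∧ IsVertexFace v₂ (Sum.inr ⁻¹' W) ∧
        (Sum.inl ⁻¹' W = Set.univ ↔ Sum.inr ⁻¹' W = Set.univ) := by
  constructor
  · intro h
    refine ⟨h.preimage Sum.inl (.inl ℝ E₁ E₂) 0 (by simp),
      h.preimage Sum.inr (.inr ℝ E₁ E₂) 0 (by simp), ?_⟩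
    obtain ⟨l, m, h1, h2⟩ := h
    have h3 : ∀ i, l.comp (.inl ℝ E₁ E₂) (v₁ i) ≤ m := fun i => h1 (.inl i)
    have h4 : ∀ j, l.comp (.inr ℝ E₁ E₂) (v₂ j) ≤ m := fun j => h1 (.inr j)
    rcases (bound_nonneg hsum₁ h3).eq_or_lt with rfl | hm
    · refine iff_of_true ?_ ?_
      · exact Set.eq_univ_of_forall fun i => (h2 (.inl i)).2 (eq_univ_of_nonpos hsum₁ h3 i)
      · exact Set.eq_univ_of_forall fun j => (h2 (.inr j)).2 (eq_univ_of_nonpos hsum₂ h4 j)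
    · refine iff_of_false (fun h => ?_) fun h => ?_
      · have key : ∀ i, l.comp (.inl ℝ E₁ E₂) (v₁ i) = m := fun i =>
          (h2 (.inl i)).1 (Set.eq_univ_iff_forall.1 h i)
        have := bound_nonneg (m := -m) (l := -l.comp (.inl ℝ E₁ E₂)) hsum₁ fun i => by
          rw [neg_apply, key]
        linarith
      · have key : ∀ j, l.comp (.inr ℝ E₁ E₂) (v₂ j) = m := fun j =>
          (h2 (.inr j)).1 (Set.eq_univ_iff_forall.1 h j)
        have := bound_nonneg (m := -m) (l := -l.comp (.inr ℝ E₁ E₂)) hsum₂ fun j => by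
          rw [neg_apply, key]
        linarith
  · rintro ⟨h₁, h₂, hiff⟩
    by_cases hu : Sum.inl ⁻¹' W = Set.univ
    · convert isVertexFace_univ _
      refine Set.eq_univ_of_forall ?_
      rintro (i | j)
      · exact Set.eq_univ_iff_forall.1 hu i
      · exact Set.eq_univ_iff_forall.1 (hiff.1 hu) j
    · obtain ⟨l₁, h1, h2⟩ := h₁.exists_of_ne_univ hsum₁ hu
      obtain ⟨l₂, h3, h4⟩ := h₂.exists_of_ne_univ hsum₂ fun h => hu (hiff.2 h)
      refine ⟨l₁.coprod l₂, 1, ?_, ?_⟩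
      · rintro (i | j)
        · simpa using h1 i
        · simpa using h3 j
      · rintro (i | j)
        · simpa using h2 i
        · simpa using h4 j

/-- A point family can be translated to have barycenter zero without changing its faces. -/
theorem IsFaceMap.exists_finsum_eq_zero {L : Type*} [PartialOrder L] [Finite I₁] {g : L → Set I₁}
    (hg : IsFaceMap v₁ g) : ∃ v : I₁ → E₁, ∑ᶠ i, v i = 0 ∧ IsFaceMap v g := by
  have := Fintype.ofFinite I₁
  rcases isEmpty_or_nonempty I₁ with h | h
  · exact ⟨v₁, finsum_of_isEmpty v₁, hg⟩
  · have hc : (Fintype.card I₁ : ℝ) ≠ 0 := Nat.cast_ne_zero.2 Fintype.card_ne_zero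
    refine ⟨fun i => v₁ i - (Fintype.card I₁ : ℝ)⁻¹ • ∑ j, v₁ j, ?_,
      hg.congr (.id ℝ E₁) ((Fintype.card I₁ : ℝ)⁻¹ • ∑ j, v₁ j)
        (fun _ => (sub_add_cancel _ _).symm) (.id ℝ E₁)
        (-((Fintype.card I₁ : ℝ)⁻¹ • ∑ j, v₁ j)) fun _ => sub_eq_add_neg _ _⟩
    rw [finsum_eq_sum_of_fintype, Finset.sum_sub_distrib, Finset.sum_const, Finset.card_univ,
      ← Nat.cast_smul_eq_nsmul ℝ, smul_smul, mul_inv_cancel₀ hc, one_smul, sub_self]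

end Constructions

/-! ### The three products of polytope face lattices -/

section ProductFaceLattices

theorem preimage_inl_sum_image {I₁ I₂ : Type*} (A : Set I₁) (B : Set I₂) :
    Sum.inl ⁻¹' (Sum.inl '' A ∪ Sum.inr '' B) = A := by
  ext; simp

theorem preimage_inr_sum_image {I₁ I₂ : Type*} (A : Set I₁) (B : Set I₂) :
    Sum.inr ⁻¹' (Sum.inl '' A ∪ Sum.inr '' B) = B := by
  ext; simp

theorem sum_image_preimage {I₁ I₂ : Type*} (W : Set (I₁ ⊕ I₂)) :
    Sum.inl '' (Sum.inl ⁻¹' W) ∪ Sum.inr '' (Sum.inr ⁻¹' W) = W :=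
  Set.image_preimage_inl_union_image_preimage_inr W

theorem sum_image_subset_iff {I₁ I₂ : Type*} {A A' : Set I₁} {B B' : Set I₂} :
    Sum.inl '' A ∪ Sum.inr '' B ⊆ (Sum.inl '' A' ∪ Sum.inr '' B' : Set (I₁ ⊕ I₂)) ↔
      A ⊆ A' ∧ B ⊆ B' := by
  rw [Set.union_subset_iff, Set.image_subset_iff, Set.image_subset_iff, preimage_inl_sum_image,
    preimage_inr_sum_image]

variable {P₁ P₂ : Type*} [PartialOrder P₁] [PartialOrder P₂] {S₁ : Set P₁} {S₂ : Set P₂}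

theorem IsPolytopeFaceLattice.prod {Q : Type*} [PartialOrder Q] (f₁ : Q → P₁) (f₂ : Q → P₂)
    (hle : ∀ x y, x ≤ y ↔ f₁ x ≤ f₁ y ∧ f₂ x ≤ f₂ y) (hsurj : ∀ x₁ x₂, ∃ q, f₁ q = x₁ ∧ f₂ q = x₂)
    (h₁ : IsPolytopeFaceLattice S₁) (h₂ : IsPolytopeFaceLattice S₂) :
    IsPolytopeFaceLattice {q | f₁ q ∈ S₁ ∧ f₂ q ∈ S₂} := by
  obtain ⟨n₁, I₁, _, v₁, g₁, hg₁⟩ := h₁.exists_isFaceMap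
  obtain ⟨n₂, I₂, _, v₂, g₂, hg₂⟩ := h₂.exists_isFaceMap
  refine IsFaceMap.isPolytopeFaceLattice
    (v := Sum.elim (fun i => (v₁ i, (0 : Fin n₂ → ℝ), (0 : ℝ))) fun j => (0, v₂ j, 1))
    (g := fun q => Sum.inl '' g₁ ⟨f₁ q, q.2.1⟩ ∪ Sum.inr '' g₂ ⟨f₂ q, q.2.2⟩) ⟨?_, ?_⟩
  · intro x y
    rw [sum_image_subset_iff, ← hg₁.le_iff, ← hg₂.le_iff]
    exact hle x y
  · intro W
    rw [isVertexFace_join_iff, hg₁.isVertexFace_iff, hg₂.isVertexFace_iff]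
    constructor
    · rintro ⟨⟨x₁, h1⟩, ⟨x₂, h2⟩⟩
      obtain ⟨q, h3, h4⟩ := hsurj x₁ x₂
      obtain ⟨x₁, hx₁⟩ := x₁
      obtain ⟨x₂, hx₂⟩ := x₂
      subst h3 h4
      exact ⟨⟨q, hx₁, hx₂⟩, by rw [h1, h2, sum_image_preimage]⟩
    · rintro ⟨q, rfl⟩
      exact ⟨⟨_, (preimage_inl_sum_image _ _).symm⟩, ⟨_, (preimage_inr_sum_image _ _).symm⟩⟩

variable [BoundedOrder P₁] [BoundedOrder P₂]

theorem IsPolytopeFaceLattice.lowerProd (hS₁ : ⊥ ∈ S₁) (hS₂ : ⊥ ∈ S₂)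
    (h₁ : IsPolytopeFaceLattice S₁) (h₂ : IsPolytopeFaceLattice S₂) :
    IsPolytopeFaceLattice {q : LowerProd P₁ P₂ | q.1.1 ∈ S₁ ∧ q.1.2 ∈ S₂} := by
  obtain ⟨n₁, I₁, _, v₁, g₁, hg₁⟩ := h₁.exists_isFaceMap
  obtain ⟨n₂, I₂, _, v₂, g₂, hg₂⟩ := h₂.exists_isFaceMap
  have e₁ : ∀ x, g₁ x = ∅ ↔ x.1 = ⊥ := fun x =>
    (hg₁.eq_empty_iff (x₀ := ⟨⊥, hS₁⟩) fun y => (bot_le : ⊥ ≤ y.1)).trans Subtype.ext_iff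
  have e₂ : ∀ x, g₂ x = ∅ ↔ x.1 = ⊥ := fun x =>
    (hg₂.eq_empty_iff (x₀ := ⟨⊥, hS₂⟩) fun y => (bot_le : ⊥ ≤ y.1)).trans Subtype.ext_iff
  refine IsFaceMap.isPolytopeFaceLattice (v := fun p : I₁ × I₂ => (v₁ p.1, v₂ p.2))
    (g := fun q => g₁ ⟨q.1.1.1, q.2.1⟩ ×ˢ g₂ ⟨q.1.1.2, q.2.2⟩) ⟨?_, ?_⟩
  · rintro ⟨x, hx₁, hx₂⟩ ⟨y, hy₁, hy₂⟩
    have key : x ≤ y ↔ g₁ ⟨x.1.1, hx₁⟩ ⊆ g₁ ⟨y.1.1, hy₁⟩ ∧ g₂ ⟨x.1.2, hx₂⟩ ⊆ g₂ ⟨y.1.2, hy₂⟩ := by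
      rw [← hg₁.le_iff, ← hg₂.le_iff]
      rfl
    rw [Subtype.mk_le_mk, Set.prod_subset_prod_iff, e₁, e₂, key]
    -- An inclusion of products says nothing about the factors if one of them is empty; in the
    -- reduced product that happens only at the bottom.
    refine ⟨.inl, fun h => h.elim id fun h => ?_⟩
    have hx : x.1 = (⊥, ⊥) := by
      by_contra hx
      exact h.elim (LowerProd.ne_bot hx).1 (LowerProd.ne_bot hx).2
    rw [(e₁ _).2 (LowerProd.fst_eq_bot hx), (e₂ _).2 (LowerProd.snd_eq_bot hx)]
    exact ⟨Set.empty_subset _, Set.empty_subset _⟩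
  · intro W
    constructor
    · intro hW
      rcases W.eq_empty_or_nonempty with rfl | hne
      · refine ⟨⟨⟨(⊥, ⊥), .inl rfl⟩, hS₁, hS₂⟩, ?_⟩
        rw [Set.prod_eq_empty_iff]
        exact .inl ((e₁ _).2 rfl)
      · obtain ⟨W₁, W₂, hW₁, hW₂, rfl⟩ := hW.exists_eq_prod hne
        obtain ⟨x₁, rfl⟩ := (hg₁.isVertexFace_iff _).1 hW₁
        obtain ⟨x₂, rfl⟩ := (hg₂.isVertexFace_iff _).1 hW₂
        refine ⟨⟨⟨(x₁.1, x₂.1), .inr ⟨fun h => ?_, fun h => ?_⟩⟩, x₁.2, x₂.2⟩, rfl⟩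
        · exact hne.fst.ne_empty ((e₁ _).2 h)
        · exact hne.snd.ne_empty ((e₂ _).2 h)
    · rintro ⟨q, rfl⟩
      exact isVertexFace_product (hg₁.isVertexFace _) (hg₂.isVertexFace _)

theorem IsPolytopeFaceLattice.upperProd [Nontrivial P₁] [Nontrivial P₂]
    (hb₁ : ⊥ ∈ S₁) (hb₂ : ⊥ ∈ S₂) (ht₁ : ⊤ ∈ S₁) (ht₂ : ⊤ ∈ S₂)
    (h₁ : IsPolytopeFaceLattice S₁) (h₂ : IsPolytopeFaceLattice S₂) :
    IsPolytopeFaceLattice {q : UpperProd P₁ P₂ | q.1.1 ∈ S₁ ∧ q.1.2 ∈ S₂} := by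
  obtain ⟨n₁, I₁, _, v₁, g₁, hg₁⟩ := h₁.exists_isFaceMap
  obtain ⟨n₂, I₂, _, v₂, g₂, hg₂⟩ := h₂.exists_isFaceMap
  obtain ⟨w₁, hsum₁, hg₁⟩ := hg₁.exists_finsum_eq_zero
  obtain ⟨w₂, hsum₂, hg₂⟩ := hg₂.exists_finsum_eq_zero
  have e₁ : ∀ x, g₁ x = Set.univ ↔ x.1 = ⊤ := fun x =>
    (hg₁.eq_univ_iff (x₀ := ⟨⊤, ht₁⟩) fun y => (le_top : y.1 ≤ ⊤)).trans Subtype.ext_iff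
  have e₂ : ∀ x, g₂ x = Set.univ ↔ x.1 = ⊤ := fun x =>
    (hg₂.eq_univ_iff (x₀ := ⟨⊤, ht₂⟩) fun y => (le_top : y.1 ≤ ⊤)).trans Subtype.ext_iff
  -- Without points, the empty set would be the whole index set, and the bounds of `S₁` would
  -- coincide.
  have : Nonempty I₁ := not_isEmpty_iff.1 fun _ =>
    bot_ne_top ((e₁ ⟨⊥, hb₁⟩).1 (Set.eq_univ_of_forall isEmptyElim))
  have : Nonempty I₂ := not_isEmpty_iff.1 fun _ =>
    bot_ne_top ((e₂ ⟨⊥, hb₂⟩).1 (Set.eq_univ_of_forall isEmptyElim))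
  refine IsFaceMap.isPolytopeFaceLattice
    (v := Sum.elim (fun i => (w₁ i, (0 : Fin n₂ → ℝ))) fun j => (0, w₂ j))
    (g := fun q => Sum.inl '' g₁ ⟨q.1.1.1, q.2.1⟩ ∪ Sum.inr '' g₂ ⟨q.1.1.2, q.2.2⟩) ⟨?_, ?_⟩
  · intro x y
    rw [sum_image_subset_iff, ← hg₁.le_iff, ← hg₂.le_iff]
    rfl
  · intro W
    rw [isVertexFace_sum_iff hsum₁ hsum₂, hg₁.isVertexFace_iff, hg₂.isVertexFace_iff]
    constructor
    · rintro ⟨⟨x₁, h1⟩, ⟨x₂, h2⟩, h3⟩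
      rw [← h1, ← h2, e₁, e₂] at h3
      refine ⟨⟨⟨(x₁.1, x₂.1), ?_⟩, x₁.2, x₂.2⟩, ?_⟩
      · by_cases h : x₁.1 = ⊤
        · exact .inl (Prod.ext h (h3.1 h))
        · exact .inr ⟨h, fun h' => h (h3.2 h')⟩
      · rw [← sum_image_preimage W, ← h1, ← h2]
    · rintro ⟨⟨q, hq₁, hq₂⟩, rfl⟩
      rw [preimage_inl_sum_image, preimage_inr_sum_image, e₁, e₂]
      refine ⟨⟨_, rfl⟩, ⟨_, rfl⟩, ?_⟩
      by_cases hq : q.1 = (⊤, ⊤)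
      · exact iff_of_true (UpperProd.fst_eq_top hq) (UpperProd.snd_eq_top hq)
      · exact iff_of_false (UpperProd.ne_top hq).1 (UpperProd.ne_top hq).2

end ProductFaceLattices

/-! ### One-point posets -/

/-- This is the face lattice of the empty polytope, whose only face is `∅`. -/
theorem isPolytopeFaceLattice_of_unique {L : Type*} [PartialOrder L] [Nonempty L]
    [Subsingleton L] : IsPolytopeFaceLattice L := by
  refine IsFaceMap.isPolytopeFaceLattice (v := (isEmptyElim : Empty → ℝ)) (g := fun _ => ∅)
    ⟨fun x y => iff_of_true (Subsingleton.elim x y).le le_rfl, fun W => ?_⟩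
  obtain rfl : W = ∅ := Set.eq_empty_of_isEmpty W
  exact iff_of_true (isVertexFace_empty _) ⟨Classical.arbitrary L, rfl⟩

theorem hasRank_zero_of_subsingleton {P : Type*} [PartialOrder P] [Subsingleton P] {S : Set P}
    (hS : S.Nonempty) : HasRank S 0 := by
  obtain ⟨x, hx⟩ := hS
  intro c hc
  have : x ∈ c := hc.mem_of_forall hx fun b _ => .inl (Subsingleton.elim x b).le
  rw [(Set.subsingleton_of_subsingleton (s := c)).eq_singleton_of_mem this, Set.ncard_singleton]

theorem isCLced_of_subsingleton {P Λ ι : Type*} [PartialOrder P] [Subsingleton P] [Nonempty P]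
    [LinearOrder Λ] [LinearOrder ι] [Nonempty ι] (lam : ChainEdgeLabeling P Λ) {Sig : ι → Set P}
    (hSig : ∀ s, (Sig s).Nonempty) : IsCLced lam Sig := by
  have hnil : ∀ {x y : P} {l : List P}, IsIntervalChain x y l → l = [] := fun {x y l} h => by
    obtain rfl := Subsingleton.elim x y
    exact h.eq_nil
  have hu : ∀ s, Sig s = Set.univ := fun s => by
    obtain ⟨x, hx⟩ := hSig s
    exact Set.eq_univ_of_forall fun y => Subsingleton.elim x y ▸ hx
  refine ⟨0, hasRank_zero_of_subsingleton Set.univ_nonempty,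
    fun s => hasRank_zero_of_subsingleton (hSig s), ?_, fun s => ?_, ?_, ?_, ?_⟩
  · intro r x y _ _
    exact ⟨[], isIntervalChain_nil.2 (Subsingleton.elim x y), List.isChain_nil,
      fun l hl _ => hnil hl, fun l hl hne => absurd (hnil hl) hne⟩
  · have := (hSig s).to_subtype
    exact isPolytopeFaceLattice_of_unique
  · intro s r x y _ l l' hl _ _ hl' _ _
    rw [hnil hl, hnil hl']
  -- All members are the whole poset, so a later ear contains no maximal chain.
  · rintro s t hts c - - ⟨m, hm, -⟩ -
    exact absurd (by rw [hu t, ← hu s]; exact hm.1) (hm.2 t hts)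
  · intro c _
    exact ⟨Classical.arbitrary ι, by rw [hu]; exact Set.subset_univ c⟩

theorem lowerProd_subsingleton {P₁ P₂ : Type*} [PartialOrder P₁] [BoundedOrder P₁]
    [PartialOrder P₂] [BoundedOrder P₂] (h : Subsingleton P₁ ∨ Subsingleton P₂) :
    Subsingleton (LowerProd P₁ P₂) := by
  have key : ∀ x : LowerProd P₁ P₂, x.1 = (⊥, ⊥) := fun x => by
    by_contra hx
    rcases h with h | h
    · exact (LowerProd.ne_bot hx).1 (Subsingleton.elim _ _)
    · exact (LowerProd.ne_bot hx).2 (Subsingleton.elim _ _)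
  exact ⟨fun x y => Subtype.ext ((key x).trans (key y).symm)⟩

theorem upperProd_subsingleton {P₁ P₂ : Type*} [PartialOrder P₁] [BoundedOrder P₁]
    [PartialOrder P₂] [BoundedOrder P₂] (h : Subsingleton P₁ ∨ Subsingleton P₂) :
    Subsingleton (UpperProd P₁ P₂) := by
  have key : ∀ x : UpperProd P₁ P₂, x.1 = (⊤, ⊤) := fun x => by
    by_contra hx
    rcases h with h | h
    · exact (UpperProd.ne_top hx).1 (Subsingleton.elim _ _)
    · exact (UpperProd.ne_top hx).2 (Subsingleton.elim _ _)
  exact ⟨fun x y => Subtype.ext ((key x).trans (key y).symm)⟩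

theorem mainTheorem5
    {P₁ P₂ Λ₁ Λ₂ Λ ι₁ ι₂ : Type*}
    [PartialOrder P₁] [BoundedOrder P₁] [Finite P₁]
    [PartialOrder P₂] [BoundedOrder P₂] [Finite P₂]
    [LinearOrder Λ₁] [LinearOrder Λ₂] [LinearOrder Λ]
    [LinearOrder ι₁] [Finite ι₁] [LinearOrder ι₂] [Finite ι₂]
    (lam₁ : ChainEdgeLabeling P₁ Λ₁) (lam₂ : ChainEdgeLabeling P₂ Λ₂)
    (Sig₁ : ι₁ → Set P₁) (Sig₂ : ι₂ → Set P₂)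
    (h₁ : IsCLced lam₁ Sig₁) (h₂ : IsCLced lam₂ Sig₂)
    (j₁ : Λ₁ → Λ) (j₂ : Λ₂ → Λ) :
    (IsShuffle j₁ j₂ →
      IsCLced (prodLabeling j₁ j₂ lam₁ lam₂) (prodFamily Sig₁ Sig₂)) ∧
    (∀ (part₁ : Λ₁ → SignType) (part₂ : Λ₂ → SignType),
      IsOrderly lam₁ part₁ → IsOrderly lam₂ part₂ → IsOrderlyShuffle part₁ part₂ j₁ j₂ →
      IsCLced (lowerLabeling j₁ j₂ lam₁ lam₂) (lowerFamily Sig₁ Sig₂)) ∧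
    (∀ (part₁ : Λ₁ → SignType) (part₂ : Λ₂ → SignType),
      IsCoorderly lam₁ part₁ → IsCoorderly lam₂ part₂ → IsOrderlyShuffle part₁ part₂ j₁ j₂ →
      IsCLced (upperLabeling j₁ j₂ lam₁ lam₂) (upperFamily Sig₁ Sig₂)) := by
  obtain ⟨k₁, h₁⟩ := h₁
  obtain ⟨k₂, h₂⟩ := h₂
  have hS₁ := h₁.isFullySaturated
  have hS₂ := h₂.isFullySaturated
  have hι : Nonempty (ι₁ ×ₗ ι₂) := by
    obtain ⟨s, -⟩ := h₁.union ∅ (by simp)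
    obtain ⟨t, -⟩ := h₂.union ∅ (by simp)
    exact ⟨toLex (s, t)⟩
  refine ⟨fun hj => ?_, fun part₁ part₂ ho₁ ho₂ hj => ?_, fun part₁ part₂ ho₁ ho₂ hj => ?_⟩
  · exact (isProductLabeling_prodLabeling h₁.rank_poset h₂.rank_poset h₁.labeling h₂.labeling
      hj).isCLced isProductLike_prod h₁ h₂ fun p => IsPolytopeFaceLattice.prod Prod.fst Prod.snd
        (fun _ _ => Iff.rfl) (fun x₁ x₂ => ⟨(x₁, x₂), rfl, rfl⟩) (h₁.polytope _) (h₂.polytope _)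
  -- If a factor is a point, the reduced product collapses to a point. A coordinate map to a
  -- nontrivial factor then misses one of the bounds, so this case is separate.
  · rcases subsingleton_or_nontrivial P₁ with h | _
    · have := lowerProd_subsingleton (P₁ := P₁) (P₂ := P₂) (.inl h)
      have : Nonempty (LowerProd P₁ P₂) := ⟨⟨(⊥, ⊥), .inl rfl⟩⟩
      exact isCLced_of_subsingleton _ fun p => ⟨⟨(⊥, ⊥), .inl rfl⟩, .inl rfl⟩
    rcases subsingleton_or_nontrivial P₂ with h | _
    · have := lowerProd_subsingleton (P₁ := P₁) (P₂ := P₂) (.inr h)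
      have : Nonempty (LowerProd P₁ P₂) := ⟨⟨(⊥, ⊥), .inl rfl⟩⟩
      exact isCLced_of_subsingleton _ fun p => ⟨⟨(⊥, ⊥), .inl rfl⟩, .inl rfl⟩
    rw [lowerFamily_eq_pairFamily (fun s => (hS₁ s).bot_mem) fun s => (hS₂ s).bot_mem]
    exact (isProductLabeling_lowerLabeling h₁.rank_poset h₂.rank_poset h₁.labeling h₂.labeling
      hj ho₁ ho₂).isCLced LowerProd.isProductLike h₁ h₂ fun p =>
        .lowerProd (hS₁ _).bot_mem (hS₂ _).bot_mem (h₁.polytope _) (h₂.polytope _)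
  · rcases subsingleton_or_nontrivial P₁ with h | _
    · have := upperProd_subsingleton (P₁ := P₁) (P₂ := P₂) (.inl h)
      have : Nonempty (UpperProd P₁ P₂) := ⟨⟨(⊤, ⊤), .inl rfl⟩⟩
      exact isCLced_of_subsingleton _ fun p => ⟨⟨(⊤, ⊤), .inl rfl⟩, .inl rfl⟩
    rcases subsingleton_or_nontrivial P₂ with h | _
    · have := upperProd_subsingleton (P₁ := P₁) (P₂ := P₂) (.inr h)
      have : Nonempty (UpperProd P₁ P₂) := ⟨⟨(⊤, ⊤), .inl rfl⟩⟩
      exact isCLced_of_subsingleton _ fun p => ⟨⟨(⊤, ⊤), .inl rfl⟩, .inl rfl⟩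
    rw [upperFamily_eq_pairFamily (fun s => (hS₁ s).top_mem) fun s => (hS₂ s).top_mem]
    exact (isProductLabeling_upperLabeling h₁.rank_poset h₂.rank_poset h₁.labeling h₂.labeling
      hj ho₁ ho₂).isCLced UpperProd.isProductLike h₁ h₂ fun p =>
        .upperProd (hS₁ _).bot_mem (hS₂ _).bot_mem (hS₁ _).top_mem (hS₂ _).top_mem
          (h₁.polytope _) (h₂.polytope _)
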